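/- Let $k$ be a field and let $\mathcal E$ be an $E_\infty$-operad in cochain complexes of $k$-modules with a fixed morphism of operads $\mathcal E\to\mathcal Z$ to the Eilenberg–Zilber operad $\mathcal Z$, where $\mathcal Z(n)=\mathrm{Hom}_{\Delta}(N_*(\Delta^\bullet),N_*(\Delta^\bullet)^{\otimes n})$ is the complex of natural operations on the normalized chains of the standard simplices. The normalized complex $N(A^\bullet)=\mathrm{Hom}_\Delta(N_*(\Delta^\bullet),A^\bullet)$ of a cosimplicial commutative $k$-algebra is a $\mathcal Z$-algebra, hence an $\mathcal E$-algebra. Let $\mathcal C,\mathcal C'$ be small sites with terminal objects $X,X'$ and with chosen sets $S,S'$ of points that are conservative (a morphism of sheaves of sets is an isomorphism if and only if it is bijective on all stalks at the chosen points). For a sheaf $\mathcal O$ of commutative $k$-algebras on $\mathcal C$ let $p^*\mathcal O=(\mathcal O_x)_{x\in S}$, let $p_*$ be the right adjoint of $p^*$ (the product of skyscraper sheaves), let $G=p_*p^*$ be the Godement monad, and let $G^\bullet\mathcal O$ be the associated cosimplicial resolution, with $G^{n+1}\mathcal O$ in cosimplicial degree $n$. The $\mathcal E$-algebra $R\Gamma(\mathcal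 C,\mathcal O)$ is $(NG^\bullet\mathcal O)(X)$; similarly for $\mathcal C'$. Let $\mathcal O,\mathcal O'$ be sheaves of commutative $k$-algebras on $\mathcal C,\mathcal C'$, and let $f:(\mathcal C,\mathcal O)\to(\mathcal C',\mathcal O')$ be a morphism of ringed sites induced by a continuous functor $u:\mathcal C'\to\mathcal C$; that is, the inverse image functor $f^{-1}$ on sheaves of sets preserves finite limits, and a morphism of sheaves of $k$-algebras $\varphi:\mathcal O'\to f_*\mathcal O$ is given, where $(f_*\mathcal O)(U)=\mathcal O(u(U))$. Then $f$ induces a map of $E_\infty$-algebras $R\Gamma(\mathcal C',\mathcal O')\to R\Gamma(\mathcal C,\mathcal O)$, up to quasi-isomorphism of $E_\infty$-algebras. Precisely, there are an $\mathcal E$-algebra $B$ and morphisms of $\mathcal E$-algebras $$R\Gamma(\mathcal C',\mathcal O')\xrightarrow{\ a\ }B\xleftarrow{\ b\ }R\Gamma(\mathcal C,\mathcal O)$$ such that $b$ is a quasi-isomorphism and $\psi=b^{-1}a$, a morphism in the derived category of $k$-modules, is the natural map of derived global sections. The latter means the following. Let $\mathcal O\to I$ and $\mathcal O'\to I'$ be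 injective resolutions in the categories of sheaves of $k$-modules, let $e:NG^\bullet\mathcal O\to I$ and $e':NG^\bullet\mathcal O'\to I'$ be maps of complexes that are compatible with the augmentations of $\mathcal O$ and $\mathcal O'$, and let $t:I'\to f_*I$ be a map of complexes that lifts $\varphi$. Such resolutions with maps $e,e'$ exist; for any injective resolutions $I,I'$ of $\mathcal O,\mathcal O'$ such a $t$ exists; $e$ and $e'$ induce quasi-isomorphisms $R\Gamma(\mathcal C,\mathcal O)\to I(X)$ and $R\Gamma(\mathcal C',\mathcal O')\to I'(X')$; and for all choices of these data the composites $$R\Gamma(\mathcal C',\mathcal O')\xrightarrow{e'}I'(X')\xrightarrow{t}I(u(X')),\qquad R\Gamma(\mathcal C',\mathcal O')\xrightarrow{\psi}R\Gamma(\mathcal C,\mathcal O)\xrightarrow{e}I(X)\xrightarrow{\mathrm{res}}I(u(X'))$$ agree in the derived category of $k$-modules, where $\mathrm{res}$ is the restriction along the unique map $u(X')\to X$. -/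

import Mathlib

open CategoryTheory Limits Opposite

universe u v w

set_option linter.unusedSectionVars false
set_option linter.unusedVariables false
set_option linter.unnecessarySeqFocus false

namespace EInf

/-!
Contents: the standard simplices and their normalized chains as matrices; operads in cochain
complexes, algebras over them, `E_∞`-operads; the Eilenberg–Zilber operad (natural operations
`N_*(Δ^m) → N_*(Δ^m)^{⊗ n}`); the normalized complex of a cosimplicial commutative algebra with
the action of the Eilenberg–Zilber operad; the cosimplicial Godement resolution of a sheaf of
commutative algebras for a family of points; comparison with injective resolutions.

All complexes are cochain complexes; a chain complex is regraded by `C^d = C_{-d}`.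
-/

/-- The sign `(-1) ^ x` as an element of `k`. -/
def sgn (k : Type u) [CommRing k] (x : ℤ) : k := ((Int.negOnePow x : ℤˣ) : ℤ)

section sgn
variable {k : Type u} [CommRing k]

lemma sgn_add (x y : ℤ) : sgn k (x + y) = sgn k x * sgn k y := by
  simp [sgn, Int.negOnePow_add]

@[simp] lemma sgn_zero : sgn k 0 = 1 := by simp [sgn]

@[simp] lemma sgn_one : sgn k 1 = -1 := by simp [sgn]

lemma sgn_congr {x y : ℤ} (h : Even (x - y)) : sgn k x = sgn k y := by
  rw [sgn, sgn, Int.negOnePow_eq_iff x y |>.2 h]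

lemma sgn_succ (x : ℤ) : sgn k (x + 1) = - sgn k x := by rw [sgn_add, sgn_one]; ring

@[simp] lemma sgn_mul_self (x : ℤ) : sgn k x * sgn k x = 1 := by
  rw [← sgn_add, sgn_congr (y := 0) (by simp), sgn_zero]

end sgn

/-- The faces of the standard `m`-simplex. -/
abbrev Face (m : ℕ) : Type := {s : Finset (Fin (m + 1)) // s.Nonempty}

/-- The dimension of a face. -/
def fdeg {m : ℕ} (s : Face m) : ℤ := (s.1.card : ℤ) - 1

/-- The matrix of the boundary of the normalized chains of the `m`-simplex:
`∂ s = ∑ s', bdry s s' • s'`, where `∂ s = ∑_i (-1) ^ i • (s without its i-th vertex)`. -/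
def bdry (k : Type u) [CommRing k] {m : ℕ} (s s' : Face m) : k :=
  ∑ v ∈ s.1, if s.1.erase v = s'.1 then sgn k ((s.1.filter (· < v)).card) else 0

/-- The matrix of the map of normalized chains induced by a monotone map `θ` of vertices: a face
`s` is sent to the face `θ(s)`, and to `0` if `θ` is not injective on `s`. -/
def push (k : Type u) [CommRing k] {m l : ℕ} (θ : Fin (m + 1) →o Fin (l + 1))
    (s : Face m) (s' : Face l) : k :=
  if Set.InjOn θ s.1 ∧ s.1.image θ = s'.1 then 1 else 0

section faces
variable {k : Type u} [CommRing k]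

lemma bdry_deg {m : ℕ} {s s' : Face m} (h : bdry k s s' ≠ 0) : fdeg s = fdeg s' + 1 := by
  obtain ⟨v, hv, h⟩ := Finset.exists_ne_zero_of_sum_ne_zero h
  have h1 : s.1.erase v = s'.1 := by by_contra h1; simp [h1] at h
  have := Finset.card_erase_add_one hv
  rw [h1] at this
  simp only [fdeg]; omega

lemma push_deg {m l : ℕ} {θ : Fin (m + 1) →o Fin (l + 1)} {s : Face m} {s' : Face l}
    (h : push k θ s s' ≠ 0) : fdeg s' = fdeg s := by
  classical
  have h1 : Set.InjOn θ s.1 ∧ s.1.image θ = s'.1 := by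
    by_contra h1; exact h (if_neg (by convert h1))
  simp only [fdeg]
  rw [← h1.2, Finset.card_image_of_injOn h1.1]

lemma sum_bdry_mul {m : ℕ} (s : Face m) (f : Finset (Fin (m + 1)) → k) (hf : f ∅ = 0) :
    ∑ s' : Face m, bdry k s s' * f s'.1 =
      ∑ v ∈ s.1, sgn k ((s.1.filter (· < v)).card) * f (s.1.erase v) := by
  simp only [bdry, Finset.sum_mul]
  rw [Finset.sum_comm]
  refine Finset.sum_congr rfl fun v hv => ?_
  by_cases h : (s.1.erase v).Nonempty
  · rw [Finset.sum_eq_single ⟨_, h⟩]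
    · simp
    · intro b _ hb
      rw [if_neg, zero_mul]
      exact fun h' => hb (Subtype.ext h'.symm)
    · simp
  · rw [Finset.not_nonempty_iff_eq_empty.1 h, hf, mul_zero]
    refine Finset.sum_eq_zero fun b _ => ?_
    rw [if_neg, zero_mul]
    exact fun h' => b.2.ne_empty h'.symm

lemma bdry_bdry {m : ℕ} (s s'' : Face m) : ∑ s', bdry k s s' * bdry k s' s'' = 0 := by
  classical
  have := sum_bdry_mul (k := k) s (fun t => ∑ v ∈ t, if t.erase v = s''.1 then
    sgn k ((t.filter (· < v)).card) else 0) (by simp)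
  refine this.trans ?_
  simp only [Finset.mul_sum]
  rw [Finset.sum_sigma']
  refine Finset.sum_involution (fun p _ => ⟨p.2, p.1⟩) ?_ ?_ ?_ ?_
  · rintro ⟨v, w⟩ hp
    simp only [Finset.mem_sigma, Finset.mem_erase] at hp
    obtain ⟨hv, hwv, hw⟩ := hp
    dsimp only
    rw [Finset.erase_right_comm]
    by_cases h : (s.1.erase w).erase v = s''.1
    · simp only [h, if_true, ← sgn_add]
      have key : ∀ a b : Fin (m + 1), a ∈ s.1 → b ∈ s.1 → a < b →
          sgn k (((s.1.filter (· < a)).card : ℤ) + (((s.1.erase a).filter (· < b)).card : ℤ)) +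
          sgn k (((s.1.filter (· < b)).card : ℤ) + (((s.1.erase b).filter (· < a)).card : ℤ)) = 0 := by
        intro a b ha hb hab
        have h1 : (s.1.erase b).filter (· < a) = s.1.filter (· < a) := by
          ext x; simp only [Finset.mem_filter, Finset.mem_erase]
          constructor
          · tauto
          · rintro ⟨hx, hxa⟩; exact ⟨⟨(hxa.trans hab).ne, hx⟩, hxa⟩
        have h2 : (s.1.erase a).filter (· < b) = (s.1.filter (· < b)).erase a := by
          ext x; simp only [Finset.mem_filter, Finset.mem_erase]; tauto
        have h3 : ((s.1.filter (· < b)).erase a).card + 1 = (s.1.filter (· < b)).card :=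
          Finset.card_erase_add_one (by simp [ha, hab])
        rw [h1, h2, ← h3]
        push_cast
        rw [show (((s.1.filter (· < b)).erase a).card : ℤ) + 1 + ((s.1.filter (· < a)).card : ℤ) =
          ((s.1.filter (· < a)).card : ℤ) + (((s.1.filter (· < b)).erase a).card : ℤ) + 1 by ring,
          sgn_succ]
        ring
      rcases lt_or_gt_of_ne hwv with h' | h'
      · rw [add_comm]; exact key w v hw hv h'
      · exact key v w hv hw h'
    · simp [h]
  · rintro ⟨v, w⟩ hp _ h
    simp only [Finset.mem_sigma, Finset.mem_erase] at hp
    simp only [Sigma.mk.injEq, heq_eq_eq] at h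
    exact hp.2.1 h.1
  · rintro ⟨v, w⟩ hp
    simp only [Finset.mem_sigma, Finset.mem_erase] at hp ⊢
    exact ⟨hp.2.2, hp.2.1.symm, hp.1⟩
  · rintro ⟨v, w⟩ hp; rfl

lemma sum_push_mul {m l : ℕ} (θ : Fin (m + 1) →o Fin (l + 1)) (s : Face m)
    (f : Face l → k) :
    ∑ s', push k θ s s' * f s' =
      if Set.InjOn θ s.1 then f ⟨s.1.image θ, s.2.image θ⟩ else 0 := by
  classical
  by_cases h : Set.InjOn θ s.1
  · rw [Finset.sum_eq_single ⟨s.1.image θ, s.2.image θ⟩]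
    · simp [push, h]
    · intro b _ hb
      have : ¬ (s.1.image θ = b.1) := fun h' => hb (Subtype.ext h'.symm)
      simp [push, this]
    · simp
  · simp [push, h]

lemma bdry_push {m l : ℕ} (θ : Fin (m + 1) →o Fin (l + 1)) (s : Face m) (y : Face l) :
    ∑ s', bdry k s s' * push k θ s' y = ∑ s', push k θ s s' * bdry k s' y := by
  classical
  rw [sum_push_mul]
  have := sum_bdry_mul (k := k) s
    (fun t => if Set.InjOn θ t ∧ t.image θ = y.1 then 1 else 0)
    (by rw [if_neg]; rintro ⟨-, h⟩; exact y.2.ne_empty h.symm)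
  have e : ∑ s', bdry k s s' * push k θ s' y = _ := Eq.trans (by
    refine Finset.sum_congr rfl fun s' _ => ?_
    rw [push]) this
  rw [e]
  by_cases h : Set.InjOn θ s.1
  · rw [if_pos h, bdry, Finset.sum_image h]
    refine Finset.sum_congr rfl fun v hv => ?_
    have h1 : Set.InjOn θ (s.1.erase v) := h.mono (by simp)
    have h2 : (s.1.erase v).image θ = (s.1.image θ).erase (θ v) := by
      ext x
      simp only [Finset.mem_image, Finset.mem_erase]
      constructor
      · rintro ⟨a, ⟨h3, h4⟩, rfl⟩
        exact ⟨fun h5 => h3 (h h4 hv h5), a, h4, rfl⟩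
      · rintro ⟨h3, a, h4, rfl⟩
        exact ⟨a, ⟨fun h5 => h3 (by rw [h5]), h4⟩, rfl⟩
    have h3 : (s.1.image θ).filter (· < θ v) = (s.1.filter (· < v)).image θ := by
      ext x
      simp only [Finset.mem_image, Finset.mem_filter]
      constructor
      · rintro ⟨⟨a, h4, rfl⟩, h5⟩
        exact ⟨a, ⟨h4, lt_of_not_ge fun h6 => absurd (θ.monotone h6) (not_le.2 h5)⟩, rfl⟩
      · rintro ⟨a, ⟨h4, h5⟩, rfl⟩
        exact ⟨⟨a, h4, rfl⟩, lt_of_le_of_ne (θ.monotone h5.le) fun h6 => h5.ne (h h4 hv h6)⟩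
    have h4 : (s.1.filter (· < v)).card = ((s.1.image θ).filter (· < θ v)).card := by
      rw [h3, Finset.card_image_of_injOn (h.mono (by intro x hx; simp at hx; exact hx.1))]
    simp only [h1, true_and, h2, h4]
    split_ifs <;> simp
  · rw [if_neg h]
    obtain ⟨a, ha, b, hb, hab, hne⟩ : ∃ a ∈ s.1, ∃ b ∈ s.1, a < b ∧ θ a = θ b := by
      simp only [Set.InjOn, not_forall] at h
      obtain ⟨a, ha, b, hb, h1, h2⟩ := h
      rcases lt_or_gt_of_ne h2 with h3 | h3
      · exact ⟨a, ha, b, hb, h3, h1⟩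
      · exact ⟨b, hb, a, ha, h3, h1.symm⟩
    have h0 : ∀ v ∈ s.1, v ≠ a → v ≠ b → ¬ Set.InjOn θ (s.1.erase v) := by
      intro v _ hva hvb hi
      exact hab.ne (hi (by simp [ha, hva.symm]) (by simp [hb, hvb.symm]) hne)
    rw [← Finset.sum_subset (s₁ := {a, b}) (by simp [Finset.insert_subset_iff, ha, hb])]
    · rw [Finset.sum_pair hab.ne]
      by_cases hc : ∃ c ∈ s.1, a < c ∧ c < b
      · obtain ⟨c, hc, hac, hcb⟩ := hc
        have e1 : θ c = θ b := le_antisymm (θ.monotone hcb.le) (hne ▸ θ.monotone hac.le)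
        have i1 : ¬ Set.InjOn θ (s.1.erase a) := fun hi =>
          hcb.ne (hi (by simp [hc, hac.ne']) (by simp [hb, hab.ne']) e1)
        have i2 : ¬ Set.InjOn θ (s.1.erase b) := fun hi =>
          hac.ne (hi (by simp [ha, hab.ne]) (by simp [hc, hcb.ne]) (hne.trans e1.symm))
        rw [if_neg fun h => i1 h.1, if_neg fun h => i2 h.1]
        simp
      · push Not at hc
        have e1 : s.1.filter (· < b) = insert a (s.1.filter (· < a)) := by
          ext x
          simp only [Finset.mem_filter, Finset.mem_insert]
          constructor
          · rintro ⟨hx, hxb⟩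
            rcases lt_trichotomy x a with h1 | h1 | h1
            · exact Or.inr ⟨hx, h1⟩
            · exact Or.inl h1
            · exact absurd hxb (not_lt.2 (hc x hx h1))
          · rintro (rfl | ⟨hx, hxa⟩)
            · exact ⟨ha, hab⟩
            · exact ⟨hx, hxa.trans hab⟩
        have e2 : (s.1.filter (· < b)).card = (s.1.filter (· < a)).card + 1 := by
          rw [e1, Finset.card_insert_of_notMem (by simp)]
        have e3 : (s.1.erase a).image θ = (s.1.erase b).image θ := by
          ext x
          simp only [Finset.mem_image, Finset.mem_erase]
          constructor
          · rintro ⟨c, ⟨h1, h2⟩, rfl⟩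
            by_cases h3 : c = b
            · exact ⟨a, ⟨hab.ne, ha⟩, by rw [h3, hne]⟩
            · exact ⟨c, ⟨h3, h2⟩, rfl⟩
          · rintro ⟨c, ⟨h1, h2⟩, rfl⟩
            by_cases h3 : c = a
            · exact ⟨b, ⟨hab.ne', hb⟩, by rw [h3, hne]⟩
            · exact ⟨c, ⟨h3, h2⟩, rfl⟩
        have e4 : Set.InjOn θ (s.1.erase a) ↔ Set.InjOn θ (s.1.erase b) := by
          rw [← Finset.card_image_iff, ← Finset.card_image_iff, e3,
            Finset.card_erase_of_mem ha, Finset.card_erase_of_mem hb]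
        simp only [e2, e3, e4]
        push_cast
        rw [sgn_succ]
        ring
    · intro v hv hv'
      simp only [Finset.mem_insert, Finset.mem_singleton, not_or] at hv'
      rw [if_neg, mul_zero]
      exact fun h' => h0 v hv hv'.1 hv'.2 h'.1

end faces

/-- The inputs of a partial composite `p ∘_i q`, where `p` has `n` and `q` has `m` inputs, are the
inputs of `p` other than `i`, with those of `q` inserted at the position `i`. -/
def compSlot {n m l : ℕ} (i : Fin n) (h : l + 1 = n + m) :
    {j : Fin n // j ≠ i} ⊕ Fin m ≃ Fin l where
  toFun := Sum.elim
    (fun j => if hj : j.1 < i then ⟨j.1, by have := i.2; omega⟩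
      else ⟨j.1 + m - 1, by
        have h1 := j.2; have h2 := j.1.2; have : j.1.1 ≠ i.1 := fun h => h1 (Fin.ext h)
        omega⟩)
    (fun b => ⟨i + b, by have := i.2; have := b.2; omega⟩)
  invFun c := if h1 : c.1 < i then Sum.inl ⟨⟨c, by omega⟩, fun h => by simp [← h] at h1⟩
    else if h2 : c.1 < i + m then Sum.inr ⟨c - i, by omega⟩
    else Sum.inl ⟨⟨c + 1 - m, by omega⟩, fun h => by have := congrArg Fin.val h; simp at this; omega⟩
  left_inv x := by
    rcases x with ⟨j, hj⟩ | b
    · have : j.1 ≠ i.1 := fun h => hj (Fin.ext h)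
      by_cases h : j < i
      · simp [h]
      · have h' : ¬ j.1 < i.1 := h
        have h1 : ¬ (j.1 + m - 1 < i.1) := by omega
        have h2 : ¬ (j.1 + m - 1 < i.1 + m) := by omega
        simp only [Sum.elim_inl, h, dite_false, h1, h2]
        congr 2
        apply Fin.ext
        simp; omega
    · simp
  right_inv c := by
    by_cases h1 : c.1 < i.1
    · have h3 : (⟨c.1, by omega⟩ : Fin n) < i := h1
      simp only [h1, dite_true, Sum.elim_inl, h3]
    · by_cases h2 : c.1 < i.1 + m
      · simp only [h1, h2, dite_true, dite_false, Sum.elim_inr]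
        exact Fin.ext (by simp; omega)
      · have h3 : ¬ (⟨c.1 + 1 - m, by omega⟩ : Fin n) < i := by
          simp only [Fin.lt_def]; omega
        simp only [h1, h2, dite_false, Sum.elim_inl, h3]
        exact Fin.ext (by simp; omega)

/-- The permutation `σ ∘_i τ` of the inputs of a partial composite: it carries the inputs of
`p ∘_{σ⁻¹ i} q` to those of `p ∘_i q`, by `σ` on the inputs of `p` and by `τ` on those of `q`. -/
def compPerm {n m l : ℕ} (i : Fin n) (h : l + 1 = n + m)
    (σ : Equiv.Perm (Fin n)) (τ : Equiv.Perm (Fin m)) : Equiv.Perm (Fin l) :=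
  (compSlot (σ.symm i) h).symm.trans
    ((Equiv.sumCongr (σ.subtypeEquiv (fun j => by simp [Equiv.eq_symm_apply])) τ).trans
      (compSlot i h))

section coend

/-- The product of two matrices. -/
def mmul {k : Type u} [CommRing k] {α β γ : Type} [Fintype β]
    (f : α → β → k) (g : β → γ → k) : α → γ → k := fun a c => ∑ b, f a b * g b c

variable {k : Type u} [CommRing k] {α : Type} [Fintype α] [DecidableEq α] (deg : α → ℤ)

/-- total degree of the entries in positions `< c` -/
def pre {l : ℕ} (x : Fin l → α) (c : ℕ) : ℤ := ∑ a : Fin l, if a.1 < c then deg (x a) else 0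

/-- The matrix of the boundary of the `n`-th tensor power of a chain complex with graded basis `α`
and boundary matrix `bd`, with the Koszul sign rule. -/
def bdT (bd : α → α → k) (n : ℕ) : (Fin n → α) → (Fin n → α) → k := fun t x =>
  ∑ j, if ∀ i, i ≠ j → t i = x i then sgn k (pre deg x j) * bd (t j) (x j) else 0

/-- The matrix of `1 ⊗ … ⊗ w ⊗ … ⊗ 1` with `w : N → N^{⊗ m}` of cohomological degree `d` in the
slot `i`; the sign is from moving `w` past the elements in the slots before `i`. -/
def insM {n m l : ℕ} (d : ℤ) (i : Fin n) (h : l + 1 = n + m) (w : α → (Fin m → α) → k) :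
    (Fin n → α) → (Fin l → α) → k := fun t x =>
  if ∀ j : {j // j ≠ i}, t j = x (compSlot i h (Sum.inl j)) then
    sgn k (d * pre deg x i) * w (t i) (fun b => x (compSlot i h (Sum.inr b))) else 0

lemma pre_congr {deg : α → ℤ} {l : ℕ} {x y : Fin l → α} {c : ℕ} (h : ∀ a : Fin l, a.1 < c → deg (x a) = deg (y a)) :
    pre deg x c = pre deg y c := by
  refine Finset.sum_congr rfl fun a _ => ?_
  by_cases ha : a.1 < c
  · simp [ha, h a ha]
  · simp [ha]

/-- The tuple with `s` in the slot `i` and the entries of `x` outside the inserted block. -/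
def outer {n m l : ℕ} (i : Fin n) (h : l + 1 = n + m) (x : Fin l → α) (s : α) : Fin n → α :=
  fun j => if hj : j = i then s else x (compSlot i h (Sum.inl ⟨j, hj⟩))

lemma sum_insM {n m l : ℕ} (d : ℤ) (i : Fin n) (h : l + 1 = n + m) (w : α → (Fin m → α) → k)
    (F : (Fin n → α) → k) (x : Fin l → α) :
    ∑ t, F t * insM deg d i h w t x = ∑ s, F (outer i h x s) *
      (sgn k (d * pre deg x i) * w s (fun b => x (compSlot i h (Sum.inr b)))) := by
  rw [← (Equiv.funSplitAt i α).symm.sum_comp, Fintype.sum_prod_type]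
  refine Finset.sum_congr rfl fun s _ => ?_
  rw [Finset.sum_eq_single (fun j => x (compSlot i h (Sum.inl j)))]
  · rw [insM, if_pos]
    · have : (Equiv.funSplitAt i α).symm (s, fun j => x (compSlot i h (Sum.inl j))) =
          outer i h x s := by
        funext j; simp [outer, Equiv.funSplitAt]
      rw [this]
      simp [outer]
    · rintro ⟨j, hj⟩; simp [Equiv.funSplitAt, hj]
  · intro g _ hg
    rw [insM, if_neg, mul_zero]
    intro h'
    apply hg
    funext j
    have := h' j
    simpa [Equiv.funSplitAt, j.2] using this
  · simp

lemma sum_bdT (bd : α → α → k) (n : ℕ) (F : (Fin n → α) → k) (x : Fin n → α) :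
    ∑ t, F t * bdT deg bd n t x = ∑ j, ∑ y, F (Function.update x j y) *
      (sgn k (pre deg x j) * bd y (x j)) := by
  simp only [bdT, Finset.mul_sum]
  rw [Finset.sum_comm]
  refine Finset.sum_congr rfl fun j _ => ?_
  rw [← (Equiv.funSplitAt j α).symm.sum_comp, Fintype.sum_prod_type]
  refine Finset.sum_congr rfl fun s _ => ?_
  rw [Finset.sum_eq_single (fun i : {i // i ≠ j} => x i)]
  · rw [if_pos]
    · have : (Equiv.funSplitAt j α).symm (s, fun i : {i // i ≠ j} => x i) =
          Function.update x j s := by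
        funext i
        by_cases hi : i = j
        · subst hi; simp [Equiv.funSplitAt]
        · simp [Equiv.funSplitAt, hi]
      rw [this]
      simp
    · intro i hi; simp [Equiv.funSplitAt, hi]
  · intro g _ hg
    rw [if_neg, mul_zero]
    intro h'
    apply hg
    funext i
    have := h' i i.2
    simpa [Equiv.funSplitAt, i.2] using this
  · simp

lemma pre_update_of_le {n : ℕ} (x : Fin n → α) (j : Fin n) (y : α) {c : ℕ} (h : c ≤ j.1) :
    pre deg (Function.update x j y) c = pre deg x c := by
  refine pre_congr fun a ha => ?_
  rw [Function.update_of_ne]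
  rintro rfl; omega

lemma pre_update_of_lt {n : ℕ} (x : Fin n → α) (j : Fin n) (y : α) {c : ℕ} (h : j.1 < c) :
    pre deg (Function.update x j y) c = pre deg x c + (deg y - deg (x j)) := by
  rw [pre, pre, ← sub_eq_iff_eq_add', ← Finset.sum_sub_distrib, Finset.sum_eq_single j]
  · simp [h]
  · intro b _ hb; simp [Function.update_of_ne hb]
  · simp

lemma bdT_bdT {bd : α → α → k} (hd : ∀ s s', bd s s' ≠ 0 → deg s = deg s' + 1)
    (hbd : mmul bd bd = 0) (n : ℕ) : mmul (bdT deg bd n) (bdT deg bd n) = 0 := by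
  ext t x
  rw [mmul, sum_bdT]
  have h1 : ∀ j y, bdT deg bd n t (Function.update x j y) * (sgn k (pre deg x j) * bd y (x j)) =
      ∑ j', (if ∀ i, i ≠ j' → t i = Function.update x j y i then
        sgn k (pre deg (Function.update x j y) j') * bd (t j') (Function.update x j y j') else 0) *
        (sgn k (pre deg x j) * bd y (x j)) := by
    intro j y; rw [bdT, Finset.sum_mul]
  simp only [h1]
  have h2 : ∀ j, ∑ y, ∑ j', (if ∀ i, i ≠ j' → t i = Function.update x j y i then
        sgn k (pre deg (Function.update x j y) j') * bd (t j') (Function.update x j y j') else 0) *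
        (sgn k (pre deg x j) * bd y (x j)) =
      ∑ j', if j' = j then 0 else (if ∀ i, i ≠ j → i ≠ j' → t i = x i then
        sgn k (pre deg (Function.update x j (t j)) j') * bd (t j') (x j') *
          (sgn k (pre deg x j) * bd (t j) (x j)) else 0) := by
    intro j
    rw [Finset.sum_comm]
    refine Finset.sum_congr rfl fun j' _ => ?_
    by_cases hj : j' = j
    · subst hj
      simp only [if_true, Function.update_self]
      by_cases hc : ∀ i, i ≠ j' → t i = x i
      · have : ∀ y, (∀ i, i ≠ j' → t i = Function.update x j' y i) := fun y i hi => by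
          rw [Function.update_of_ne hi]; exact hc i hi
        simp only [if_pos (this _), pre_update_of_le deg x j' _ le_rfl]
        have e := congrFun (congrFun hbd (t j')) (x j')
        rw [mmul] at e
        calc _ = ∑ y, (sgn k (pre deg x j') * sgn k (pre deg x j')) * (bd (t j') y * bd y (x j')) :=
              Finset.sum_congr rfl fun y _ => by ring
          _ = 0 := by rw [← Finset.mul_sum, e]; simp
      · refine Finset.sum_eq_zero fun y _ => ?_
        rw [if_neg, zero_mul]
        intro h; apply hc; intro i hi; rw [h i hi, Function.update_of_ne hi]
    · rw [if_neg hj, Finset.sum_eq_single (t j)]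
      · by_cases hc : ∀ i, i ≠ j → i ≠ j' → t i = x i
        · rw [if_pos hc, if_pos]
          · rw [Function.update_of_ne hj]
          · intro i hi
            by_cases hij : i = j
            · subst hij; simp
            · rw [Function.update_of_ne hij]; exact hc i hij hi
        · rw [if_neg hc, if_neg, zero_mul]
          intro h; apply hc; intro i h1 h2; rw [h i h2, Function.update_of_ne h1]
      · intro y _ hy
        rw [if_neg, zero_mul]
        intro h
        apply hy
        rw [h j (Ne.symm hj)]; simp
      · simp
  simp only [h2]
  rw [← Finset.sum_product']
  refine Finset.sum_involution (fun p _ => (p.2, p.1)) ?_ ?_ (by simp) (by simp)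
  · rintro ⟨j, j'⟩ -
    dsimp only
    by_cases hj : j' = j
    · simp [hj]
    · rw [if_neg hj, if_neg (Ne.symm hj)]
      by_cases hc : ∀ i, i ≠ j → i ≠ j' → t i = x i
      · rw [if_pos hc, if_pos fun i h1 h2 => hc i h2 h1]
        by_cases h3 : bd (t j) (x j) = 0
        · simp [h3]
        by_cases h4 : bd (t j') (x j') = 0
        · simp [h4]
        have h3 := hd _ _ h3
        have h4 := hd _ _ h4
        rcases lt_or_gt_of_ne hj with h5 | h5
        · rw [pre_update_of_le deg x j _ h5.le, pre_update_of_lt deg x j' _ h5, h4,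
            add_sub_cancel_left, sgn_succ]
          ring
        · rw [pre_update_of_lt deg x j _ h5, pre_update_of_le deg x j' _ h5.le, h3,
            add_sub_cancel_left, sgn_succ]
          ring
      · rw [if_neg hc, if_neg fun h => hc fun i h1 h2 => h i h2 h1, add_zero]
  · rintro ⟨j, j'⟩ - h h'
    simp only [Prod.mk.injEq] at h'
    exact h (if_pos h'.1)

end coend

section slots
variable {n m l : ℕ} (i : Fin n) (h : l + 1 = n + m)

lemma slot_inr (b : Fin m) : (compSlot i h (Sum.inr b)).1 = i + b := rfl

lemma slot_inl_of_lt (j : {j // j ≠ i}) (hj : j.1 < i) :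
    (compSlot i h (Sum.inl j)).1 = j.1 := by
  simp [compSlot, hj]

lemma slot_inl_of_gt (j : {j // j ≠ i}) (hj : i < j.1) :
    (compSlot i h (Sum.inl j)).1 + 1 = j.1 + m := by
  have : ¬ j.1 < i := by omega
  simp [compSlot, this]; omega

lemma slot_inl_cases (j : {j // j ≠ i}) :
    (j.1.1 < i.1 ∧ (compSlot i h (Sum.inl j)).1 = j.1) ∨
    (i.1 < j.1.1 ∧ (compSlot i h (Sum.inl j)).1 + 1 = j.1 + m) := by
  rcases lt_or_gt_of_ne j.2 with h1 | h1
  · exact Or.inl ⟨h1, slot_inl_of_lt i h j h1⟩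
  · exact Or.inr ⟨h1, slot_inl_of_gt i h j h1⟩

lemma slot_inl_lt_inl (j j' : {j // j ≠ i}) :
    (compSlot i h (Sum.inl j)).1 < (compSlot i h (Sum.inl j')).1 ↔ j.1.1 < j'.1.1 := by
  have := slot_inl_cases i h j; have := slot_inl_cases i h j'; omega

lemma slot_inl_lt (j : {j // j ≠ i}) : (compSlot i h (Sum.inl j)).1 < i.1 ↔ j.1.1 < i.1 := by
  have := slot_inl_cases i h j; omega

lemma slot_inr_lt (b : Fin m) : (compSlot i h (Sum.inr b)).1 < i.1 ↔ False := by
  rw [iff_false, slot_inr]; omega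

lemma slot_inl_lt_inr (j : {j // j ≠ i}) (b : Fin m) :
    (compSlot i h (Sum.inl j)).1 < (compSlot i h (Sum.inr b)).1 ↔ j.1.1 < i.1 := by
  have := slot_inl_cases i h j; have := slot_inr i h b; have := b.2; omega

lemma slot_inr_lt_inl (j : {j // j ≠ i}) (b : Fin m) :
    (compSlot i h (Sum.inr b)).1 < (compSlot i h (Sum.inl j)).1 ↔ i.1 < j.1.1 := by
  have := slot_inl_cases i h j; have := slot_inr i h b; have := b.2; omega

lemma slot_inr_lt_inr (b b' : Fin m) :
    (compSlot i h (Sum.inr b)).1 < (compSlot i h (Sum.inr b')).1 ↔ b.1 < b'.1 := by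
  have := slot_inr i h b; have := slot_inr i h b'; omega

lemma sum_slot {M : Type*} [AddCommMonoid M] (f : Fin l → M) :
    ∑ c, f c = ∑ j : {j // j ≠ i}, f (compSlot i h (Sum.inl j)) +
      ∑ b, f (compSlot i h (Sum.inr b)) := by
  rw [← (compSlot i h).sum_comp, Fintype.sum_sum_type]

lemma prod_slot {M : Type*} [CommMonoid M] (f : Fin l → M) :
    ∏ c, f c = (∏ j : {j // j ≠ i}, f (compSlot i h (Sum.inl j))) *
      ∏ b, f (compSlot i h (Sum.inr b)) := by
  rw [← (compSlot i h).prod_comp, Fintype.prod_sum_type]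

end slots

section coend
variable {k : Type u} [CommRing k] {α : Type} (deg : α → ℤ)

lemma outer_self {n m l : ℕ} (i : Fin n) (h : l + 1 = n + m) (x : Fin l → α) (s : α) :
    outer i h x s i = s := by simp [outer]

lemma outer_ne {n m l : ℕ} (i : Fin n) (h : l + 1 = n + m) (x : Fin l → α) (s : α)
    (j : {j // j ≠ i}) : outer i h x s j = x (compSlot i h (Sum.inl j)) := by
  simp [outer, j.2]

lemma pre_outer {n m l : ℕ} (i : Fin n) (h : l + 1 = n + m) (x : Fin l → α) (s : α) (c : ℕ) :
    pre deg (outer i h x s) c = (if i.1 < c then deg s else 0) +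
      ∑ j : {j // j ≠ i}, if j.1.1 < c then deg (x (compSlot i h (Sum.inl j))) else 0 := by
  rw [pre, Fintype.sum_eq_add_sum_subtype_ne _ i, outer_self]
  simp only [outer_ne]

lemma pre_self {n m l : ℕ} (i : Fin n) (h : l + 1 = n + m) (x : Fin l → α) :
    pre deg x i = ∑ j : {j // j ≠ i}, if j.1.1 < i.1 then
      deg (x (compSlot i h (Sum.inl j))) else 0 := by
  rw [pre, sum_slot i h]
  simp only [slot_inr_lt, slot_inl_lt, if_false, Finset.sum_const_zero, add_zero]

lemma pre_outer_self {n m l : ℕ} (i : Fin n) (h : l + 1 = n + m) (x : Fin l → α) (s : α) :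
    pre deg (outer i h x s) i = pre deg x i := by
  rw [pre_outer, pre_self deg i h x]; simp

lemma pre_inr {n m l : ℕ} (i : Fin n) (h : l + 1 = n + m) (x : Fin l → α) (b : Fin m) :
    pre deg x (compSlot i h (Sum.inr b)) =
      pre deg x i + pre deg (fun b => x (compSlot i h (Sum.inr b))) b := by
  rw [pre, sum_slot i h, pre_self deg i h x, pre]
  simp only [slot_inl_lt_inr, slot_inr_lt_inr]

lemma pre_inl {n m l : ℕ} (i : Fin n) (h : l + 1 = n + m) (x : Fin l → α) (s : α)
    (j : {j // j ≠ i}) :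
    pre deg x (compSlot i h (Sum.inl j)) = pre deg (outer i h x s) j +
      if i.1 < j.1.1 then (∑ b, deg (x (compSlot i h (Sum.inr b))) - deg s) else 0 := by
  rw [pre, sum_slot i h, pre_outer]
  simp only [slot_inl_lt_inl, slot_inr_lt_inl]
  split_ifs <;> simp <;> ring

variable [Fintype α] [DecidableEq α]

lemma mmul_assoc {α β γ δ : Type} [Fintype β] [Fintype γ] (f : α → β → k) (g : β → γ → k)
    (g' : γ → δ → k) : mmul (mmul f g) g' = mmul f (mmul g g') := by
  funext a d
  simp only [mmul, Finset.sum_mul, Finset.mul_sum]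
  rw [Finset.sum_comm]
  simp only [mul_assoc]

/-- The matrix of an operation `N → N^{⊗ m}` is homogeneous of cohomological degree `d`, that is, it
lowers the chain degree by `d`. -/
def OpDeg {m : ℕ} (d : ℤ) (w : α → (Fin m → α) → k) : Prop :=
  ∀ s x, w s x ≠ 0 → ∑ j, deg (x j) = deg s - d

lemma insM_bdT {n m l : ℕ} {bd : α → α → k} (hbd : ∀ s s', bd s s' ≠ 0 → deg s = deg s' + 1)
    (d : ℤ) (i : Fin n) (h : l + 1 = n + m) (w : α → (Fin m → α) → k) (hw : OpDeg deg d w) :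
    mmul (insM deg d i h w) (bdT deg bd l) =
      insM deg (d + 1) i h (mmul w (bdT deg bd m) - sgn k d • mmul bd w) +
        sgn k d • mmul (bdT deg bd n) (insM deg d i h w) := by
  funext t x
  simp only [mmul, Pi.add_apply, Pi.smul_apply, smul_eq_mul]
  rw [sum_bdT, sum_insM, sum_slot i h]
  simp only [bdT, Finset.sum_mul]
  rw [Finset.sum_comm (s := Finset.univ (α := α)), Fintype.sum_eq_add_sum_subtype_ne _ i, mul_add]
  -- the three matching pieces
  have e1 : ∑ b, ∑ y, insM deg d i h w t (Function.update x (compSlot i h (Sum.inr b)) y) *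
      (sgn k (pre deg x (compSlot i h (Sum.inr b))) * bd y (x (compSlot i h (Sum.inr b)))) =
      insM deg (d + 1) i h (mmul w (bdT deg bd m)) t x := by
    have hu : ∀ b y (j : {j // j ≠ i}), Function.update x (compSlot i h (Sum.inr b)) y
        (compSlot i h (Sum.inl j)) = x (compSlot i h (Sum.inl j)) := fun b y j => by
      rw [Function.update_of_ne]; simp
    have hv : ∀ b y, (fun b' => Function.update x (compSlot i h (Sum.inr b)) y
        (compSlot i h (Sum.inr b'))) =
        Function.update (fun b' => x (compSlot i h (Sum.inr b'))) b y := fun b y => by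
      funext b'
      by_cases hb : b' = b
      · subst hb; simp
      · rw [Function.update_of_ne, Function.update_of_ne hb]; simpa using hb
    simp only [insM, hu, hv]
    by_cases hc : ∀ j : {j // j ≠ i}, t j = x (compSlot i h (Sum.inl j))
    · simp only [if_pos hc, mmul]
      rw [sum_bdT, Finset.mul_sum]
      refine Finset.sum_congr rfl fun b _ => ?_
      rw [Finset.mul_sum]
      refine Finset.sum_congr rfl fun y _ => ?_
      rw [pre_inr, pre_update_of_le deg x _ _ (by rw [slot_inr]; omega), sgn_add, add_mul, sgn_add,
        one_mul]
      ring
    · simp only [if_neg hc, zero_mul, Finset.sum_const_zero]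
  have e2 : sgn k d * ∑ s, (if ∀ i', i' ≠ i → t i' = outer i h x s i' then
      sgn k (pre deg (outer i h x s) i) * bd (t i) (outer i h x s i) else 0) *
      (sgn k (d * pre deg x i) * w s fun b => x (compSlot i h (Sum.inr b))) =
      insM deg (d + 1) i h (sgn k d • mmul bd w) t x := by
    have hc' : ∀ s, (∀ i', i' ≠ i → t i' = outer i h x s i') ↔
        ∀ j : {j // j ≠ i}, t j = x (compSlot i h (Sum.inl j)) := fun s =>
      ⟨fun H j => by rw [H j j.2, outer_ne], fun H j hj => by
        rw [outer_ne i h x s ⟨j, hj⟩]; exact H ⟨j, hj⟩⟩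
    simp only [hc', insM, pre_outer_self, outer_self]
    by_cases hc : ∀ j : {j // j ≠ i}, t j = x (compSlot i h (Sum.inl j))
    · simp only [if_pos hc, mmul, Pi.smul_apply, smul_eq_mul, Finset.mul_sum]
      refine Finset.sum_congr rfl fun s _ => ?_
      rw [add_mul, sgn_add, one_mul]; ring
    · simp only [if_neg hc, zero_mul, Finset.sum_const_zero, mul_zero]
  have e3 : ∀ j : {j // j ≠ i},
      ∑ y, insM deg d i h w t (Function.update x (compSlot i h (Sum.inl j)) y) *
      (sgn k (pre deg x (compSlot i h (Sum.inl j))) * bd y (x (compSlot i h (Sum.inl j)))) =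
      sgn k d * ∑ s, (if ∀ i', i' ≠ j.1 → t i' = outer i h x s i' then
        sgn k (pre deg (outer i h x s) j) * bd (t j) (outer i h x s j) else 0) *
        (sgn k (d * pre deg x i) * w s fun b => x (compSlot i h (Sum.inr b))) := by
    intro j
    have hu : ∀ y, (fun b' => Function.update x (compSlot i h (Sum.inl j)) y
        (compSlot i h (Sum.inr b'))) = fun b' => x (compSlot i h (Sum.inr b')) := fun y => by
      funext b'; rw [Function.update_of_ne]; simp
    rw [Finset.sum_eq_single (t j), Finset.sum_eq_single (t i)]
    · simp only [insM, hu]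
      by_cases hc : ∀ j' : {j // j ≠ i}, j' ≠ j → t j' = x (compSlot i h (Sum.inl j'))
      · rw [if_pos, if_pos]
        · by_cases hb : bd (t j) (x (compSlot i h (Sum.inl j))) = 0
          · simp [outer_ne, hb]
          by_cases hw0 : (w (t i) fun b => x (compSlot i h (Sum.inr b))) = 0
          · simp [hw0]
          have hb' := hbd _ _ hb
          have hw' := hw _ _ hw0
          rw [outer_ne, pre_inl deg i h x (t i) j, hw']
          rcases lt_or_gt_of_ne (Fin.val_ne_of_ne j.2) with h1 | h1
          · rw [if_neg (by omega), pre_update_of_lt deg x _ _ (by rw [slot_inl_lt]; exact h1), hb',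
              add_zero, add_sub_cancel_left, mul_add, mul_one, sgn_add]
            ring
          · rw [if_pos h1, pre_update_of_le deg x _ _ (by
              have := slot_inl_cases i h j; omega), sgn_add,
              sgn_congr (k := k) (x := deg (t i) - d - deg (t i)) (y := d) ⟨-d, by ring⟩]
            ring
        · intro i' hi'
          by_cases hii : i' = i
          · subst hii; rw [outer_self]
          · rw [outer_ne i h x _ ⟨i', hii⟩]
            exact hc ⟨i', hii⟩ fun h => hi' (congrArg Subtype.val h)
        · intro j'
          by_cases hj : j' = j
          · subst hj; simp
          · rw [Function.update_of_ne (by simpa using hj)]; exact hc j' hj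
      · rw [if_neg, if_neg]
        · simp
        · intro H
          apply hc
          intro j' hj'
          rw [H j' (fun h => hj' (Subtype.ext h)), outer_ne]
        · intro H
          apply hc
          intro j' hj'
          rw [H j', Function.update_of_ne (by simpa using hj')]
    · intro s _ hs
      rw [if_neg, zero_mul]
      intro H
      apply hs
      rw [H i (Ne.symm j.2), outer_self]
    · simp
    · intro y _ hy
      rw [insM, if_neg, zero_mul]
      intro H
      apply hy
      rw [H j]; simp
    · simp
  have e4 : insM deg (d + 1) i h (mmul w (bdT deg bd m) - sgn k d • mmul bd w) t x =
      insM deg (d + 1) i h (mmul w (bdT deg bd m)) t x -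
        insM deg (d + 1) i h (sgn k d • mmul bd w) t x := by
    simp only [insM, Pi.sub_apply]
    split_ifs <;> ring
  rw [e4, e1, e2, Finset.sum_congr rfl fun j _ => e3 j, ← Finset.mul_sum]
  ring

end coend

section coend
variable {k : Type u} [CommRing k] {α β : Type}
  [Fintype α] [DecidableEq α] [Fintype β] [DecidableEq β] (deg : α → ℤ) (deg' : β → ℤ)

/-- The matrix of the `n`-th tensor power of a map of degree zero. -/
def tensM (P : α → β → k) (n : ℕ) : (Fin n → α) → (Fin n → β) → k := fun x y =>
  ∏ j, P (x j) (y j)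

lemma pre_tensM {P : α → β → k} {n : ℕ} (hP : ∀ s s', P s s' ≠ 0 → deg' s' = deg s)
    {t : Fin n → α} {y : Fin n → β} {c : ℕ}
    (h : (∏ j : Fin n, if j.1 < c then P (t j) (y j) else 1) ≠ 0) :
    pre deg' y c = pre deg t c := by
  refine Finset.sum_congr rfl fun a _ => ?_
  by_cases ha : a.1 < c
  · rw [if_pos ha, if_pos ha]
    apply hP
    intro h0
    apply h
    refine Finset.prod_eq_zero (Finset.mem_univ a) ?_
    rw [if_pos ha, h0]
  · simp [ha]

lemma bdT_sum (bd : α → α → k) (n : ℕ) {M : Type*} [AddCommGroup M] [Module k M] (G : (Fin n → α) → M) (t : Fin n → α) :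
    ∑ x, bdT deg bd n t x • G x = ∑ j : Fin n, ∑ r, (sgn k (pre deg t j) * bd (t j) r) •
      G (Function.update t j r) := by
  simp only [bdT, Finset.sum_smul]
  rw [Finset.sum_comm]
  refine Finset.sum_congr rfl fun j _ => ?_
  rw [← (Equiv.funSplitAt j α).symm.sum_comp, Fintype.sum_prod_type]
  refine Finset.sum_congr rfl fun s _ => ?_
  rw [Finset.sum_eq_single (fun i : {i // i ≠ j} => t i)]
  · have : (Equiv.funSplitAt j α).symm (s, fun i : {i // i ≠ j} => t i) =
        Function.update t j s := by
      funext i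
      by_cases hi : i = j
      · subst hi; simp [Equiv.funSplitAt]
      · simp [Equiv.funSplitAt, hi]
    rw [this, if_pos]
    · rw [pre_update_of_le deg t j _ le_rfl, Function.update_self]
    · intro i hi; rw [Function.update_of_ne hi]
  · intro g _ hg
    rw [if_neg, zero_smul]
    intro h'
    apply hg
    funext i
    have := h' i i.2
    simpa [Equiv.funSplitAt, i.2] using this.symm
  · simp

lemma bdT_tensM {P : α → β → k} (hP : ∀ s s', P s s' ≠ 0 → deg' s' = deg s)
    {bd : α → α → k} {bd' : β → β → k} (h : mmul bd P = mmul P bd') (n : ℕ) :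
    mmul (bdT deg bd n) (tensM P n) = mmul (tensM P n) (bdT deg' bd' n) := by
  funext t y
  have h0 := bdT_sum deg bd n (fun x => tensM P n x y) t
  simp only [smul_eq_mul] at h0
  rw [mmul, mmul, h0, sum_bdT]
  refine Finset.sum_congr rfl fun j _ => ?_
  have h1 : ∀ r, tensM P n (Function.update t j r) y =
      P r (y j) * ∏ i : {i // i ≠ j}, P (t i) (y i) := fun r => by
    rw [tensM, Fintype.prod_eq_mul_prod_subtype_ne _ j, Function.update_self]
    congr 1
    exact Finset.prod_congr rfl fun i _ => by rw [Function.update_of_ne i.2]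
  have h2 : ∀ r, tensM P n t (Function.update y j r) =
      P (t j) r * ∏ i : {i // i ≠ j}, P (t i) (y i) := fun r => by
    rw [tensM, Fintype.prod_eq_mul_prod_subtype_ne _ j, Function.update_self]
    congr 1
    exact Finset.prod_congr rfl fun i _ => by rw [Function.update_of_ne i.2]
  by_cases h3 : ∏ i : {i // i ≠ j}, P (t i) (y i) = 0
  · simp [h1, h2, h3]
  have h4 : pre deg' y j = pre deg t j := by
    apply pre_tensM deg deg' hP
    intro h5
    apply h3
    rw [Fintype.prod_eq_mul_prod_subtype_ne _ j, if_neg (lt_irrefl _), one_mul] at h5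
    have : ∏ i : {i // i ≠ j}, P (t i) (y i) =
        (∏ i : {i // i ≠ j}, if i.1.1 < j.1 then P (t i) (y i) else 1) *
        (∏ i : {i // i ≠ j}, if i.1.1 < j.1 then 1 else P (t i) (y i)) := by
      rw [← Finset.prod_mul_distrib]
      exact Finset.prod_congr rfl fun i _ => by split_ifs <;> simp
    rw [this, h5, zero_mul]
  have h5 := congrFun (congrFun h (t j)) (y j)
  simp only [mmul] at h5
  simp only [h1, h2, h4]
  calc _ = (sgn k (pre deg t j) * ∏ i : {i // i ≠ j}, P (t i) (y i)) *
        ∑ r, bd (t j) r * P r (y j) := by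
        rw [Finset.mul_sum]; exact Finset.sum_congr rfl fun _ _ => by ring
    _ = _ := by
        rw [h5, Finset.mul_sum]; exact Finset.sum_congr rfl fun _ _ => by ring

/-- insert the tuple `r` into slot `i` -/
def join {n m l : ℕ} (i : Fin n) (h : l + 1 = n + m) (t : Fin n → α) (r : Fin m → α) : Fin l → α :=
  fun c => Sum.elim (fun j => t j.1) r ((compSlot i h).symm c)

lemma join_inl {n m l : ℕ} (i : Fin n) (h : l + 1 = n + m) (t : Fin n → α) (r : Fin m → α)
    (j : {j // j ≠ i}) : join i h t r (compSlot i h (Sum.inl j)) = t j := by simp [join]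

lemma join_inr {n m l : ℕ} (i : Fin n) (h : l + 1 = n + m) (t : Fin n → α) (r : Fin m → α)
    (b : Fin m) : join i h t r (compSlot i h (Sum.inr b)) = r b := by simp [join]

lemma pre_eq_pre_self {n m l : ℕ} (i : Fin n) (h : l + 1 = n + m) (x : Fin l → α) (t : Fin n → α)
    (ht : ∀ j : {j // j ≠ i}, t j = x (compSlot i h (Sum.inl j))) :
    pre deg x i = pre deg t i := by
  rw [pre_self deg i h, pre, Fintype.sum_eq_add_sum_subtype_ne _ i, if_neg (lt_irrefl _), zero_add]
  simp only [ht]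

lemma insM_sum {n m l : ℕ} (d : ℤ) (i : Fin n) (h : l + 1 = n + m) (w : α → (Fin m → α) → k)
    {M : Type*} [AddCommGroup M] [Module k M] (G : (Fin l → α) → M) (t : Fin n → α) :
    ∑ x, insM deg d i h w t x • G x = ∑ r, (sgn k (d * pre deg t i) * w (t i) r) •
      G (join i h t r) := by
  let e : (Fin l → α) ≃ ({j // j ≠ i} → α) × (Fin m → α) :=
    (Equiv.arrowCongr (compSlot i h).symm (Equiv.refl α)).trans (Equiv.sumArrowEquivProdArrow _ _ _)
  rw [← e.symm.sum_comp, Fintype.sum_prod_type, Finset.sum_eq_single (fun j => t j.1)]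
  · refine Finset.sum_congr rfl fun r _ => ?_
    have : e.symm (fun j => t j.1, r) = join i h t r := by
      funext c
      simp only [e, join, Equiv.symm_trans_apply]
      simp only [Equiv.sumArrowEquivProdArrow, Equiv.coe_fn_symm_mk, Equiv.arrowCongr,
        Function.comp_def, Equiv.symm_symm, Equiv.refl_symm, Equiv.refl_apply]
    rw [this, insM, if_pos]
    · rw [pre_eq_pre_self deg i h _ t]
      · simp only [join_inr]
      · intro j; rw [join_inl]
    · intro j; rw [join_inl]
  · intro g _ hg
    refine Finset.sum_eq_zero fun r _ => ?_
    rw [insM, if_neg, zero_smul]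
    intro H
    apply hg
    funext j
    rw [H j]
    simp [e, Equiv.arrowCongr, Equiv.sumArrowEquivProdArrow]
  · simp

lemma insM_tensM {P : α → β → k} (hP : ∀ s s', P s s' ≠ 0 → deg' s' = deg s)
    {n m l : ℕ} (d : ℤ) (i : Fin n) (h : l + 1 = n + m) {w : α → (Fin m → α) → k}
    {w' : β → (Fin m → β) → k} (hw : mmul w (tensM P m) = mmul P w') :
    mmul (insM deg d i h w) (tensM P l) = mmul (tensM P n) (insM deg' d i h w') := by
  funext t y
  have h0 := insM_sum deg d i h w (fun x => tensM P l x y) t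
  simp only [smul_eq_mul] at h0
  rw [mmul, mmul, h0, sum_insM]
  have h1 : ∀ r, tensM P l (join i h t r) y =
      (∏ j : {j // j ≠ i}, P (t j) (y (compSlot i h (Sum.inl j)))) *
        tensM P m r (fun b => y (compSlot i h (Sum.inr b))) := fun r => by
    rw [tensM, prod_slot i h]; simp only [join_inl, join_inr, tensM]
  have h2 : ∀ s, tensM P n t (outer i h y s) =
      P (t i) s * ∏ j : {j // j ≠ i}, P (t j) (y (compSlot i h (Sum.inl j))) := fun s => by
    rw [tensM, Fintype.prod_eq_mul_prod_subtype_ne _ i, outer_self]; simp only [outer_ne]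
  by_cases h3 : ∏ j : {j // j ≠ i}, P (t j) (y (compSlot i h (Sum.inl j))) = 0
  · simp [h1, h2, h3]
  have h4 : pre deg' y i = pre deg t i := by
    rw [pre_self deg' i h, pre, Fintype.sum_eq_add_sum_subtype_ne _ i, if_neg (lt_irrefl _),
      zero_add]
    refine Finset.sum_congr rfl fun j _ => ?_
    rw [hP _ _ fun h0 => h3 (Finset.prod_eq_zero (Finset.mem_univ j) h0)]
  have h5 := congrFun (congrFun hw (t i)) (fun b => y (compSlot i h (Sum.inr b)))
  simp only [mmul] at h5
  simp only [h1, h2, h4]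
  calc _ = (sgn k (d * pre deg t i) *
        ∏ j : {j // j ≠ i}, P (t j) (y (compSlot i h (Sum.inl j)))) *
        ∑ r, w (t i) r * tensM P m r (fun b => y (compSlot i h (Sum.inr b))) := by
        rw [Finset.mul_sum]; exact Finset.sum_congr rfl fun _ _ => by ring
    _ = _ := by
        rw [h5, Finset.mul_sum]; exact Finset.sum_congr rfl fun _ _ => by ring

lemma slot_ext {n m r s s' t : ℕ} (i : Fin n) (j : Fin m)
    (hs : s + 1 = n + m) (ht : t + 1 = s + r) (hs' : s' + 1 = m + r) (ht' : t + 1 = n + s') :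
    (∀ (a : {a // a ≠ i}) (ha),
      compSlot (compSlot i hs (Sum.inr j)) ht (Sum.inl ⟨compSlot i hs (Sum.inl a), ha⟩) =
        compSlot i ht' (Sum.inl a)) ∧
    (∀ (b : {b // b ≠ j}) (hb),
      compSlot (compSlot i hs (Sum.inr j)) ht (Sum.inl ⟨compSlot i hs (Sum.inr b), hb⟩) =
        compSlot i ht' (Sum.inr (compSlot j hs' (Sum.inl b)))) ∧
    (∀ c, compSlot (compSlot i hs (Sum.inr j)) ht (Sum.inr c) =
      compSlot i ht' (Sum.inr (compSlot j hs' (Sum.inr c)))) := by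
  refine ⟨fun a ha => Fin.ext ?_, fun b hb => Fin.ext ?_, fun c => Fin.ext ?_⟩
  · have h1 := slot_inl_cases (compSlot i hs (Sum.inr j)) ht ⟨compSlot i hs (Sum.inl a), ha⟩
    have h2 := slot_inl_cases i ht' a
    have h3 := slot_inl_cases i hs a
    have h4 := slot_inr i hs j
    have := j.2
    dsimp only at h1
    omega
  · have h1 := slot_inl_cases (compSlot i hs (Sum.inr j)) ht ⟨compSlot i hs (Sum.inr b), hb⟩
    have h2 := slot_inr i ht' (compSlot j hs' (Sum.inl b))
    have h3 := slot_inl_cases j hs' b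
    have h4 := slot_inr i hs j
    have h5 := slot_inr i hs b.1
    dsimp only at h1
    omega
  · rw [slot_inr, slot_inr, slot_inr, slot_inr]; omega

lemma slot_ext' {n m r s s' t : ℕ} (i j : Fin n) (hij : i < j)
    (hs : s + 1 = n + m) (ht : t + 1 = s + r) (hs' : s' + 1 = n + r) (ht' : t + 1 = s' + m) :
    (∀ (a : Fin n) (h1 : a ≠ i) (h2 : a ≠ j) (h3) (h4),
      compSlot (compSlot i hs (Sum.inl ⟨j, hij.ne'⟩)) ht
        (Sum.inl ⟨compSlot i hs (Sum.inl ⟨a, h1⟩), h3⟩) =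
      compSlot (compSlot j hs' (Sum.inl ⟨i, hij.ne⟩)) ht'
        (Sum.inl ⟨compSlot j hs' (Sum.inl ⟨a, h2⟩), h4⟩)) ∧
    (∀ b h3, compSlot (compSlot i hs (Sum.inl ⟨j, hij.ne'⟩)) ht
        (Sum.inl ⟨compSlot i hs (Sum.inr b), h3⟩) =
      compSlot (compSlot j hs' (Sum.inl ⟨i, hij.ne⟩)) ht' (Sum.inr b)) ∧
    (∀ b h3, compSlot (compSlot i hs (Sum.inl ⟨j, hij.ne'⟩)) ht (Sum.inr b) =
      compSlot (compSlot j hs' (Sum.inl ⟨i, hij.ne⟩)) ht'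
        (Sum.inl ⟨compSlot j hs' (Sum.inr b), h3⟩)) := by
  have g1 := slot_inl_of_gt i hs ⟨j, hij.ne'⟩ hij
  have g2 := slot_inl_of_lt j hs' ⟨i, hij.ne⟩ hij
  dsimp only at g1 g2
  refine ⟨fun a h1 h2 h3 h4 => Fin.ext ?_, fun b h3 => Fin.ext ?_, fun b h3 => Fin.ext ?_⟩
  · have e1 := slot_inl_cases _ ht ⟨compSlot i hs (Sum.inl ⟨a, h1⟩), h3⟩
    have e2 := slot_inl_cases _ ht' ⟨compSlot j hs' (Sum.inl ⟨a, h2⟩), h4⟩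
    have e3 := slot_inl_cases i hs ⟨a, h1⟩
    have e4 := slot_inl_cases j hs' ⟨a, h2⟩
    dsimp only at e1 e2 e3 e4
    omega
  · have e1 := slot_inl_cases _ ht ⟨compSlot i hs (Sum.inr b), h3⟩
    have e2 := slot_inr (compSlot j hs' (Sum.inl ⟨i, hij.ne⟩)) ht' b
    have e3 := slot_inr i hs b
    dsimp only at e1
    have := b.2
    omega
  · have e1 := slot_inl_cases _ ht' ⟨compSlot j hs' (Sum.inr b), h3⟩
    have e2 := slot_inr (compSlot i hs (Sum.inl ⟨j, hij.ne'⟩)) ht b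
    have e3 := slot_inr j hs' b
    dsimp only at e1
    have := b.2
    omega

lemma pre_outer_of_le {n m l : ℕ} (i : Fin n) (h : l + 1 = n + m) (x : Fin l → α) (s : α) {c : ℕ}
    (hc : c ≤ i.1) : pre deg (outer i h x s) c = pre deg x c := by
  rw [pre_outer, if_neg (by omega), zero_add]
  conv_rhs => rw [pre, sum_slot i h]
  rw [Finset.sum_eq_zero (s := (Finset.univ : Finset (Fin m))), add_zero]
  · refine Finset.sum_congr rfl fun j _ => ?_
    have := slot_inl_cases i h j
    exact if_congr (by omega) rfl rfl
  · intro b _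
    rw [if_neg]
    rw [slot_inr]; omega

lemma pre_add {n m l : ℕ} (i : Fin n) (h : l + 1 = n + m) (x : Fin l → α) {c : ℕ} (hc : c ≤ m) :
    pre deg x (i + c) = pre deg x i + pre deg (fun b => x (compSlot i h (Sum.inr b))) c := by
  rw [pre, sum_slot i h, pre_self deg i h x, pre]
  congr 1
  · refine Finset.sum_congr rfl fun j _ => ?_
    have := slot_inl_cases i h j
    exact if_congr (by omega) rfl rfl
  · refine Finset.sum_congr rfl fun j _ => ?_
    rw [slot_inr]
    exact if_congr (by omega) rfl rfl

lemma pre_outer_add {n m l : ℕ} (i : Fin n) (h : l + 1 = n + m) (x : Fin l → α) (s : α) {e c : ℕ}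
    (he : i.1 + m ≤ e) (hc : e + 1 = c + m) :
    pre deg x e = pre deg (outer i h x s) c +
      (∑ b, deg (x (compSlot i h (Sum.inr b))) - deg s) := by
  rw [pre, sum_slot i h, pre_outer, if_pos (by omega)]
  have h1 : ∀ j : {j // j ≠ i}, (compSlot i h (Sum.inl j)).1 < e ↔ j.1.1 < c := fun j => by
    have := slot_inl_cases i h j; have := j.1.2; omega
  have h2 : ∀ b : Fin m, (compSlot i h (Sum.inr b)).1 < e := fun b => by
    rw [slot_inr]; omega
  simp only [h1, h2, if_true]
  ring

lemma insM_insM_assoc {n m r s s' t : ℕ} (a b : ℤ) (i : Fin n) (j : Fin m)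
    (hs : s + 1 = n + m) (ht : t + 1 = s + r) (hs' : s' + 1 = m + r) (ht' : t + 1 = n + s')
    (w : α → (Fin m → α) → k) (v : α → (Fin r → α) → k) :
    mmul (insM deg a i hs w) (insM deg b (compSlot i hs (Sum.inr j)) ht v) =
      insM deg (a + b) i ht' (mmul w (insM deg b j hs' v)) := by
  obtain ⟨f1, f2, f3⟩ := slot_ext i j hs ht hs' ht'
  funext y x
  rw [mmul, sum_insM]
  have h1 : ∀ (q : α) (c : {c // c ≠ i}),
      outer (compSlot i hs (Sum.inr j)) ht x q (compSlot i hs (Sum.inl c)) =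
      x (compSlot i ht' (Sum.inl c)) := fun q c => by
    rw [← f1 c (by simp), ← outer_ne _ ht x q ⟨_, _⟩]
  have h2 : ∀ (q : α), (fun b => outer (compSlot i hs (Sum.inr j)) ht x q
      (compSlot i hs (Sum.inr b))) =
      outer j hs' (fun b => x (compSlot i ht' (Sum.inr b))) q := fun q => by
    funext b
    by_cases hb : b = j
    · subst hb; rw [outer_self, outer_self]
    · rw [outer_ne j hs' _ q ⟨b, hb⟩, ← f2 ⟨b, hb⟩ (by simpa using hb),
        ← outer_ne _ ht x q ⟨_, _⟩]
  have h3 : ∀ q, pre deg (outer (compSlot i hs (Sum.inr j)) ht x q) i = pre deg x i := fun q =>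
    pre_outer_of_le _ _ _ _ _ (by rw [slot_inr]; omega)
  have h4 : pre deg x (compSlot i hs (Sum.inr j)) = pre deg x i +
      pre deg (fun b => x (compSlot i ht' (Sum.inr b))) j := by
    rw [slot_inr]; exact pre_add deg i ht' x (by have := j.2; omega)
  simp only [insM, h1, h2, h3, h4, f3]
  by_cases hc : ∀ c : {c // c ≠ i}, y c = x (compSlot i ht' (Sum.inl c))
  · simp only [if_pos hc]
    rw [mmul, sum_insM, Finset.mul_sum]
    refine Finset.sum_congr rfl fun q _ => ?_
    rw [mul_add, add_mul, sgn_add, sgn_add]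
    ring
  · simp only [if_neg hc, zero_mul, Finset.sum_const_zero]

lemma insM_insM_comm {n m r s s' t : ℕ} (a b : ℤ) (i j : Fin n) (hij : i < j)
    (hs : s + 1 = n + m) (ht : t + 1 = s + r) (hs' : s' + 1 = n + r) (ht' : t + 1 = s' + m)
    (w : α → (Fin m → α) → k) (hw : OpDeg deg a w) (v : α → (Fin r → α) → k) :
    mmul (insM deg a i hs w) (insM deg b (compSlot i hs (Sum.inl ⟨j, hij.ne'⟩)) ht v) =
      sgn k (a * b) • mmul (insM deg b j hs' v)
        (insM deg a (compSlot j hs' (Sum.inl ⟨i, hij.ne⟩)) ht' w) := by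
  obtain ⟨f1, f2, f3⟩ := slot_ext' i j hij hs ht hs' ht'
  funext y x
  have hij' : i.1 < j.1 := hij
  have hi' : (compSlot j hs' (Sum.inl ⟨i, hij.ne⟩)).1 = i.1 :=
    slot_inl_of_lt j hs' ⟨i, hij.ne⟩ hij
  have hj' : i.1 ≤ (compSlot i hs (Sum.inl ⟨j, hij.ne'⟩)).1 := by
    have := slot_inl_cases i hs ⟨j, hij.ne'⟩; dsimp only at this; omega
  rw [Pi.smul_apply, Pi.smul_apply, smul_eq_mul, mmul, mmul, sum_insM, sum_insM,
    Finset.sum_eq_single (y j), Finset.sum_eq_single (y i)]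
  · have h2 : (fun c => outer (compSlot i hs (Sum.inl ⟨j, hij.ne'⟩)) ht x (y j)
        (compSlot i hs (Sum.inr c))) =
        fun c => x (compSlot (compSlot j hs' (Sum.inl ⟨i, hij.ne⟩)) ht' (Sum.inr c)) := by
      funext c
      rw [← f2 c (by simp), ← outer_ne _ ht x (y j) ⟨_, _⟩]
    have h3 : (fun c => outer (compSlot j hs' (Sum.inl ⟨i, hij.ne⟩)) ht' x (y i)
        (compSlot j hs' (Sum.inr c))) =
        fun c => x (compSlot (compSlot i hs (Sum.inl ⟨j, hij.ne'⟩)) ht (Sum.inr c)) := by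
      funext c
      rw [f3 c (by simp), ← outer_ne _ ht' x (y i) ⟨_, _⟩]
    have h1 : (∀ c : {c // c ≠ i}, y c = outer (compSlot i hs (Sum.inl ⟨j, hij.ne'⟩)) ht x (y j)
          (compSlot i hs (Sum.inl c))) ↔
        (∀ c : {c // c ≠ j}, y c = outer (compSlot j hs' (Sum.inl ⟨i, hij.ne⟩)) ht' x (y i)
          (compSlot j hs' (Sum.inl c))) := by
      have key : ∀ c (h1 : c ≠ i) (h2 : c ≠ j),
          outer (compSlot i hs (Sum.inl ⟨j, hij.ne'⟩)) ht x (y j)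
            (compSlot i hs (Sum.inl ⟨c, h1⟩)) =
          outer (compSlot j hs' (Sum.inl ⟨i, hij.ne⟩)) ht' x (y i)
            (compSlot j hs' (Sum.inl ⟨c, h2⟩)) := fun c h1 h2 => by
        have e1 : compSlot i hs (Sum.inl ⟨c, h1⟩) ≠ compSlot i hs (Sum.inl ⟨j, hij.ne'⟩) := by
          simpa using h2
        have e2 : compSlot j hs' (Sum.inl ⟨c, h2⟩) ≠ compSlot j hs' (Sum.inl ⟨i, hij.ne⟩) := by
          simpa using h1
        rw [outer_ne _ ht x (y j) ⟨_, e1⟩, outer_ne _ ht' x (y i) ⟨_, e2⟩, f1 c h1 h2 e1 e2]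
      constructor
      · rintro H ⟨c, hc⟩
        by_cases hci : c = i
        · subst hci; rw [outer_self]
        · rw [← key c hci hc]; exact H ⟨c, hci⟩
      · rintro H ⟨c, hc⟩
        by_cases hci : c = j
        · subst hci; rw [outer_self]
        · rw [key c hc hci]; exact H ⟨c, hci⟩
    have h4 : pre deg (outer (compSlot i hs (Sum.inl ⟨j, hij.ne'⟩)) ht x (y j)) i = pre deg x i :=
      pre_outer_of_le _ _ _ _ _ hj'
    simp only [insM, h2, h3, h4, hi']
    by_cases hc : (∀ c : {c // c ≠ i}, y c =
        outer (compSlot i hs (Sum.inl ⟨j, hij.ne'⟩)) ht x (y j) (compSlot i hs (Sum.inl c)))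
    · rw [if_pos hc, if_pos (h1.1 hc)]
      by_cases hw0 : (w (y i) fun c => x (compSlot (compSlot j hs' (Sum.inl ⟨i, hij.ne⟩)) ht'
          (Sum.inr c))) = 0
      · simp [hw0]
      have hw' := hw _ _ hw0
      have h5 : pre deg x (compSlot i hs (Sum.inl ⟨j, hij.ne'⟩)) =
          pre deg (outer (compSlot j hs' (Sum.inl ⟨i, hij.ne⟩)) ht' x (y i)) j - a := by
        have e3 := slot_inl_of_gt i hs ⟨j, hij.ne'⟩ hij
        dsimp only at e3
        rw [pre_outer_add deg (compSlot j hs' (Sum.inl ⟨i, hij.ne⟩)) ht' x (y i)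
          (e := (compSlot i hs (Sum.inl ⟨j, hij.ne'⟩)).1) (c := j.1) (by rw [hi']; omega) e3, hw']
        ring
      rw [h5, sgn_congr (k := k)
        (x := b * (pre deg (outer (compSlot j hs' (Sum.inl ⟨i, hij.ne⟩)) ht' x (y i)) j - a))
        (y := a * b + b * pre deg (outer (compSlot j hs' (Sum.inl ⟨i, hij.ne⟩)) ht' x (y i)) j)
        ⟨-(a * b), by ring⟩, sgn_add]
      ring
    · rw [if_neg hc, if_neg fun h => hc (h1.2 h)]; simp
  · intro q _ hq
    rw [insM, if_neg, zero_mul]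
    intro H
    apply hq
    rw [H ⟨i, hij.ne⟩, outer_self]
  · simp
  · intro q _ hq
    rw [insM, if_neg, zero_mul]
    intro H
    apply hq
    rw [H ⟨j, hij.ne'⟩, outer_self]
  · simp

end coend

/-- The exponent of the Koszul sign of the rearrangement `(x_1, …, x_n) ↦ (x_{σ 1}, …, x_{σ n})` of
elements of degrees `e_1, …, e_n`. -/
def koszulExp {n : ℕ} (σ : Equiv.Perm (Fin n)) (e : Fin n → ℤ) : ℤ :=
  ∑ a, ∑ b, if a < b ∧ σ b < σ a then e (σ a) * e (σ b) else 0

section koszul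

lemma pairSum_perm {n : ℕ} (g : Fin n → Fin n → ℤ) (hg : ∀ a b, g a b = g b a)
    (τ : Equiv.Perm (Fin n)) :
    ∑ a, ∑ b, (if a < b then g (τ a) (τ b) else 0) = ∑ a, ∑ b, if a < b then g a b else 0 := by
  have key : ∀ g : Fin n → Fin n → ℤ, (∀ a b, g a b = g b a) →
      2 * ∑ a, ∑ b, (if a < b then g a b else 0) = ∑ a, ∑ b, g a b - ∑ a, g a a := by
    intro g hg
    rw [two_mul]
    nth_rw 2 [Finset.sum_comm]
    rw [← Finset.sum_add_distrib, ← Finset.sum_sub_distrib]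
    refine Finset.sum_congr rfl fun a _ => ?_
    rw [← Finset.sum_add_distrib, eq_sub_iff_add_eq,
      show g a a = ∑ b, if b = a then g a b else 0 by simp, ← Finset.sum_add_distrib]
    refine Finset.sum_congr rfl fun b _ => ?_
    rcases lt_trichotomy a b with h | h | h
    · simp [h, h.not_gt, h.ne']
    · subst h; simp
    · simp [h, h.not_gt, h.ne, hg b a]
  have h1 := key g hg
  have h2 := key (fun a b => g (τ a) (τ b)) (fun a b => hg _ _)
  have h3 : ∑ a, ∑ b, g (τ a) (τ b) = ∑ a, ∑ b, g a b := by
    rw [← Equiv.sum_comp τ (fun a => ∑ b, g a b)]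
    exact Finset.sum_congr rfl fun a _ => Equiv.sum_comp τ fun b => g (τ a) b
  have h4 : ∑ a, g (τ a) (τ a) = ∑ a, g a a := Equiv.sum_comp τ (fun a => g a a)
  rw [h3, h4, ← h1] at h2
  omega

lemma even_sum' {ι : Type*} (s : Finset ι) (f : ι → ℤ) (h : ∀ i ∈ s, Even (f i)) :
    Even (∑ i ∈ s, f i) := by
  rw [even_iff_two_dvd]
  exact Finset.dvd_sum fun i hi => even_iff_two_dvd.1 (h i hi)

lemma koszulExp_one {n : ℕ} (e : Fin n → ℤ) : koszulExp 1 e = 0 := by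
  refine Finset.sum_eq_zero fun a _ => Finset.sum_eq_zero fun b _ => if_neg ?_
  rintro ⟨h, h'⟩
  exact absurd h h'.not_gt

lemma koszulExp_mul {n : ℕ} (σ τ : Equiv.Perm (Fin n)) (e : Fin n → ℤ) :
    Even (koszulExp (σ * τ) e - (koszulExp σ e + koszulExp τ (fun a => e (σ a)))) := by
  have h1 : koszulExp σ e = ∑ a, ∑ b, if a < b then
      (if (τ a < τ b ↔ σ (τ b) < σ (τ a)) then e (σ (τ a)) * e (σ (τ b)) else 0) else 0 := by
    rw [pairSum_perm (fun a b => if (a < b ↔ σ b < σ a) then e (σ a) * e (σ b) else 0)]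
    · refine Finset.sum_congr rfl fun a _ => Finset.sum_congr rfl fun b _ => ?_
      by_cases h : a < b <;> simp [h]
    · intro a b
      by_cases h : a = b
      · rw [h]
      · have h' : σ a ≠ σ b := fun h' => h (σ.injective h')
        rw [mul_comm]
        refine if_congr ?_ rfl rfl
        rcases lt_or_gt_of_ne h with h1 | h1 <;> rcases lt_or_gt_of_ne h' with h2 | h2 <;>
          simp [h1, h2, h1.not_gt, h2.not_gt]
  rw [h1, koszulExp, koszulExp, ← Finset.sum_add_distrib, ← Finset.sum_sub_distrib]
  refine even_sum' _ _ fun a _ => ?_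
  rw [← Finset.sum_add_distrib, ← Finset.sum_sub_distrib]
  refine even_sum' _ _ fun b _ => ?_
  by_cases h : a < b
  · have h' : τ a ≠ τ b := fun h' => h.ne (τ.injective h')
    have h'' : σ (τ a) ≠ σ (τ b) := fun h'' => h' (σ.injective h'')
    rcases lt_or_gt_of_ne h' with h1 | h1 <;> rcases lt_or_gt_of_ne h'' with h2 | h2 <;>
      simp [h, h1, h2, h1.not_gt, h2.not_gt, ← two_mul]
  · simp [h]

/-- inversions at position `j` -/
def invSum {n : ℕ} (σ : Equiv.Perm (Fin n)) (e : Fin n → ℤ) (j : Fin n) : ℤ :=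
  ∑ b, ((if j < b ∧ σ b < σ j then e (σ b) else 0) + (if b < j ∧ σ j < σ b then e (σ b) else 0))

lemma koszulExp_split {n : ℕ} (σ : Equiv.Perm (Fin n)) (e : Fin n → ℤ) (j : Fin n) :
    koszulExp σ e = ∑ a : {a // a ≠ j}, ∑ b : {a // a ≠ j},
      (if a.1 < b.1 ∧ σ b < σ a then e (σ a) * e (σ b) else 0) + e (σ j) * invSum σ e j := by
  have h0 : invSum σ e j = ∑ b : {b // b ≠ j}, ((if j < b.1 ∧ σ b < σ j then e (σ b) else 0) +
      (if b.1 < j ∧ σ j < σ b then e (σ b) else 0)) := by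
    rw [invSum, Fintype.sum_eq_add_sum_subtype_ne _ j]; simp
  rw [koszulExp, Fintype.sum_eq_add_sum_subtype_ne _ j, Fintype.sum_eq_add_sum_subtype_ne _ j,
    if_neg (by simp), zero_add, h0]
  have : ∀ a : {a // a ≠ j}, ∑ b, (if a.1 < b ∧ σ b < σ a then e (σ a) * e (σ b) else 0) =
      (if a.1 < j ∧ σ j < σ a then e (σ a) * e (σ j) else 0) +
      ∑ b : {a // a ≠ j}, (if a.1 < b.1 ∧ σ b < σ a then e (σ a) * e (σ b) else 0) := fun a => by
    rw [Fintype.sum_eq_add_sum_subtype_ne _ j]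
  simp only [this, Finset.sum_add_distrib, mul_add, Finset.mul_sum, mul_ite, mul_zero]
  simp only [mul_comm (e (σ j))]
  ring

lemma invSum_parity {n : ℕ} (σ : Equiv.Perm (Fin n)) (e : Fin n → ℤ) (j : Fin n) :
    Even (invSum σ e j + (∑ b, if b.1 < (σ j).1 then e b else 0) +
      ∑ b, if b.1 < j.1 then e (σ b) else 0) := by
  rw [← Equiv.sum_comp σ (fun b => if b.1 < (σ j).1 then e b else 0), invSum,
    ← Finset.sum_add_distrib, ← Finset.sum_add_distrib]
  refine even_sum' _ _ fun b _ => ?_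
  simp only [← Fin.lt_def]
  by_cases h : b = j
  · subst h; simp
  have h' : σ b ≠ σ j := fun h' => h (σ.injective h')
  rcases lt_or_gt_of_ne h with h1 | h1 <;> rcases lt_or_gt_of_ne h' with h2 | h2 <;>
    simp [h1, h2, h1.not_gt, h2.not_gt]

end koszul

section coend
variable {k : Type u} [CommRing k] {α β : Type}

/-- The left action of permutations on operations: the outputs in `N^{⊗ n}` are rearranged, with
the Koszul sign. -/
def permT (deg : α → ℤ) {n : ℕ} (σ : Equiv.Perm (Fin n)) (z : α → (Fin n → α) → k) :
    α → (Fin n → α) → k :=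
  fun s x => sgn k (koszulExp σ fun j => deg (x j)) * z s fun j => x (σ j)

lemma permT_one (deg : α → ℤ) {n : ℕ} (z : α → (Fin n → α) → k) : permT deg 1 z = z := by
  funext s x; simp [permT, koszulExp_one]

lemma permT_mul (deg : α → ℤ) {n : ℕ} (σ τ : Equiv.Perm (Fin n)) (z : α → (Fin n → α) → k) :
    permT deg (σ * τ) z = permT deg σ (permT deg τ z) := by
  funext s x
  simp only [permT]
  rw [sgn_congr (koszulExp_mul σ τ _), sgn_add, mul_assoc]
  rfl

lemma permT_hom (deg : α → ℤ) {n : ℕ} (σ : Equiv.Perm (Fin n)) {d : ℤ} {z : α → (Fin n → α) → k}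
    (hz : OpDeg deg d z) : OpDeg deg d (permT deg σ z) := fun s x h => by
  rw [← hz s (fun j => x (σ j)) (right_ne_zero_of_mul h)]
  exact (Equiv.sum_comp σ fun j => deg (x j)).symm

lemma mmul_permT (deg : α → ℤ) {n : ℕ} (σ : Equiv.Perm (Fin n)) [Fintype α] (f : β → α → k)
    (z : α → (Fin n → α) → k) (s : β) (x : Fin n → α) :
    mmul f (permT deg σ z) s x =
      sgn k (koszulExp σ fun j => deg (x j)) * mmul f z s fun j => x (σ j) := by
  simp only [mmul, permT, Finset.mul_sum]
  exact Finset.sum_congr rfl fun _ _ => by ring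

lemma permT_tensM [Fintype α] {deg : α → ℤ} {deg' : β → ℤ} {P : α → β → k}
    (hP : ∀ s s', P s s' ≠ 0 → deg' s' = deg s) {n : ℕ} (σ : Equiv.Perm (Fin n))
    (z : α → (Fin n → α) → k) (s : α) (x : Fin n → β) :
    mmul (permT deg σ z) (tensM P n) s x =
      sgn k (koszulExp σ fun j => deg' (x j)) * mmul z (tensM P n) s fun j => x (σ j) := by
  let e : (Fin n → α) ≃ (Fin n → α) :=
    ⟨fun y j => y (σ j), fun y j => y (σ.symm j), fun y => by simp, fun y => by simp⟩
  rw [mmul, mmul, Finset.mul_sum]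
  refine (Finset.sum_congr rfl fun y _ => ?_).trans (e.sum_comp fun y => sgn k (koszulExp σ fun j => deg' (x j)) *
    (z s y * tensM P n y fun j => x (σ j)))
  have h1 : tensM P n (e y) (fun j => x (σ j)) = tensM P n y x :=
    Equiv.prod_comp σ fun j => P (y j) (x j)
  rw [h1, permT, mul_assoc]
  by_cases h : tensM P n y x = 0
  · simp [h]
  · have h2 : ∀ j, deg' (x j) = deg (y j) := fun j =>
      hP _ _ fun h0 => h (Finset.prod_eq_zero (Finset.mem_univ j) h0)
    simp only [h2]
    rfl

lemma permT_bdT [Fintype α] [DecidableEq α] (deg : α → ℤ) {bd : α → α → k}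
    (hd : ∀ s s', bd s s' ≠ 0 → deg s = deg s' + 1) {n : ℕ} (σ : Equiv.Perm (Fin n))
    (z : α → (Fin n → α) → k) :
    mmul (permT deg σ z) (bdT deg bd n) = permT deg σ (mmul z (bdT deg bd n)) := by
  funext s x
  rw [mmul, sum_bdT, permT, mmul, sum_bdT, ← Equiv.sum_comp σ, Finset.mul_sum]
  refine Finset.sum_congr rfl fun j _ => ?_
  rw [Finset.mul_sum]
  refine Finset.sum_congr rfl fun y _ => ?_
  have h1 : (fun i => Function.update x (σ j) y (σ i)) =
      Function.update (fun i => x (σ i)) j y := by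
    funext i
    by_cases h : i = j
    · subst h; simp
    · rw [Function.update_of_ne h, Function.update_of_ne fun h' => h (σ.injective h')]
  rw [permT, h1]
  by_cases hb : bd y (x (σ j)) = 0
  · simp [hb]
  have h2 := hd _ _ hb
  have h3 : (koszulExp σ fun i => deg (Function.update x (σ j) y i)) =
      koszulExp σ (fun i => deg (x i)) + invSum σ (fun i => deg (x i)) j := by
    have hu : ∀ a : {a // a ≠ j}, Function.update x (σ j) y (σ a) = x (σ a) := fun a => by
      rw [Function.update_of_ne fun h' => a.2 (σ.injective h')]
    have hi : invSum σ (fun i => deg (Function.update x (σ j) y i)) j =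
        invSum σ (fun i => deg (x i)) j := by
      refine Finset.sum_congr rfl fun b _ => ?_
      by_cases h : b = j
      · subst h; simp
      · have := hu ⟨b, h⟩
        simp only [this]
    rw [koszulExp_split _ _ j, koszulExp_split _ _ j, hi]
    simp only [hu, Function.update_self, h2]
    ring
  have h4 := invSum_parity σ (fun i => deg (x i)) j
  have h5 : sgn k (koszulExp σ (fun i => deg (x i)) + invSum σ (fun i => deg (x i)) j) *
      sgn k (pre deg x (σ j)) = sgn k (koszulExp σ (fun i => deg (x i))) *
      sgn k (pre deg (fun i => x (σ i)) j) := by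
    rw [← sgn_add, ← sgn_add]
    apply sgn_congr
    obtain ⟨r, hr⟩ := h4
    refine ⟨r - pre deg (fun i => x (σ i)) j, ?_⟩
    simp only [pre]
    linear_combination hr
  rw [h3]
  linear_combination (z s (Function.update (fun i => x (σ i)) j y) * bd y (x (σ j))) * h5

lemma compPerm_inl {n m l : ℕ} (i : Fin n) (h : l + 1 = n + m) (σ : Equiv.Perm (Fin n))
    (τ : Equiv.Perm (Fin m)) (j : {j // j ≠ σ.symm i}) (hj : σ j ≠ i) :
    compPerm i h σ τ (compSlot (σ.symm i) h (Sum.inl j)) = compSlot i h (Sum.inl ⟨σ j, hj⟩) := by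
  simp [compPerm]

lemma compPerm_inr {n m l : ℕ} (i : Fin n) (h : l + 1 = n + m) (σ : Equiv.Perm (Fin n))
    (τ : Equiv.Perm (Fin m)) (b : Fin m) :
    compPerm i h σ τ (compSlot (σ.symm i) h (Sum.inr b)) = compSlot i h (Sum.inr (τ b)) := by
  simp [compPerm]

lemma koszulExp_compPerm {n m l : ℕ} (i : Fin n) (h : l + 1 = n + m) (σ : Equiv.Perm (Fin n))
    (τ : Equiv.Perm (Fin m)) (e : Fin l → ℤ) (u : Fin n → ℤ)
    (hu : ∀ j : {j // j ≠ i}, u j = e (compSlot i h (Sum.inl j))) :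
    koszulExp (compPerm i h σ τ) e + u i * invSum σ u (σ.symm i) =
      koszulExp σ u + koszulExp τ (fun b => e (compSlot i h (Sum.inr b))) +
      (∑ b, e (compSlot i h (Sum.inr b))) * invSum σ u (σ.symm i) := by
  have hj : ∀ j : {j // j ≠ σ.symm i}, σ j ≠ i := fun j h => j.2 ((Equiv.eq_symm_apply σ).2 h)
  have e1 : ∀ j : {j // j ≠ σ.symm i}, e (compPerm i h σ τ (compSlot (σ.symm i) h (Sum.inl j))) =
      u (σ j) := fun j => by rw [compPerm_inl i h σ τ j (hj j), hu ⟨σ j, hj j⟩]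
  have e2 : ∀ b, e (compPerm i h σ τ (compSlot (σ.symm i) h (Sum.inr b))) =
      e (compSlot i h (Sum.inr (τ b))) := fun b => by rw [compPerm_inr]
  have h0 : invSum σ u (σ.symm i) = ∑ b : {b // b ≠ σ.symm i},
      ((if σ.symm i < b.1 ∧ σ b < i then u (σ b) else 0) +
      (if b.1 < σ.symm i ∧ i < σ b then u (σ b) else 0)) := by
    rw [invSum, Fintype.sum_eq_add_sum_subtype_ne _ (σ.symm i)]; simp
  rw [koszulExp_split σ u (σ.symm i), Equiv.apply_symm_apply]
  have h1 : koszulExp (compPerm i h σ τ) e = ∑ a : {a // a ≠ σ.symm i}, ∑ b : {a // a ≠ σ.symm i},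
      (if a.1 < b.1 ∧ σ b < σ a then u (σ a) * u (σ b) else 0) +
      koszulExp τ (fun b => e (compSlot i h (Sum.inr b))) +
      (∑ b, e (compSlot i h (Sum.inr b))) * invSum σ u (σ.symm i) := by
    have e3 : ∀ j : {j // j ≠ σ.symm i}, compPerm i h σ τ (compSlot (σ.symm i) h (Sum.inl j)) =
        compSlot i h (Sum.inl ⟨σ j, hj j⟩) := fun j => compPerm_inl i h σ τ j (hj j)
    rw [koszulExp, sum_slot (σ.symm i) h]
    simp only [sum_slot (σ.symm i) h (fun b => ite _ _ _), Fin.lt_def, slot_inl_lt_inl,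
      slot_inl_lt_inr, slot_inr_lt_inl, slot_inr_lt_inr, compPerm_inr, e3]
    have h2 : ∑ b, e (compSlot i h (Sum.inr b)) = ∑ b, e (compSlot i h (Sum.inr (τ b))) :=
      (Equiv.sum_comp τ _).symm
    rw [Finset.sum_add_distrib, Finset.sum_add_distrib, h0, h2, Finset.sum_mul_sum]
    have hu' : ∀ j : {j // j ≠ σ.symm i}, e (compSlot i h (Sum.inl ⟨σ j, hj j⟩)) = u (σ j) :=
      fun j => (hu ⟨σ j, hj j⟩).symm
    simp only [hu', mul_add, Finset.sum_add_distrib, mul_ite, mul_zero]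
    rw [Finset.sum_comm (s := Finset.univ (α := {j // j ≠ σ.symm i}))
      (t := Finset.univ (α := Fin m))]
    simp only [mul_comm (u _) (e _), koszulExp, Fin.lt_def]
    ring
  rw [h1]; ring

lemma permT_insM [Fintype α] [DecidableEq α] (deg : α → ℤ) {n m l : ℕ} (b : ℤ) (i : Fin n)
    (h : l + 1 = n + m) (σ : Equiv.Perm (Fin n)) (τ : Equiv.Perm (Fin m))
    (z : α → (Fin n → α) → k) {w : α → (Fin m → α) → k} (hw : OpDeg deg b w) :
    mmul (permT deg σ z) (insM deg b i h (permT deg τ w)) =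
      permT deg (compPerm i h σ τ) (mmul z (insM deg b (σ.symm i) h w)) := by
  funext s x
  have hj : ∀ j, j ≠ σ.symm i → σ j ≠ i := fun j h h' => h ((Equiv.eq_symm_apply σ).2 h')
  rw [mmul, sum_insM, permT, mmul, sum_insM, Finset.mul_sum]
  refine Finset.sum_congr rfl fun q _ => ?_
  have h1 : (fun j => outer i h x q (σ j)) =
      outer (σ.symm i) h (fun c => x (compPerm i h σ τ c)) q := by
    funext j
    by_cases hji : j = σ.symm i
    · subst hji; simp [outer]
    · rw [outer_ne i h x q ⟨σ j, hj j hji⟩, outer_ne _ h _ q ⟨j, hji⟩,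
        compPerm_inl i h σ τ ⟨j, hji⟩ (hj j hji)]
  have h2 : (fun b => x (compPerm i h σ τ (compSlot (σ.symm i) h (Sum.inr b)))) =
      fun b => x (compSlot i h (Sum.inr (τ b))) := by
    funext b; rw [compPerm_inr]
  rw [permT, permT, h1, h2]
  by_cases hw0 : (w q fun b => x (compSlot i h (Sum.inr (τ b)))) = 0
  · simp [hw0]
  have h3 := hw _ _ hw0
  rw [Equiv.sum_comp τ (fun b => deg (x (compSlot i h (Sum.inr b))))] at h3
  have h4 := koszulExp_compPerm i h σ τ (fun c => deg (x c)) (fun j => deg (outer i h x q j))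
    (fun j => by simp only [outer_ne])
  have h5 := invSum_parity σ (fun j => deg (outer i h x q j)) (σ.symm i)
  have h6 : (∑ c, if c.1 < (σ (σ.symm i)).1 then deg (outer i h x q c) else 0) = pre deg x i := by
    rw [Equiv.apply_symm_apply]; exact pre_outer_self deg i h x q
  have h7 : (∑ c, if c.1 < (σ.symm i).1 then deg (outer i h x q (σ c)) else 0) =
      pre deg (fun c => x (compPerm i h σ τ c)) (σ.symm i) := by
    rw [← pre_outer_self deg _ h _ q, ← h1]; rfl
  rw [h6, h7] at h5
  simp only [h3, outer_self] at h4
  have h8 : sgn k (koszulExp σ fun j => deg (outer i h x q j)) *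
      (sgn k (b * pre deg x i) * sgn k (koszulExp τ fun c => deg (x (compSlot i h (Sum.inr c))))) =
      sgn k (koszulExp (compPerm i h σ τ) fun c => deg (x c)) *
        sgn k (b * pre deg (fun c => x (compPerm i h σ τ c)) (σ.symm i)) := by
    rw [← sgn_add, ← sgn_add, ← sgn_add]
    apply sgn_congr
    obtain ⟨r, hr⟩ := h5
    refine ⟨b * (r - pre deg (fun c => x (compPerm i h σ τ c)) (σ.symm i)), ?_⟩
    linear_combination b * hr - h4
  linear_combination (z s (outer (σ.symm i) h (fun c => x (compPerm i h σ τ c)) q) *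
    w q (fun b => x (compSlot i h (Sum.inr (τ b))))) * h8

end coend

/-- A (symmetric, unital) operad in cochain complexes of `k`-modules, in terms of its partial
compositions `p ∘_i q`. The symmetric groups act from the left; in an algebra,
`(σ • p)(a_1, …, a_n) = ± p(a_{σ 1}, …, a_{σ n})`. -/
structure DGOperad (k : Type u) [CommRing k] where
  obj : ℕ → CochainComplex (ModuleCat.{u} k) ℤ
  perm (n : ℕ) (d : ℤ) : Representation k (Equiv.Perm (Fin n)) ((obj n).X d)
  one : (obj 1).X 0
  comp {n m l : ℕ} {a b c : ℤ} (i : Fin n) (hl : l + 1 = n + m) (hd : a + b = c) :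
    (obj n).X a →ₗ[k] (obj m).X b →ₗ[k] (obj l).X c
  d_perm {n : ℕ} {a : ℤ} (σ : Equiv.Perm (Fin n)) (p : (obj n).X a) :
    (obj n).d a (a + 1) (perm n a σ p) = perm n (a + 1) σ ((obj n).d a (a + 1) p)
  d_one : (obj 1).d 0 1 one = 0
  d_comp {n m l : ℕ} {a b c : ℤ} (i : Fin n) (hl : l + 1 = n + m) (hd : a + b = c)
    (p : (obj n).X a) (q : (obj m).X b) :
    (obj l).d c (c + 1) (comp i hl hd p q) =
      comp i hl (by omega) ((obj n).d a (a + 1) p) q +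
        sgn k a • comp i hl (by omega) p ((obj m).d b (b + 1) q)
  one_comp {m : ℕ} {b : ℤ} (q : (obj m).X b) :
    comp (0 : Fin 1) (Nat.add_comm m 1) (zero_add b) one q = q
  comp_one {n : ℕ} {a : ℤ} (i : Fin n) (p : (obj n).X a) :
    comp i rfl (add_zero a) p one = p
  comp_assoc {n m r s s' t : ℕ} {a b c ab bc abc : ℤ} (i : Fin n) (j : Fin m)
    (hs : s + 1 = n + m) (ht : t + 1 = s + r) (hs' : s' + 1 = m + r) (ht' : t + 1 = n + s')
    (hab : a + b = ab) (habc : ab + c = abc) (hbc : b + c = bc) (habc' : a + bc = abc)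
    (x : (obj n).X a) (y : (obj m).X b) (z : (obj r).X c) :
    comp (compSlot i hs (Sum.inr j)) ht habc (comp i hs hab x y) z =
      comp i ht' habc' x (comp j hs' hbc y z)
  comp_comm {n m r s s' t : ℕ} {a b c ab ac abc : ℤ} (i j : Fin n) (hij : i < j)
    (hs : s + 1 = n + m) (ht : t + 1 = s + r) (hs' : s' + 1 = n + r) (ht' : t + 1 = s' + m)
    (hab : a + b = ab) (habc : ab + c = abc) (hac : a + c = ac) (habc' : ac + b = abc)
    (x : (obj n).X a) (y : (obj m).X b) (z : (obj r).X c) :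
    comp (compSlot i hs (Sum.inl ⟨j, hij.ne'⟩)) ht habc (comp i hs hab x y) z =
      sgn k (b * c) •
        comp (compSlot j hs' (Sum.inl ⟨i, hij.ne⟩)) ht' habc' (comp j hs' hac x z) y
  perm_comp {n m l : ℕ} {a b c : ℤ} (i : Fin n) (hl : l + 1 = n + m) (hd : a + b = c)
    (σ : Equiv.Perm (Fin n)) (τ : Equiv.Perm (Fin m)) (p : (obj n).X a) (q : (obj m).X b) :
    comp i hl hd (perm n a σ p) (perm m b τ q) =
      perm l c (compPerm i hl σ τ) (comp (σ.symm i) hl hd p q)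

namespace DGOperad

variable {k : Type u} [CommRing k]

/-- A morphism of operads. -/
@[ext]
structure Hom (P Q : DGOperad k) where
  app (n : ℕ) : P.obj n ⟶ Q.obj n
  map_perm {n : ℕ} {a : ℤ} (σ : Equiv.Perm (Fin n)) (p : (P.obj n).X a) :
    (app n).f a (P.perm n a σ p) = Q.perm n a σ ((app n).f a p)
  map_one : (app 1).f 0 P.one = Q.one
  map_comp {n m l : ℕ} {a b c : ℤ} (i : Fin n) (hl : l + 1 = n + m) (hd : a + b = c)
    (p : (P.obj n).X a) (q : (P.obj m).X b) :
    (app l).f c (P.comp i hl hd p q) = Q.comp i hl hd ((app n).f a p) ((app m).f b q)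

/-- `E_∞`-operads: every `P(n)` consists of projective `k[Σ_n]`-modules, and there is an augmentation
of `P` to the commutative operad (`k` in degree `0` for all `n`, all compositions the
multiplication, trivial symmetric group actions) that is a quasi-isomorphism in each arity. -/
structure IsEInfinity (P : DGOperad k) : Prop where
  projective (n : ℕ) (d : ℤ) :
    Module.Projective (MonoidAlgebra k (Equiv.Perm (Fin n))) (P.perm n d).asModule
  acyclic : ∃ ε : ∀ (n : ℕ) (d : ℤ), (P.obj n).X d →ₗ[k] k,
    (∀ n d, d ≠ 0 → ε n d = 0) ∧
    (∀ n (x : (P.obj n).X (-1)), ε n 0 ((P.obj n).d (-1) 0 x) = 0) ∧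
    ε 1 0 P.one = 1 ∧
    (∀ {n m l : ℕ} {a b c : ℤ} (i : Fin n) (hl : l + 1 = n + m) (hd : a + b = c)
      (p : (P.obj n).X a) (q : (P.obj m).X b),
      ε l c (P.comp i hl hd p q) = ε n a p * ε m b q) ∧
    (∀ n d σ (p : (P.obj n).X d), ε n d (P.perm n d σ p) = ε n d p) ∧
    (∀ n d (x : (P.obj n).X d), (P.obj n).d d (d + 1) x = 0 → ε n d x = 0 →
      ∃ y : (P.obj n).X (d - 1), (P.obj n).d (d - 1) d y = x) ∧
    (∀ n, ∃ x : (P.obj n).X 0, (P.obj n).d 0 1 x = 0 ∧ ε n 0 x = 1)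

/-- An algebra over the operad `P`: a cochain complex `A` with structure maps
`P(n) ⊗ A^{⊗ n} → A`, which are given on homogeneous elements. The elements `⟨e, a⟩` of the type
`Σ s, A^s` are elements with their degree. In `act_comp`, the family `a'` is `a` with the block
that belongs to `q` replaced by `q` of this block; in `d_act`, the family `a' j` is `a` with the
`j`-th element `a_j` replaced by `d a_j`. -/
structure Alg (P : DGOperad k) where
  cpx : CochainComplex (ModuleCat.{u} k) ℤ
  act {n : ℕ} {d t : ℤ} (e : Fin n → ℤ) (h : d + ∑ j, e j = t) :
    (P.obj n).X d →ₗ[k] MultilinearMap k (fun j => cpx.X (e j)) (cpx.X t)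
  act_one {t : ℤ} (a : Fin 1 → cpx.X t) :
    act (fun _ => t) (by simp) P.one a = a 0
  act_perm {n : ℕ} {d t : ℤ} (σ : Equiv.Perm (Fin n)) (e : Fin n → ℤ)
    (h : d + ∑ j, e j = t) (p : (P.obj n).X d) (a : ∀ j, cpx.X (e j)) :
    act e h (P.perm n d σ p) a =
      sgn k (koszulExp σ e) •
        act (fun j => e (σ j)) (by rw [Equiv.sum_comp σ e]; exact h) p (fun j => a (σ j))
  act_comp {n m l : ℕ} {d d' d'' t t' : ℤ} (i : Fin n) (hl : l + 1 = n + m) (hd : d + d' = d'')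
    (p : (P.obj n).X d) (q : (P.obj m).X d') (e : Fin l → ℤ) (a : ∀ c, cpx.X (e c))
    (h : d'' + ∑ c, e c = t)
    (h' : d' + ∑ b, e (compSlot i hl (Sum.inr b)) = t')
    (e' : Fin n → ℤ) (a' : ∀ j, cpx.X (e' j)) (h'' : d + ∑ j, e' j = t)
    (hi : (⟨e' i, a' i⟩ : Σ s, cpx.X s) = ⟨t', act _ h' q fun b => a (compSlot i hl (Sum.inr b))⟩)
    (hj : ∀ j : {j // j ≠ i}, (⟨e' j, a' j⟩ : Σ s, cpx.X s) =
      ⟨e (compSlot i hl (Sum.inl j)), a (compSlot i hl (Sum.inl j))⟩) :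
    act e h (P.comp i hl hd p q) a =
      sgn k (d' * ∑ c : Fin l, if c.1 < i.1 then e c else 0) • act e' h'' p a'
  d_act {n : ℕ} {d t : ℤ} (e : Fin n → ℤ) (h : d + ∑ j, e j = t) (p : (P.obj n).X d)
    (a : ∀ j, cpx.X (e j)) (e' : Fin n → Fin n → ℤ) (a' : ∀ j i, cpx.X (e' j i))
    (h' : ∀ j, d + ∑ i, e' j i = t + 1)
    (hj : ∀ j, (⟨e' j j, a' j j⟩ : Σ s, cpx.X s) = ⟨e j + 1, cpx.d (e j) (e j + 1) (a j)⟩)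
    (hi : ∀ j i, i ≠ j → (⟨e' j i, a' j i⟩ : Σ s, cpx.X s) = ⟨e i, a i⟩) :
    cpx.d t (t + 1) (act e h p a) =
      act e (by omega) ((P.obj n).d d (d + 1) p) a +
        ∑ j, sgn k (d + ∑ i, if i < j then e i else 0) • act (e' j) (h' j) p (a' j)

namespace Alg

/-- A morphism of algebras over an operad: a map of complexes that commutes with all
operations. -/
@[ext]
structure Hom {P : DGOperad k} (A B : P.Alg) where
  hom : A.cpx ⟶ B.cpx
  map_act {n : ℕ} {d t : ℤ} (e : Fin n → ℤ) (h : d + ∑ j, e j = t)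
    (p : (P.obj n).X d) (a : ∀ j, A.cpx.X (e j)) :
    hom.f t (A.act e h p a) = B.act e h p (fun j => hom.f (e j) (a j))

instance (P : DGOperad k) : Category P.Alg where
  Hom := Hom
  id A := { hom := 𝟙 _, map_act := by intros; rfl }
  comp f g :=
    { hom := f.hom ≫ g.hom
      map_act := fun e h p a => by
        simp only [HomologicalComplex.comp_f, ModuleCat.comp_apply, f.map_act, g.map_act] }

/-- Restriction of algebras along a morphism of operads. -/
def restrict {P Q : DGOperad k} (η : DGOperad.Hom P Q) : Q.Alg ⥤ P.Alg where
  obj A :=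
    { cpx := A.cpx
      act := fun {n d t} e h => (A.act e h).comp ((η.app n).f d).hom
      act_one := fun a => by
        simp only [LinearMap.comp_apply, η.map_one]; exact A.act_one a
      act_perm := fun σ e h p a => by
        have hc := η.map_perm σ p
        exact (congrArg (fun z => A.act e h z a) hc).trans <| A.act_perm σ e h _ a
      act_comp := fun i hl hd p q e a h h' e' a' h'' hi hj => by
        have hc := η.map_comp i hl hd p q
        exact (congrArg (fun z => A.act e h z a) hc).trans <| A.act_comp i hl hd _ _ e a h h' e' a' h'' hi hj
      d_act := fun {n d t} e h p a e' a' h' hj hi => by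
        have hc : ((η.app n).f (d + 1)).hom ((P.obj n).d d (d + 1) p) =
            (Q.obj n).d d (d + 1) (((η.app n).f d).hom p) :=
          (congrArg (fun f => f.hom p) ((η.app n).comm d (d + 1))).symm
        simp only [LinearMap.comp_apply, hc]
        exact A.d_act e h _ a e' a' h' hj hi }
  map f := { hom := f.hom, map_act := fun e h p a => f.map_act e h _ a }

end Alg
end DGOperad

section ez
variable {k : Type u} [CommRing k]

/-- The identity matrix `N_* → N_*`, as a unary operation. -/
def idM (k : Type u) [CommRing k] (α : Type) [DecidableEq α] : α → (Fin 1 → α) → k :=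
  fun s x => if x 0 = s then 1 else 0

/-- The differential of an operation `z : N → N^{⊗ n}` of cohomological degree `d`,
`∂ ∘ z - (-1) ^ d z ∘ ∂`. (Matrices act from the right on rows, so products appear in reverse
order.) -/
def diffM {α : Type} [Fintype α] [DecidableEq α] (deg : α → ℤ) (bd : α → α → k) {n : ℕ} (d : ℤ)
    (z : α → (Fin n → α) → k) : α → (Fin n → α) → k :=
  mmul z (bdT deg bd n) - sgn k d • mmul bd z

/-- The partial composite of operations of degrees `a` and `b`:
`(-1) ^ (a b)` times `(1 ⊗ … ⊗ w ⊗ … ⊗ 1) ∘ z`. -/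
def compM {α : Type} [Fintype α] [DecidableEq α] (deg : α → ℤ) {n m l : ℕ} (a b : ℤ) (i : Fin n)
    (h : l + 1 = n + m) (z : α → (Fin n → α) → k) (w : α → (Fin m → α) → k) :
    α → (Fin l → α) → k :=
  sgn k (a * b) • mmul z (insM deg b i h w)

section lin
variable {α β γ : Type} [Fintype β] (f f' : α → β → k) (g g' : β → γ → k) (c : k)

lemma mmul_add : mmul f (g + g') = mmul f g + mmul f g' := by
  funext a b; simp [mmul, mul_add, Finset.sum_add_distrib]
lemma add_mmul : mmul (f + f') g = mmul f g + mmul f' g := by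
  funext a b; simp [mmul, add_mul, Finset.sum_add_distrib]
lemma mmul_sub : mmul f (g - g') = mmul f g - mmul f g' := by
  funext a b; simp [mmul, mul_sub, Finset.sum_sub_distrib]
lemma sub_mmul : mmul (f - f') g = mmul f g - mmul f' g := by
  funext a b; simp [mmul, sub_mul, Finset.sum_sub_distrib]
lemma mmul_smul : mmul f (c • g) = c • mmul f g := by
  funext a b; simp only [mmul, Pi.smul_apply, smul_eq_mul, Finset.mul_sum]
  exact Finset.sum_congr rfl fun _ _ => by ring
lemma smul_mmul : mmul (c • f) g = c • mmul f g := by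
  funext a b; simp only [mmul, Pi.smul_apply, smul_eq_mul, Finset.mul_sum]
  exact Finset.sum_congr rfl fun _ _ => by ring
lemma mmul_zero' : mmul f (0 : β → γ → k) = 0 := by funext a b; simp [mmul]
lemma zero_mmul : mmul (0 : α → β → k) g = 0 := by funext a b; simp [mmul]

end lin

section laws
variable {α : Type} [Fintype α] [DecidableEq α] (deg : α → ℤ) {bd : α → α → k}

lemma insM_add {n m l : ℕ} (b : ℤ) (i : Fin n) (h : l + 1 = n + m) (w w' : α → (Fin m → α) → k) :
    insM deg b i h (w + w') = insM deg b i h w + insM deg b i h w' := by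
  funext t x; simp only [insM, Pi.add_apply]; split_ifs <;> ring

lemma insM_smul {n m l : ℕ} (b : ℤ) (i : Fin n) (h : l + 1 = n + m) (c : k)
    (w : α → (Fin m → α) → k) : insM deg b i h (c • w) = c • insM deg b i h w := by
  funext t x; simp only [insM, Pi.smul_apply, smul_eq_mul]; split_ifs <;> ring

lemma diffM_hom (hd : ∀ s s', bd s s' ≠ 0 → deg s = deg s' + 1) {n : ℕ} {d e : ℤ} (he : d + 1 = e) {z : α → (Fin n → α) → k} (hz : OpDeg deg d z) :
    OpDeg deg e (diffM deg bd d z) := by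
  intro s x h
  have h1 : mmul z (bdT deg bd n) s x ≠ 0 ∨ mmul bd z s x ≠ 0 := by
    by_contra! H
    apply h
    simp [diffM, H.1, H.2]
  rcases h1 with h1 | h1
  · rw [mmul, sum_bdT] at h1
    obtain ⟨j, -, h1⟩ := Finset.exists_ne_zero_of_sum_ne_zero h1
    obtain ⟨y, -, h1⟩ := Finset.exists_ne_zero_of_sum_ne_zero h1
    have h2 := hz _ _ (left_ne_zero_of_mul h1)
    have h3 := hd _ _ (right_ne_zero_of_mul (right_ne_zero_of_mul h1))
    rw [Fintype.sum_eq_add_sum_subtype_ne _ j] at h2 ⊢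
    rw [Function.update_self, h3] at h2
    have h4 : ∀ i : {i // i ≠ j}, Function.update x j y i = x i := fun i => by
      rw [Function.update_of_ne i.2]
    simp only [h4] at h2
    omega
  · obtain ⟨y, -, h1⟩ := Finset.exists_ne_zero_of_sum_ne_zero h1
    have h2 := hz _ _ (right_ne_zero_of_mul h1)
    have h3 := hd _ _ (left_ne_zero_of_mul h1)
    omega

lemma diffM_diffM (hd : ∀ s s', bd s s' ≠ 0 → deg s = deg s' + 1) (hbd : mmul bd bd = 0)
    {n : ℕ} (d : ℤ) (z : α → (Fin n → α) → k) :
    diffM deg bd (d + 1) (diffM deg bd d z) = 0 := by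
  simp only [diffM, sub_mmul, mmul_sub, smul_mmul, mmul_smul]
  rw [mmul_assoc, bdT_bdT deg hd hbd, mmul_zero', ← mmul_assoc bd bd, hbd, zero_mmul, sgn_succ,
    mmul_assoc bd]
  simp

lemma compM_hom {n m l : ℕ} {a b c : ℤ} (i : Fin n) (h : l + 1 = n + m) (hc : a + b = c)
    {z : α → (Fin n → α) → k} {w : α → (Fin m → α) → k} (hz : OpDeg deg a z) (hw : OpDeg deg b w) :
    OpDeg deg c (compM deg a b i h z w) := by
  intro s x h0
  have h1 : mmul z (insM deg b i h w) s x ≠ 0 := right_ne_zero_of_mul h0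
  rw [mmul, sum_insM] at h1
  obtain ⟨q, -, h1⟩ := Finset.exists_ne_zero_of_sum_ne_zero h1
  have h2 := hz _ _ (left_ne_zero_of_mul h1)
  have h3 := hw _ _ (right_ne_zero_of_mul (right_ne_zero_of_mul h1))
  rw [Fintype.sum_eq_add_sum_subtype_ne _ i, outer_self] at h2
  simp only [outer_ne] at h2
  rw [sum_slot i h]
  omega

lemma diffM_compM (hd : ∀ s s', bd s s' ≠ 0 → deg s = deg s' + 1)
    {n m l : ℕ} {a b c : ℤ} (i : Fin n) (h : l + 1 = n + m) (hc : a + b = c)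
    (z : α → (Fin n → α) → k) {w : α → (Fin m → α) → k} (hw : OpDeg deg b w) :
    diffM deg bd c (compM deg a b i h z w) = compM deg (a + 1) b i h (diffM deg bd a z) w +
      sgn k a • compM deg a (b + 1) i h z (diffM deg bd b w) := by
  subst hc
  have h1 := insM_bdT deg hd b i h w hw
  simp only [compM]
  rw [diffM, smul_mmul, mmul_smul, mmul_assoc, h1, mmul_add, mmul_smul, diffM, sub_mmul, smul_mmul,
    mmul_assoc, mmul_assoc, ← diffM]
  simp only [smul_add, smul_sub, smul_smul, ← sgn_add]
  rw [sgn_congr (k := k) (x := (a + 1) * b) (y := a * b + b) ⟨0, by ring⟩,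
    sgn_congr (k := k) (x := a + a * (b + 1)) (y := a * b) ⟨a, by ring⟩,
    sgn_congr (k := k) (x := (a + 1) * b + a) (y := a + b + a * b) ⟨0, by ring⟩]
  abel

lemma idM_compM {m : ℕ} (b : ℤ) (w : α → (Fin m → α) → k) :
    compM deg 0 b (0 : Fin 1) (Nat.add_comm m 1) (idM k α) w = w := by
  funext s x
  rw [compM, Pi.smul_apply, Pi.smul_apply, mmul, sum_insM, Finset.sum_eq_single s]
  · have h1 : ∀ c : Fin m, compSlot (0 : Fin 1) (Nat.add_comm m 1) (Sum.inr c) = c := fun c =>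
      Fin.ext (by simp [slot_inr])
    have h2 : pre deg x 0 = 0 := by simp [pre]
    rw [idM, outer_self]
    simp [h1, h2]
  · intro q _ hq
    rw [idM, outer_self, if_neg hq, zero_mul]
  · simp

lemma compM_idM {n : ℕ} (a : ℤ) (i : Fin n) (z : α → (Fin n → α) → k) :
    compM deg a 0 i (rfl : n + 1 = n + 1) z (idM k α) = z := by
  funext s x
  have h1 : ∀ j : {j // j ≠ i}, compSlot i (rfl : n + 1 = n + 1) (Sum.inl j) = j := fun j => by
    apply Fin.ext
    have := slot_inl_cases i (rfl : n + 1 = n + 1) j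
    omega
  have h2 : compSlot i (rfl : n + 1 = n + 1) (Sum.inr 0) = i := Fin.ext (by simp [slot_inr])
  rw [compM, Pi.smul_apply, Pi.smul_apply, mmul, sum_insM, Finset.sum_eq_single (x i)]
  · have h3 : outer i (rfl : n + 1 = n + 1) x (x i) = x := by
      funext j
      by_cases hj : j = i
      · subst hj; rw [outer_self]
      · rw [outer_ne i _ x _ ⟨j, hj⟩, h1]
    rw [h3, idM, h2]
    simp
  · intro q _ hq
    rw [idM, h2, if_neg hq.symm]; simp
  · simp

lemma diffM_idM (bd : α → α → k) : diffM deg bd 0 (idM k α) = 0 := by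
  funext s x
  rw [diffM, Pi.sub_apply, Pi.sub_apply, mmul, sum_bdT, Pi.smul_apply, Pi.smul_apply, mmul]
  simp [idM, pre, Finset.sum_ite_eq]

end laws

/-- The operations of arity `n` and degree `d` of the Eilenberg–Zilber operad: the families of maps
`N_*(Δ^m) → N_*(Δ^m)^{⊗ n}` of cohomological degree `d` that are natural in `Δ^m`. -/
def EZ (k : Type u) [CommRing k] (n : ℕ) (d : ℤ) :
    Submodule k (∀ m, Face m → (Fin n → Face m) → k) where
  carrier := {z | (∀ m, OpDeg fdeg d (z m)) ∧ ∀ (m l : ℕ) (θ : Fin (m + 1) →o Fin (l + 1)),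
    mmul (z m) (tensM (push k θ) n) = mmul (push k θ) (z l)}
  zero_mem' := ⟨fun m s x h => (h rfl).elim, fun m l θ => by
    simp only [Pi.zero_apply, mmul_zero', zero_mmul]⟩
  add_mem' := fun {z z'} hz hz' => ⟨fun m s x h => by
      by_cases h1 : z m s x = 0
      · exact hz'.1 m s x fun h2 => h (by simp [h1, h2])
      · exact hz.1 m s x h1,
    fun m l θ => by simp only [Pi.add_apply, mmul_add, add_mmul, hz.2, hz'.2]⟩
  smul_mem' := fun c z hz => ⟨fun m s x h => hz.1 m s x (right_ne_zero_of_mul h),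
    fun m l θ => by simp only [Pi.smul_apply, mmul_smul, smul_mmul, hz.2]⟩

lemma bdry_push' {m l : ℕ} (θ : Fin (m + 1) →o Fin (l + 1)) :
    mmul (bdry k) (push k θ) = mmul (push k θ) (bdry k) := by
  funext s y; exact bdry_push θ s y

lemma bdry_bdry' {m : ℕ} : mmul (bdry k) (bdry k) = (0 : Face m → Face m → k) := by
  funext s y; exact bdry_bdry s y

/-- The differential of the Eilenberg–Zilber operad. -/
def EZ.diff (n : ℕ) {d e : ℤ} (h : d + 1 = e) : EZ k n d →ₗ[k] EZ k n e where
  toFun z := ⟨fun m => diffM fdeg (bdry k) d (z.1 m),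
    fun m => diffM_hom fdeg (fun _ _ => bdry_deg) h (z.2.1 m), fun m l θ => by
      change mmul (diffM fdeg (bdry k) d (z.1 m)) _ = mmul _ (diffM fdeg (bdry k) d (z.1 l))
      rw [diffM, diffM, sub_mmul, mmul_sub, smul_mmul, mmul_smul, mmul_assoc,
        bdT_tensM fdeg fdeg (fun _ _ => push_deg) (bdry_push' θ), ← mmul_assoc, z.2.2,
        mmul_assoc, mmul_assoc, z.2.2, ← mmul_assoc (bdry k), bdry_push',
        mmul_assoc (push k θ) (bdry k)]⟩
  map_add' z z' := Subtype.ext <| funext fun m => by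
    simp only [diffM, Submodule.coe_add, Pi.add_apply, add_mmul, mmul_add, smul_add]; abel
  map_smul' c z := Subtype.ext <| funext fun m => by
    simp only [diffM, Submodule.coe_smul, Pi.smul_apply, smul_mmul, mmul_smul, smul_sub,
      RingHom.id_apply, smul_comm c]

/-- The composition of the Eilenberg–Zilber operad. -/
def EZ.comp {n m l : ℕ} {a b c : ℤ} (i : Fin n) (hl : l + 1 = n + m) (hd : a + b = c) :
    EZ k n a →ₗ[k] EZ k m b →ₗ[k] EZ k l c :=
  LinearMap.mk₂ k
    (fun z w => ⟨fun r => compM fdeg a b i hl (z.1 r) (w.1 r),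
      fun r => compM_hom fdeg i hl hd (z.2.1 r) (w.2.1 r), fun r s θ => by
        change mmul (compM fdeg a b i hl (z.1 r) (w.1 r)) _ =
          mmul _ (compM fdeg a b i hl (z.1 s) (w.1 s))
        rw [compM, compM, smul_mmul, mmul_smul, mmul_assoc,
          insM_tensM fdeg fdeg (fun _ _ => push_deg) b i hl (w.2.2 r s θ), ← mmul_assoc, z.2.2,
          mmul_assoc]⟩)
    (fun z z' w => Subtype.ext <| funext fun r => by
      simp only [compM, Submodule.coe_add, Pi.add_apply, add_mmul, smul_add])
    (fun t z w => Subtype.ext <| funext fun r => by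
      simp only [compM, Submodule.coe_smul, Pi.smul_apply, smul_mmul, smul_comm t])
    (fun z w w' => Subtype.ext <| funext fun r => by
      simp only [compM, Submodule.coe_add, Pi.add_apply, insM_add, mmul_add, smul_add])
    (fun t z w => Subtype.ext <| funext fun r => by
      simp only [compM, Submodule.coe_smul, Pi.smul_apply, insM_smul, mmul_smul, smul_comm t])

/-- The symmetric group action on the Eilenberg–Zilber operad. -/
def EZ.perm (n : ℕ) (d : ℤ) : Representation k (Equiv.Perm (Fin n)) (EZ k n d) where
  toFun σ :=
    { toFun z := ⟨fun m => permT fdeg σ (z.1 m), fun m => permT_hom fdeg σ (z.2.1 m), fun m l θ => by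
        funext s x
        rw [permT_tensM (deg := fdeg) (deg' := fdeg) (fun _ _ => push_deg), mmul_permT, z.2.2]⟩
      map_add' z z' := Subtype.ext <| funext fun m => by
        funext s x; simp [permT, mul_add]
      map_smul' c z := Subtype.ext <| funext fun m => by
        funext s x; simp [permT, mul_left_comm] }
  map_one' := LinearMap.ext fun z => Subtype.ext <| funext fun m => permT_one fdeg _
  map_mul' σ τ := LinearMap.ext fun z => Subtype.ext <| funext fun m => permT_mul fdeg σ τ _

/-- The complex of operations of arity `n`. -/
def EZ.complex (k : Type u) [CommRing k] (n : ℕ) : CochainComplex (ModuleCat.{u} k) ℤ where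
  X d := ModuleCat.of k (EZ k n d)
  d i j := if h : i + 1 = j then ModuleCat.ofHom (EZ.diff n h) else 0
  shape i j h := dif_neg h
  d_comp_d' i j l hij hjl := by
    obtain rfl : i + 1 = j := hij
    obtain rfl : i + 1 + 1 = l := hjl
    rw [dif_pos rfl, dif_pos rfl]
    exact ModuleCat.hom_ext <| LinearMap.ext fun z => Subtype.ext <| funext fun m =>
      diffM_diffM fdeg (fun _ _ => bdry_deg) bdry_bdry' i (z.1 m)

lemma EZ.complex_d (n : ℕ) (d : ℤ) (z : EZ k n d) :
    (EZ.complex k n).d d (d + 1) z = EZ.diff n rfl z := by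
  have : (EZ.complex k n).d d (d + 1) = ModuleCat.ofHom (EZ.diff n rfl) := dif_pos rfl
  rw [this]; rfl

/-- The Eilenberg–Zilber operad: the (co)endomorphism operad of the cosimplicial chain complex
`N_*(Δ^•)`. It acts on the normalized cochains of simplicial sets and on the normalized complexes
of cosimplicial commutative algebras. -/
def ezOperad (k : Type u) [CommRing k] : DGOperad k where
  obj n := EZ.complex k n
  perm n d := EZ.perm n d
  one := ⟨fun m => idM k (Face m), fun m s x h => by
      have : x 0 = s := by by_contra h'; exact h (if_neg h')
      simp [this], fun m l θ => by
      funext s x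
      have h1 : mmul (idM k (Face m)) (tensM (push k θ) 1) s x = push k θ s (x 0) := by
        rw [mmul, Finset.sum_eq_single fun _ => s]
        · simp [idM, tensM]
        · intro y _ hy
          have : idM k (Face m) s y = 0 := if_neg ?_
          · rw [this, zero_mul]
          intro h
          exact hy (funext fun j => by rw [Subsingleton.elim j 0, h])
        · simp
      rw [h1, mmul, Finset.sum_eq_single (x 0)]
      · simp [idM]
      · intro y _ hy
        exact mul_eq_zero_of_right _ (if_neg hy.symm)
      · simp⟩
  comp i hl hd := EZ.comp i hl hd
  d_perm {n a} σ p := by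
    refine (EZ.complex_d n a _).trans <| Eq.trans ?_ (congrArg (EZ.perm n (a + 1) σ) (EZ.complex_d n a p).symm)
    exact Subtype.ext <| funext fun m => by
      funext s x
      change diffM fdeg (bdry k) a (permT fdeg σ (p.1 m)) s x =
        permT fdeg σ (diffM fdeg (bdry k) a (p.1 m)) s x
      rw [diffM, permT_bdT fdeg (fun _ _ => bdry_deg), Pi.sub_apply, Pi.sub_apply, Pi.smul_apply,
        Pi.smul_apply, mmul_permT, permT, permT, diffM]
      simp only [Pi.sub_apply, Pi.smul_apply, smul_eq_mul]
      ring
  d_one := (EZ.complex_d 1 0 _).trans <| Subtype.ext <| funext fun m => diffM_idM fdeg (bdry k)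
  d_comp {n m l a b c} i hl hd p q := by
    refine (EZ.complex_d l c _).trans ?_
    have h1 := EZ.complex_d n a p
    have h2 := EZ.complex_d m b q
    rw [h1, h2]
    exact Subtype.ext <| funext fun r =>
      diffM_compM fdeg (fun _ _ => bdry_deg) i hl hd (p.1 r) (q.2.1 r)
  one_comp q := Subtype.ext <| funext fun r => idM_compM fdeg _ (q.1 r)
  comp_one i p := Subtype.ext <| funext fun r => compM_idM fdeg _ i (p.1 r)
  comp_assoc {n m r s s' t a b c ab bc abc} i j hs ht hs' ht' hab habc hbc habc' x y z :=
    Subtype.ext <| funext fun q => by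
      change compM fdeg ab c _ ht (compM fdeg a b i hs (x.1 q) (y.1 q)) (z.1 q) =
        compM fdeg a bc i ht' (x.1 q) (compM fdeg b c j hs' (y.1 q) (z.1 q))
      subst hab hbc
      simp only [compM, smul_mmul, insM_smul, mmul_smul, smul_smul, ← sgn_add]
      rw [mmul_assoc, insM_insM_assoc fdeg b c i j hs ht hs' ht', sgn_congr]
      exact ⟨0, by ring⟩
  comp_comm {n m r s s' t a b c ab ac abc} i j hij hs ht hs' ht' hab habc hac habc' x y z :=
    Subtype.ext <| funext fun q => by
      change compM fdeg ab c _ ht (compM fdeg a b i hs (x.1 q) (y.1 q)) (z.1 q) =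
        sgn k (b * c) • compM fdeg ac b _ ht' (compM fdeg a c j hs' (x.1 q) (z.1 q)) (y.1 q)
      subst hab hac
      simp only [compM, smul_mmul, smul_smul, ← sgn_add]
      rw [mmul_assoc, insM_insM_comm fdeg b c i j hij hs ht hs' ht' _ (y.2.1 q), mmul_assoc,
        mmul_smul, smul_smul, ← sgn_add, sgn_congr]
      exact ⟨0, by ring⟩
  perm_comp {n m l a b c} i hl hd σ τ p q := Subtype.ext <| funext fun r => by
    change sgn k (a * b) • mmul (permT fdeg σ (p.1 r)) (insM fdeg b i hl (permT fdeg τ (q.1 r))) =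
      permT fdeg (compPerm i hl σ τ) (sgn k (a * b) • mmul (p.1 r) (insM fdeg b (σ.symm i) hl (q.1 r)))
    rw [permT_insM fdeg b i hl σ τ _ (q.2.1 r)]
    funext s x
    simp only [permT, Pi.smul_apply, smul_eq_mul]
    ring

end ez

section vec
variable {k : Type u} [CommRing k] {α β : Type} [Fintype α]

/-- A matrix applied to a vector with entries in a module. -/
def mact {M : Type*} [AddCommGroup M] [Module k M] (z : β → α → k) (v : α → M) : β → M :=
  fun b => ∑ a, z b a • v a

/-- The tensor product of vectors with entries in a commutative ring, multiplied out. -/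
def tens {R : Type*} [CommRing R] {n : ℕ} (a : Fin n → α → R) : (Fin n → α) → R :=
  fun x => ∏ j, a j (x j)

section lin
variable {M : Type*} [AddCommGroup M] [Module k M] (z z' : β → α → k) (v : α → M) (c : k)

lemma mact_mmul {γ : Type} (g : γ → β → k) [Fintype β] :
    mact (mmul g z) v = mact g (mact z v) := by
  funext b
  simp only [mact, mmul, Finset.sum_smul, Finset.smul_sum, mul_smul]
  exact Finset.sum_comm

lemma sub_mact : mact (z - z') v = mact z v - mact z' v := by
  funext b; simp [mact, sub_smul]
lemma add_mact : mact (z + z') v = mact z v + mact z' v := by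
  funext b; simp [mact, add_smul, Finset.sum_add_distrib]
lemma smul_mact : mact (c • z) v = c • mact z v := by
  funext b; simp [mact, mul_smul, Finset.smul_sum]
lemma mact_smul : mact z (c • v) = c • mact z v := by
  funext b; simp [mact, Finset.smul_sum, smul_comm c]
lemma mact_sum {ι : Type*} (s : Finset ι) (v : ι → α → M) :
    mact z (∑ i ∈ s, v i) = ∑ i ∈ s, mact z (v i) := by
  funext b
  simp only [mact, Finset.sum_apply, Finset.smul_sum]
  exact Finset.sum_comm

end lin

variable {R : Type*} [CommRing R] [Algebra k R]

lemma tensM_tens (P : α → β → k) [Fintype β] {n : ℕ} (a : Fin n → β → R) :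
    mact (tensM P n) (tens a) = tens fun j => mact P (a j) := by
  classical
  funext x
  simp only [mact, tens, tensM, Finset.prod_univ_sum, Fintype.piFinset_univ]
  refine Finset.sum_congr rfl fun y _ => ?_
  rw [Finset.prod_smul]

/-- A vector is supported on the basis elements of degree `e`. -/
def VecDeg (deg : α → ℤ) (e : ℤ) (v : α → R) : Prop := ∀ s, v s ≠ 0 → deg s = e

variable [DecidableEq α] (deg : α → ℤ)

lemma pre_of_tens {n : ℕ} {e : Fin n → ℤ} {a : Fin n → α → R} (ha : ∀ j, VecDeg deg (e j) (a j))
    {t : Fin n → α} (c : ℕ) (h : ∀ j : Fin n, j.1 < c → a j (t j) ≠ 0) :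
    pre deg t c = ∑ j : Fin n, if j.1 < c then e j else 0 := by
  refine Finset.sum_congr rfl fun j _ => ?_
  by_cases hj : j.1 < c
  · rw [if_pos hj, if_pos hj]; exact ha j _ (h j hj)
  · rw [if_neg hj, if_neg hj]

lemma bdT_tens (bd : α → α → k) {n : ℕ} {e : Fin n → ℤ} {a : Fin n → α → R}
    (ha : ∀ j, VecDeg deg (e j) (a j)) :
    mact (bdT deg bd n) (tens a) = ∑ j : Fin n, sgn k (∑ i : Fin n, if i.1 < j.1 then e i else 0) •
      tens (Function.update a j (mact bd (a j))) := by
  funext t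
  rw [mact, bdT_sum, Finset.sum_apply]
  refine Finset.sum_congr rfl fun j _ => ?_
  have h1 : ∀ r, tens a (Function.update t j r) = a j r * ∏ i : {i // i ≠ j}, a i (t i) :=
    fun r => by
    rw [tens, Fintype.prod_eq_mul_prod_subtype_ne _ j, Function.update_self]
    congr 1
    exact Finset.prod_congr rfl fun i _ => by rw [Function.update_of_ne i.2]
  have h2 : tens (Function.update a j (mact bd (a j))) t =
      (∑ r, bd (t j) r • a j r) * ∏ i : {i // i ≠ j}, a i (t i) := by
    rw [tens, Fintype.prod_eq_mul_prod_subtype_ne _ j, Function.update_self]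
    congr 1
    exact Finset.prod_congr rfl fun i _ => by rw [Function.update_of_ne i.2]
  simp only [Pi.smul_apply, h1, h2]
  by_cases h3 : ∏ i : {i // i ≠ j}, a i (t i) = 0
  · simp [h3]
  rw [pre_of_tens deg ha j.1]
  · rw [Finset.sum_mul, Finset.smul_sum]
    refine Finset.sum_congr rfl fun r _ => ?_
    rw [mul_smul, smul_mul_assoc]
  · intro i hi h0
    exact h3 (Finset.prod_eq_zero (Finset.mem_univ ⟨i, fun h => by subst h; omega⟩) h0)

lemma insM_tens {n m l : ℕ} (d : ℤ) (i : Fin n) (h : l + 1 = n + m) (w : α → (Fin m → α) → k)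
    {e : Fin l → ℤ} {a : Fin l → α → R} (ha : ∀ j, VecDeg deg (e j) (a j)) {a' : Fin n → α → R}
    (hi : a' i = mact w (tens fun b => a (compSlot i h (Sum.inr b))))
    (hj : ∀ j : {j // j ≠ i}, a' j = a (compSlot i h (Sum.inl j))) :
    mact (insM deg d i h w) (tens a) =
      sgn k (d * ∑ c : Fin l, if c.1 < i.1 then e c else 0) • tens a' := by
  funext t
  rw [mact, insM_sum, Pi.smul_apply]
  have h1 : ∀ r, tens a (join i h t r) = (∏ j : {j // j ≠ i}, a' j (t j)) *
      tens (fun b => a (compSlot i h (Sum.inr b))) r := fun r => by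
    rw [tens, prod_slot i h]
    simp only [join_inl, join_inr, hj, tens]
  have h2 : tens a' t = (∏ j : {j // j ≠ i}, a' j (t j)) *
      mact w (tens fun b => a (compSlot i h (Sum.inr b))) (t i) := by
    rw [tens, Fintype.prod_eq_mul_prod_subtype_ne _ i, hi, mul_comm]
  simp only [h1, h2, mact]
  by_cases h3 : ∏ i : {j // j ≠ i}, a' i (t i) = 0
  · simp [h3]
  have h4 : pre deg t i = ∑ c : Fin l, if c.1 < i.1 then e c else 0 := by
    rw [pre, Fintype.sum_eq_add_sum_subtype_ne _ i, if_neg (lt_irrefl _), zero_add, sum_slot i h]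
    simp only [slot_inl_lt, slot_inr_lt, if_false, Finset.sum_const_zero, add_zero]
    refine Finset.sum_congr rfl fun j _ => ?_
    by_cases hji : j.1.1 < i.1
    · rw [if_pos hji, if_pos hji]
      apply ha
      rw [← hj]
      exact fun h0 => h3 (Finset.prod_eq_zero (Finset.mem_univ j) h0)
    · rw [if_neg hji, if_neg hji]
  rw [h4]
  generalize sgn k _ = c
  rw [Finset.mul_sum, Finset.smul_sum]
  refine Finset.sum_congr rfl fun r _ => ?_
  rw [mul_smul, mul_smul_comm]

lemma permT_tens {n : ℕ} (σ : Equiv.Perm (Fin n)) (z : α → (Fin n → α) → k)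
    {e : Fin n → ℤ} {a : Fin n → α → R} (ha : ∀ j, VecDeg deg (e j) (a j)) :
    mact (permT deg σ z) (tens a) = sgn k (koszulExp σ e) • mact z (tens fun j => a (σ j)) := by
  funext s
  let E : (Fin n → α) ≃ (Fin n → α) :=
    ⟨fun y j => y (σ j), fun y j => y (σ.symm j), fun y => by simp, fun y => by simp⟩
  rw [mact, Pi.smul_apply, mact, Finset.smul_sum]
  refine (Finset.sum_congr rfl fun y _ => ?_).trans
    (E.sum_comp fun y => sgn k (koszulExp σ e) • z s y • tens (fun j => a (σ j)) y)
  have h1 : tens (fun j => a (σ j)) (E y) = tens a y := Equiv.prod_comp σ fun j => a j (y j)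
  rw [h1, permT, mul_smul]
  by_cases h : tens a y = 0
  · simp [h]
  · have h2 : ∀ j, deg (y j) = e j := fun j =>
      ha j _ fun h0 => h (Finset.prod_eq_zero (Finset.mem_univ j) h0)
    simp only [h2]
    rfl

lemma mact_homV {n : ℕ} {d t : ℤ} {z : α → (Fin n → α) → k} (hz : OpDeg deg d z)
    {e : Fin n → ℤ} {a : Fin n → α → R} (ha : ∀ j, VecDeg deg (e j) (a j))
    (h : d + ∑ j, e j = t) : VecDeg deg t (mact z (tens a)) := by
  intro s hs
  obtain ⟨x, -, hx⟩ := Finset.exists_ne_zero_of_sum_ne_zero hs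
  have h1 := hz s x fun h0 => hx (by rw [h0, zero_smul])
  have h2 : ∀ j, deg (x j) = e j := fun j => ha j _ fun h0 => hx (by
    rw [tens, Finset.prod_eq_zero (Finset.mem_univ j) h0, smul_zero])
  simp only [h2] at h1
  omega

end vec

/-- The sum of the products `e a * e b` over `a < b`. -/
def pairExp {n : ℕ} (e : Fin n → ℤ) : ℤ := ∑ a, ∑ b, if a < b then e a * e b else 0

lemma two_mul_pairExp {n : ℕ} (e : Fin n → ℤ) :
    2 * pairExp e = (∑ a, e a) ^ 2 - ∑ a, e a ^ 2 := by
  rw [pairExp, two_mul]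
  nth_rw 2 [Finset.sum_comm]
  rw [← Finset.sum_add_distrib, sq, Finset.sum_mul_sum, ← Finset.sum_sub_distrib]
  refine Finset.sum_congr rfl fun a _ => ?_
  rw [← Finset.sum_add_distrib, eq_sub_iff_add_eq,
    show e a ^ 2 = ∑ b, if b = a then e a * e b else 0 by simp [sq], ← Finset.sum_add_distrib]
  refine Finset.sum_congr rfl fun b _ => ?_
  rcases lt_trichotomy a b with h | h | h
  · simp [h, h.not_gt, h.ne']
  · subst h; simp
  · simp [h, h.not_gt, h.ne, mul_comm]

section norm
variable {k : Type u} [CommRing k]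

/-- The ring in cosimplicial degree `m`. -/
abbrev lev (A : SimplexCategory ⥤ CommAlgCat.{u} k) (m : ℕ) : Type u :=
  A.obj (SimplexCategory.mk m)

/-- The structure map of a cosimplicial algebra at a monotone map. -/
def levMap (A : SimplexCategory ⥤ CommAlgCat.{u} k) {m l : ℕ} (θ : Fin (m + 1) →o Fin (l + 1)) :
    lev A m →ₐ[k] lev A l := (A.map (SimplexCategory.mkHom θ)).hom

variable (A : SimplexCategory ⥤ CommAlgCat.{u} k)

/-- The degree `e` part of the normalized complex of a cosimplicial algebra `A`, in the form
`N^e(A) = Hom_Δ(N_e(Δ^•), A^•)`: a family of elements `a m s` of `A^m`, for `e`-dimensional faces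
`s` of `Δ^m`, natural in `m`. It is determined by its value on the top face of `Δ^e`, and the
values that occur are the elements of `A^e` that are killed by all codegeneracies: see
`NC.exists_top_iff` and `NC.ext_top` below. -/
def NC (e : ℤ) : Submodule k (∀ m, Face m → lev A m) where
  carrier := {a | (∀ m, VecDeg fdeg e (a m)) ∧ ∀ (m l : ℕ) (θ : Fin (m + 1) →o Fin (l + 1)) s,
    levMap A θ (a m s) = mact (push k θ) (a l) s}
  zero_mem' := ⟨fun m s h => (h rfl).elim, fun m l θ s => by simp [mact]⟩
  add_mem' := fun {a b} ha hb => ⟨fun m s h => by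
      by_cases h1 : a m s = 0
      · exact hb.1 m s fun h2 => h (by simp [h1, h2])
      · exact ha.1 m s h1,
    fun m l θ s => by
      rw [Pi.add_apply, Pi.add_apply, map_add, ha.2, hb.2]
      simp [mact, Finset.sum_add_distrib]⟩
  smul_mem' := fun c a ha => ⟨fun m s h => ha.1 m s fun h0 => h (by simp [h0]),
    fun m l θ s => by
      rw [Pi.smul_apply, Pi.smul_apply, map_smul, ha.2, Pi.smul_apply, mact_smul, Pi.smul_apply]⟩

variable {A}

lemma levMap_mact {α β : Type} [Fintype α] {m l : ℕ} (θ : Fin (m + 1) →o Fin (l + 1))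
    (z : β → α → k) (v : α → lev A m) (b : β) :
    levMap A θ (mact z v b) = mact z (fun a => levMap A θ (v a)) b := by
  simp [mact, map_sum]

/-- The differential of the normalized complex, `a ↦ (-1) ^ (e + 1) a ∘ ∂`, that is, up to the sign
`(-1) ^ (e + 1)` the alternating sum of the cofaces. -/
def NC.diff {e e' : ℤ} (h : e + 1 = e') : NC A e →ₗ[k] NC A e' where
  toFun a := ⟨fun m => sgn k (e + 1) • mact (bdry k) (a.1 m), fun m s hs => by
      have h1 : mact (bdry k) (a.1 m) s ≠ 0 := fun h0 => hs (by
        change sgn k (e + 1) • mact (bdry k) (a.1 m) s = 0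
        rw [h0, smul_zero])
      obtain ⟨y, -, hy⟩ := Finset.exists_ne_zero_of_sum_ne_zero h1
      have h2 := a.2.1 m y fun h0 => hy (by rw [h0, smul_zero])
      have h3 := bdry_deg (k := k) (s := s) (s' := y) fun h0 => hy (by rw [h0, zero_smul])
      omega, fun m l θ s => by
      have h1 : (fun s => levMap A θ (a.1 m s)) = mact (push k θ) (a.1 l) :=
        funext fun s => a.2.2 m l θ s
      change levMap A θ (sgn k (e + 1) • mact (bdry k) (a.1 m) s) =
        mact (push k θ) (sgn k (e + 1) • mact (bdry k) (a.1 l)) s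
      rw [map_smul, levMap_mact, h1, mact_smul, Pi.smul_apply, ← mact_mmul,
        ← mact_mmul, bdry_push']⟩
  map_add' a b := Subtype.ext <| funext fun m => by
    funext s; simp [mact, Finset.sum_add_distrib]
  map_smul' c a := Subtype.ext <| funext fun m => by
    simp only [Submodule.coe_smul, Pi.smul_apply, mact_smul, RingHom.id_apply, smul_comm c]

/-- The normalized complex of a cosimplicial commutative algebra. -/
def NC.complex (A : SimplexCategory ⥤ CommAlgCat.{u} k) : CochainComplex (ModuleCat.{u} k) ℤ where
  X e := ModuleCat.of k (NC A e)
  d i j := if h : i + 1 = j then ModuleCat.ofHom (NC.diff h) else 0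
  shape i j h := dif_neg h
  d_comp_d' i j l hij hjl := by
    obtain rfl : i + 1 = j := hij
    obtain rfl : i + 1 + 1 = l := hjl
    rw [dif_pos rfl, dif_pos rfl]
    refine ModuleCat.hom_ext <| LinearMap.ext fun a => Subtype.ext <| funext fun m => ?_
    change sgn k (i + 1 + 1) • mact (bdry k) (sgn k (i + 1) • mact (bdry k) (a.1 m)) = 0
    rw [mact_smul, ← mact_mmul, bdry_bdry']
    funext s; simp [mact]

lemma NC.complex_d (e : ℤ) (a : NC A e) :
    (NC.complex A).d e (e + 1) a = NC.diff rfl a := by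
  have : (NC.complex A).d e (e + 1) = ModuleCat.ofHom (NC.diff rfl) := dif_pos rfl
  rw [this]; rfl

/-- The multilinear map `(a_1, …, a_n) ↦ z(a_1 ⊗ … ⊗ a_n)`, without signs. -/
def NC.preAct {n : ℕ} {d : ℤ} (e : Fin n → ℤ) (z : EZ k n d) :
    MultilinearMap k (fun j => NC A (e j)) (∀ m, Face m → lev A m) :=
  MultilinearMap.pi fun m => MultilinearMap.pi fun s => ∑ x : Fin n → Face m, z.1 m s x •
    (MultilinearMap.mkPiAlgebra k (Fin n) (lev A m)).compLinearMap fun j =>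
      (LinearMap.proj (x j)).comp ((LinearMap.proj m).comp (NC A (e j)).subtype)

lemma NC.preAct_apply {n : ℕ} {d : ℤ} (e : Fin n → ℤ) (z : EZ k n d) (a : ∀ j, NC A (e j)) (m : ℕ) :
    NC.preAct e z a m = mact (z.1 m) (tens fun j => (a j).1 m) := by
  funext s
  simp [NC.preAct, mact, tens, MultilinearMap.pi_apply]

lemma NC.preAct_mem {n : ℕ} {d t : ℤ} (e : Fin n → ℤ) (h : d + ∑ j, e j = t) (z : EZ k n d)
    (a : ∀ j, NC A (e j)) : NC.preAct e z a ∈ NC A t := by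
  refine ⟨fun m => ?_, fun m l θ s => ?_⟩
  · rw [NC.preAct_apply]
    exact mact_homV fdeg (z.2.1 m) (fun j => (a j).2.1 m) h
  · rw [NC.preAct_apply, NC.preAct_apply, levMap_mact, ← mact_mmul, ← z.2.2, mact_mmul, tensM_tens]
    have : (fun x => levMap A θ (tens (fun j => (a j).1 m) x)) =
        tens fun j => mact (push k θ) ((a j).1 l) := by
      funext x
      simp only [tens, map_prod]
      exact Finset.prod_congr rfl fun j _ => (a j).2.2 m l θ _
    rw [this]

/-- The action of the operations on the normalized complex:
`z(a_1, …, a_n) = ± μ ∘ (a_1 ⊗ … ⊗ a_n) ∘ z` with the multiplication `μ : A^{⊗ n} → A` and the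
Koszul sign. -/
def NC.act {n : ℕ} {d t : ℤ} (e : Fin n → ℤ) (h : d + ∑ j, e j = t) :
    EZ k n d →ₗ[k] MultilinearMap k (fun j => NC A (e j)) (NC A t) where
  toFun z := sgn k (d * (∑ j, e j) + pairExp e) •
    (NC.preAct e z).codRestrict (NC A t) (NC.preAct_mem e h z)
  map_add' z z' := by
    ext a m s
    simp [NC.preAct_apply, add_mact]
  map_smul' c z := by
    ext a m s
    simp [NC.preAct_apply, smul_mact, smul_comm c]

lemma NC.act_val {n : ℕ} {d t : ℤ} (e : Fin n → ℤ) (h : d + ∑ j, e j = t) (z : EZ k n d)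
    (a : ∀ j, NC A (e j)) (m : ℕ) : (NC.act e h z a).1 m =
      sgn k (d * (∑ j, e j) + pairExp e) • mact (z.1 m) (tens fun j => (a j).1 m) := by
  rw [← NC.preAct_apply]; rfl

lemma NC.sigma_val {s t : ℤ} {a : NC A s} {b : NC A t}
    (h : (⟨s, a⟩ : Σ e, (NC.complex A).X e) = ⟨t, b⟩) (m : ℕ) : s = t ∧ a.1 m = b.1 m := by
  refine ⟨congrArg Sigma.fst h, ?_⟩
  let F : (Σ e, (NC.complex A).X e) → ∀ m, Face m → lev A m := fun p => (show NC A p.1 from p.2).1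
  exact congrFun (congrArg F h) m

lemma pairExp_comp {n m l : ℕ} (i : Fin n) (h : l + 1 = n + m) (d : ℤ) (e : Fin l → ℤ)
    (e' : Fin n → ℤ) (hi : e' i = d + ∑ b, e (compSlot i h (Sum.inr b)))
    (hj : ∀ j : {j // j ≠ i}, e' j = e (compSlot i h (Sum.inl j))) :
    pairExp e' + pairExp (fun b => e (compSlot i h (Sum.inr b))) + d *
      ∑ b, e (compSlot i h (Sum.inr b)) = pairExp e + d * ∑ c, e c := by
  have h1 := two_mul_pairExp e'
  have h2 := two_mul_pairExp e
  have h3 := two_mul_pairExp fun b => e (compSlot i h (Sum.inr b))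
  rw [Fintype.sum_eq_add_sum_subtype_ne _ i, Fintype.sum_eq_add_sum_subtype_ne (fun a => e' a ^ 2) i]
    at h1
  rw [sum_slot i h, sum_slot i h (fun c => e c ^ 2)] at h2
  rw [sum_slot i h]
  simp only [hj, hi] at h1
  linarith

lemma pairExp_perm {n : ℕ} (σ : Equiv.Perm (Fin n)) (e : Fin n → ℤ) :
    pairExp (fun j => e (σ j)) = pairExp e :=
  pairSum_perm (fun a b => e a * e b) (fun a b => mul_comm _ _) σ

/-- The normalized complex of a cosimplicial commutative algebra as an algebra over the
Eilenberg–Zilber operad. -/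
def NC.alg (A : SimplexCategory ⥤ CommAlgCat.{u} k) : (ezOperad k).Alg where
  cpx := NC.complex A
  act e h := NC.act e h
  act_one {t} a := Subtype.ext <| funext fun m => by
    refine (NC.act_val _ _ _ a m).trans ?_
    funext s
    have h1 : pairExp (fun _ : Fin 1 => t) = 0 := by simp [pairExp]
    have h2 : ((ezOperad k).one : EZ k 1 0).1 m = idM k (Face m) := rfl
    rw [h1, h2, zero_mul, add_zero, sgn_zero, one_smul, mact, Finset.sum_eq_single fun _ => s]
    · simp [idM, tens]
    · intro y _ hy
      have : idM k (Face m) s y = 0 := if_neg fun h => hy (funext fun j => by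
        rw [Subsingleton.elim j 0, h])
      rw [this, zero_smul]
    · simp
  act_perm {n d t} σ e h p a := Subtype.ext <| funext fun m => by
    refine (NC.act_val e h _ a m).trans ?_
    refine Eq.trans ?_ (congrArg (sgn k (koszulExp σ e) • ·)
      (NC.act_val (fun j => e (σ j)) (by rw [Equiv.sum_comp σ e]; exact h) p
        (fun j => a (σ j)) m)).symm
    have h1 : ((ezOperad k).perm n d σ p : EZ k n d).1 m = permT fdeg σ ((p : EZ k n d).1 m) := rfl
    rw [h1, permT_tens fdeg σ _ (fun j => (a j).2.1 m), Equiv.sum_comp σ e, pairExp_perm, smul_comm]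
  act_comp {n m l d d' d'' t t'} i hl hd p q e a h h' e' a' h'' hi hj :=
    Subtype.ext <| funext fun r => by
      subst hd
      refine (NC.act_val e h _ a r).trans ?_
      refine Eq.trans ?_ (congrArg (sgn k (d' * ∑ c : Fin l, if c.1 < i.1 then e c else 0) • ·)
        (NC.act_val e' h'' p a' r)).symm
      have h1 : ((ezOperad k).comp i hl rfl p q : EZ k l (d + d')).1 r =
        compM fdeg d d' i hl ((p : EZ k n d).1 r) ((q : EZ k m d').1 r) := rfl
      obtain ⟨hi1, hi2⟩ := NC.sigma_val hi r
      have hi3 := hi2.trans (NC.act_val _ h' q _ r)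
      have hj1 := fun j => (NC.sigma_val (hj j) r).1
      have hj2 := fun j => (NC.sigma_val (hj j) r).2
      rw [h1, compM, smul_mact, mact_mmul]
      set c := sgn k (d' * (∑ b, e (compSlot i hl (Sum.inr b))) +
        pairExp fun b => e (compSlot i hl (Sum.inr b))) with hc
      let b' : Fin n → Face r → lev A r := Function.update (fun j => (a' j).1 r) i
        (mact ((q : EZ k m d').1 r) (tens fun b => (a (compSlot i hl (Sum.inr b))).1 r))
      have h2 : tens (fun j => (a' j).1 r) = c • tens b' := by
        funext x
        rw [tens, Fintype.prod_eq_mul_prod_subtype_ne _ i, Pi.smul_apply, tens,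
          Fintype.prod_eq_mul_prod_subtype_ne _ i, hi3]
        have : ∀ j : {j // j ≠ i}, b' j = (a' j).1 r := fun j => Function.update_of_ne j.2 _ _
        simp only [this, Pi.smul_apply, smul_mul_assoc]
        congr 2
        simp [b']
      rw [insM_tens fdeg d' i hl _ (fun j => (a j).2.1 r) (a' := b') (by simp [b'])
        (fun j => (Function.update_of_ne j.2 _ _).trans (hj2 j)), h2, mact_smul, mact_smul, smul_smul,
        smul_smul, smul_smul, smul_smul, hc, ← sgn_add, ← sgn_add, ← sgn_add, ← sgn_add]
      congr 1
      apply sgn_congr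
      have h3 := pairExp_comp i hl d' e e' (hi1.trans h'.symm) hj1
      have h4 : ∑ j, e' j = d' + ∑ c, e c := by
        rw [Fintype.sum_eq_add_sum_subtype_ne _ i, sum_slot i hl]
        simp only [hj1, hi1, ← h']
        ring
      rw [h4]
      refine ⟨0, ?_⟩
      linear_combination -h3
  d_act {n d t} e h p a e' a' h' hj hi := by
    let π : NC A (t + 1) →ₗ[k] (∀ m, Face m → lev A m) := (NC A (t + 1)).subtype
    have hp : (EZ.complex k n).d d (d + 1) p = EZ.diff n rfl p := EZ.complex_d n d p
    refine (NC.complex_d t _).trans <| Subtype.ext <| ?_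
    refine Eq.trans ?_ ((map_add π _ _).trans (congrArg₂ (· + ·) rfl
      ((map_sum π _ _).trans (Finset.sum_congr rfl fun j _ => map_smul π _ _)))).symm
    funext m
    rw [Pi.add_apply, Finset.sum_apply]
    have ht : d + 1 + ∑ j, e j = t + 1 := by omega
    have h1 : π (NC.act e ht ((EZ.complex k n).d d (d + 1) p) a) m =
        sgn k ((d + 1) * (∑ j, e j) + pairExp e) •
          mact (diffM fdeg (bdry k) d ((p : EZ k n d).1 m)) (tens fun j => (a j).1 m) := by
      rw [hp]; exact NC.act_val e ht _ a m
    have h2 : ∀ j, (sgn k (d + ∑ i, if i < j then e i else 0) •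
        π (NC.act (e' j) (h' j) p (a' j))) m =
        (sgn k (d * (∑ j, e j) + pairExp e + (∑ j, e j) + 1) *
          sgn k (∑ i : Fin n, if i.1 < j.1 then e i else 0)) •
          mact ((p : EZ k n d).1 m) (tens (Function.update (fun j => (a j).1 m) j
            (mact (bdry k) ((a j).1 m)))) := fun j => by
      have hj' := NC.sigma_val (hj j) m
      have hj2 : (a' j j).1 m = sgn k (e j + 1) • mact (bdry k) ((a j).1 m) :=
        hj'.2.trans (congrArg (fun v : NC A (e j + 1) => v.1 m) (NC.complex_d (e j) (a j)))
      have hi1 := fun (i : {i // i ≠ j}) => (NC.sigma_val (hi j i i.2) m).1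
      have hi2 := fun (i : {i // i ≠ j}) => (NC.sigma_val (hi j i i.2) m).2
      have h3 : (tens fun i => (a' j i).1 m) = sgn k (e j + 1) •
          tens (Function.update (fun j => (a j).1 m) j (mact (bdry k) ((a j).1 m))) := by
        funext x
        rw [tens, Fintype.prod_eq_mul_prod_subtype_ne _ j, Pi.smul_apply, tens,
          Fintype.prod_eq_mul_prod_subtype_ne _ j, hj2, Function.update_self]
        simp only [hi2, Pi.smul_apply, smul_mul_assoc]
        congr 2
        exact Finset.prod_congr rfl fun i _ => by rw [Function.update_of_ne i.2]
      have h4 : ∑ i, e' j i = ∑ i, e i + 1 := by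
        rw [Fintype.sum_eq_add_sum_subtype_ne _ j, Fintype.sum_eq_add_sum_subtype_ne e j, hj'.1]
        simp only [hi1]
        ring
      have h5 : pairExp (e' j) = pairExp e + ∑ i, e i - e j := by
        have g1 := two_mul_pairExp (e' j)
        have g2 := two_mul_pairExp e
        rw [h4, Fintype.sum_eq_add_sum_subtype_ne (fun i => e' j i ^ 2) j] at g1
        rw [Fintype.sum_eq_add_sum_subtype_ne (fun i => e i ^ 2) j] at g2
        simp only [hi1, hj'.1] at g1
        linarith
      rw [Pi.smul_apply]
      refine (congrArg (_ • ·) (NC.act_val (e' j) (h' j) p (a' j) m)).trans ?_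
      rw [h3, mact_smul, smul_smul, smul_smul, h4, h5, ← sgn_add, ← sgn_add, ← sgn_add]
      congr 1
      apply sgn_congr
      have h7 : (∑ i, if i < j then e i else 0) = ∑ i : Fin n, if i.1 < j.1 then e i else 0 := rfl
      rw [h7]
      exact ⟨d, by ring⟩
    refine Eq.trans ?_ (congrArg₂ (· + ·) h1 (Finset.sum_congr rfl fun j _ => h2 j)).symm
    change sgn k (t + 1) • mact (bdry k) ((NC.act e h p a).1 m) = _
    have h6 : mmul (bdry k) ((p : EZ k n d).1 m) = sgn k d •
        (mmul ((p : EZ k n d).1 m) (bdT fdeg (bdry k) n) -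
          diffM fdeg (bdry k) d ((p : EZ k n d).1 m)) := by
      rw [diffM, sub_sub_cancel, smul_smul, sgn_mul_self, one_smul]
    refine (congrArg (fun v => sgn k (t + 1) • mact (bdry k) v) (NC.act_val e h p a m)).trans ?_
    rw [mact_smul, ← mact_mmul, h6, smul_mact, sub_mact, mact_mmul,
      bdT_tens fdeg (bdry k) (fun j => (a j).2.1 m), mact_sum]
    simp only [mact_smul, mul_smul]
    rw [← Finset.smul_sum]
    generalize ∑ j : Fin n, sgn k (∑ i : Fin n, if i.1 < j.1 then e i else 0) •
      mact ((p : EZ k n d).1 m) (tens (Function.update (fun j => (a j).1 m) j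
        (mact (bdry k) ((a j).1 m)))) = Q
    generalize mact (diffM fdeg (bdry k) d ((p : EZ k n d).1 m)) (tens fun j => (a j).1 m) = D
    have e1 : sgn k (t + 1) * sgn k (d * (∑ j, e j) + pairExp e) * sgn k d =
        sgn k (d * (∑ j, e j) + pairExp e + (∑ j, e j) + 1) := by
      rw [← sgn_add, ← sgn_add]
      exact sgn_congr ⟨d, by rw [← h]; ring⟩
    have e2 : sgn k ((d + 1) * (∑ j, e j) + pairExp e) =
        - sgn k (d * (∑ j, e j) + pairExp e + (∑ j, e j) + 1) := by
      rw [sgn_succ, neg_neg]; congr 1; ring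
    rw [smul_smul, smul_smul, e1, e2]
    module

/-- The map of normalized complexes induced by a map of cosimplicial algebras. -/
def NC.map {A B : SimplexCategory ⥤ CommAlgCat.{u} k} (f : A ⟶ B) (e : ℤ) : NC A e →ₗ[k] NC B e where
  toFun a := ⟨fun m s => (f.app (SimplexCategory.mk m)).hom (a.1 m s), fun m s h => a.2.1 m s
      fun h0 => h (by simp only [h0, map_zero]), fun m l θ s => by
    have h1 : levMap B θ ((f.app (SimplexCategory.mk m)).hom (a.1 m s)) =
        (f.app (SimplexCategory.mk l)).hom (levMap A θ (a.1 m s)) :=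
      (congrArg (fun g => g.hom (a.1 m s)) (f.naturality (SimplexCategory.mkHom θ))).symm
    rw [h1, a.2.2]
    simp [mact, map_sum]⟩
  map_add' a b := Subtype.ext <| funext fun m => by funext s; simp
  map_smul' c a := Subtype.ext <| funext fun m => by funext s; simp

/-- The normalized complex as a functor from cosimplicial commutative algebras to algebras over the
Eilenberg–Zilber operad. -/
def NC.functor (k : Type u) [CommRing k] :
    (SimplexCategory ⥤ CommAlgCat.{u} k) ⥤ (ezOperad k).Alg where
  obj A := NC.alg A
  map {A B} f :=
    { hom :=
        { f := fun e => ModuleCat.ofHom (NC.map f e)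
          comm' := fun i j hij => by
            obtain rfl : i + 1 = j := hij
            refine ModuleCat.hom_ext <| LinearMap.ext fun a => ?_
            refine (NC.complex_d i _).trans <| Eq.trans ?_
              (congrArg (NC.map f (i + 1)) (NC.complex_d i a)).symm
            exact Subtype.ext <| funext fun m => funext fun s => by
              change sgn k (i + 1) • mact (bdry k) (fun s => (f.app _).hom (a.1 m s)) s =
                (f.app _).hom ((sgn k (i + 1) • mact (bdry k) (a.1 m)) s)
              simp [mact, map_sum] }
      map_act := fun {n d t} e h p a => Subtype.ext <| funext fun m => by
        refine Eq.trans ?_ (NC.act_val e h p (fun j => NC.map f (e j) (a j)) m).symm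
        funext s
        have h1 := congrFun (NC.act_val e h p a m) s
        refine (congrArg (f.app (SimplexCategory.mk m)).hom h1).trans ?_
        rw [Pi.smul_apply, Pi.smul_apply, map_smul]
        congr 1
        simp only [mact, map_sum, map_smul, tens, map_prod]
        rfl }
  map_id A := rfl
  map_comp f g := rfl

end norm

section top
variable {k : Type u} [CommRing k] (A : SimplexCategory ⥤ CommAlgCat.{u} k)

/-- The top face. -/
def topFace (e : ℕ) : Face e := ⟨Finset.univ, Finset.univ_nonempty⟩

/-- The monotone map whose image is a given face. -/
def faceHom {m e : ℕ} (s : Face m) (h : s.1.card = e + 1) : Fin (e + 1) →o Fin (m + 1) :=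
  (s.1.orderEmbOfFin h).toOrderHom

lemma push_top {k : Type u} [CommRing k] {e l : ℕ} (θ : Fin (e + 1) →o Fin (l + 1)) (s : Face l) :
    push k θ (topFace e) s =
      if Function.Injective θ ∧ Finset.univ.image θ = s.1 then 1 else 0 := by
  simp [push, topFace, Set.injOn_univ]

/-- The values on the top face of the elements of the normalized complex are the elements that are
killed by all degeneracies. -/
lemma NC.exists_top_iff (e : ℕ) (x : lev A e) :
    (∃ a : NC A e, a.1 e (topFace e) = x) ↔
      ∀ (l : ℕ) (θ : Fin (e + 1) →o Fin (l + 1)), ¬ Function.Injective θ → levMap A θ x = 0 := by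
  classical
  constructor
  · rintro ⟨a, rfl⟩ l θ h
    rw [a.2.2, mact]
    exact Finset.sum_eq_zero fun y _ => by rw [push_top, if_neg (fun h' => h h'.1), zero_smul]
  · intro hx
    refine ⟨⟨fun m s => if h : s.1.card = e + 1 then levMap A (faceHom s h) x else 0, ?_, ?_⟩, ?_⟩
    · intro m s h
      by_cases h' : s.1.card = e + 1
      · simp [fdeg, h']
      · exact (h (dif_neg h')).elim
    · intro m l θ s
      have hc : ∀ {a b c : ℕ} (f : Fin (a + 1) →o Fin (b + 1)) (g : Fin (b + 1) →o Fin (c + 1)) (x : lev A a),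
          levMap A g (levMap A f x) = levMap A (g.comp f) x := by
        intro a b c f g x
        exact (congrArg (fun f => f.hom x) (A.map_comp (SimplexCategory.mkHom f) (SimplexCategory.mkHom g))).symm
      beta_reduce
      by_cases h : s.1.card = e + 1
      · rw [dif_pos h, hc]
        have hr : Set.range (faceHom s h) = s.1 := Finset.range_orderEmbOfFin _ h
        by_cases hi : Set.InjOn θ s.1
        · have hcard : (s.1.image θ).card = e + 1 := by rw [Finset.card_image_of_injOn hi, h]
          rw [mact, Finset.sum_eq_single (⟨s.1.image θ, s.2.image θ⟩ : Face l)]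
          · rw [push, if_pos ⟨hi, rfl⟩, one_smul, dif_pos hcard]
            congr 1
            have := Finset.orderEmbOfFin_unique (s := s.1.image θ) hcard (f := θ ∘ faceHom s h) (fun i => by
              refine Finset.mem_image_of_mem _ ?_
              have : faceHom s h i ∈ Set.range (faceHom s h) := ⟨i, rfl⟩
              rw [hr] at this; exact this) (by
              refine (θ.monotone.comp (faceHom s h).monotone).strictMono_of_injective ?_
              intro i j hij
              refine (s.1.orderEmbOfFin h).injective (hi ?_ ?_ hij)
              · exact hr ▸ ⟨i, rfl⟩
              · exact hr ▸ ⟨j, rfl⟩)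
            congr 1
            ext i : 2
            exact congrFun this i
          · intro y _ hy
            rw [push, if_neg (fun h' => hy (Subtype.ext h'.2.symm)), zero_smul]
          · simp
        · rw [hx]
          · exact (Finset.sum_eq_zero fun y _ => by rw [push, if_neg (fun h' => hi h'.1), zero_smul]).symm
          · intro hinj
            apply hi
            rw [← hr]
            rintro _ ⟨i, rfl⟩ _ ⟨j, rfl⟩ hij
            rw [hinj hij]
      · rw [dif_neg h, map_zero]
        refine (Finset.sum_eq_zero fun y _ => ?_).symm
        beta_reduce
        by_cases hp : push k θ s y = 0
        · rw [hp, zero_smul]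
        · have := push_deg hp
          rw [dif_neg (by simp only [fdeg] at this; omega), smul_zero]
    · have h1 : (topFace e).1.card = e + 1 := by simp [topFace]
      refine (dif_pos h1).trans ?_
      have : faceHom (topFace e) h1 = OrderHom.id := by
        ext i : 2
        exact (congrFun (Finset.orderEmbOfFin_unique h1 (f := id) (fun i => Finset.mem_univ _) strictMono_id) i).symm
      rw [this]
      exact congrArg (fun f => f.hom x) (A.map_id (SimplexCategory.mk e))

/-- An element of the normalized complex is determined by its value on the top face. -/
lemma NC.ext_top (e : ℕ) (a b : NC A e) (h : a.1 e (topFace e) = b.1 e (topFace e)) : a = b := by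
  classical
  refine Subtype.ext <| funext fun m => funext fun s => ?_
  by_cases hs : s.1.card = e + 1
  · have key : ∀ c : NC A e, c.1 m s = levMap A (faceHom s hs) (c.1 e (topFace e)) := by
      intro c
      rw [c.2.2, mact, Finset.sum_eq_single s]
      · rw [push_top, if_pos, one_smul]
        refine ⟨(s.1.orderEmbOfFin hs).injective, ?_⟩
        have hr : Set.range (faceHom s hs) = s.1 := Finset.range_orderEmbOfFin _ hs
        apply Finset.coe_injective
        rw [← hr]; simp
      · intro y _ hy
        rw [push_top, if_neg, zero_smul]
        rintro ⟨-, h2⟩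
        apply hy
        have hr : Set.range (faceHom s hs) = s.1 := Finset.range_orderEmbOfFin _ hs
        apply Subtype.ext
        apply Finset.coe_injective
        rw [← hr, ← h2]; simp
      · simp
    rw [key, key, h]
  · have key : ∀ c : NC A e, c.1 m s = 0 := by
      intro c
      by_contra h0
      have := c.2.1 m s h0
      simp only [fdeg] at this; omega
    rw [key, key]

end top

section monad
variable {𝒜 : Type*} [Category 𝒜] (T : Monad 𝒜)

/-- The iterates of the underlying functor of a monad. -/
def iter : ℕ → 𝒜 → 𝒜
  | 0, X => X
  | n + 1, X => T.obj (iter n X)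

/-- The outermost application of the monad to a map between iterates. -/
def iterStep {X Y : 𝒜} {a b : ℕ} (f : iter T a X ⟶ iter T b Y) :
    iter T (a + 1) X ⟶ iter T (b + 1) Y := T.map f

/-- The unit of the monad at an iterate. -/
def iterEta (X : 𝒜) (n : ℕ) : iter T n X ⟶ iter T (n + 1) X := T.η.app (iter T n X)

/-- The multiplication of the monad at an iterate. -/
def iterMu (X : 𝒜) (n : ℕ) : iter T (n + 2) X ⟶ iter T (n + 1) X := T.μ.app (iter T n X)

lemma iterStep_id (X : 𝒜) (n : ℕ) : iterStep T (𝟙 (iter T n X)) = 𝟙 _ := T.map_id _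

lemma iterStep_comp {X Y Z : 𝒜} {a b c : ℕ} (f : iter T a X ⟶ iter T b Y)
    (g : iter T b Y ⟶ iter T c Z) : iterStep T (f ≫ g) = iterStep T f ≫ iterStep T g :=
  T.map_comp _ _

lemma iterEta_naturality {X Y : 𝒜} {a b : ℕ} (f : iter T a X ⟶ iter T b Y) :
    iterEta T X a ≫ iterStep T f = f ≫ iterEta T Y b := (T.η.naturality f).symm

lemma iterMu_naturality {X Y : 𝒜} {a b : ℕ} (f : iter T a X ⟶ iter T b Y) :
    iterMu T X a ≫ iterStep T f = iterStep T (iterStep T f) ≫ iterMu T Y b :=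
  (T.μ.naturality f).symm

lemma iterEta_iterMu (X : 𝒜) (n : ℕ) : iterEta T X (n + 1) ≫ iterMu T X n = 𝟙 _ :=
  T.left_unit _

lemma iterStep_iterEta_iterMu (X : 𝒜) (n : ℕ) : iterStep T (iterEta T X n) ≫ iterMu T X n = 𝟙 _ :=
  T.right_unit _

lemma iterMu_assoc (X : 𝒜) (n : ℕ) :
    iterStep T (iterMu T X n) ≫ iterMu T X n = iterMu T X (n + 1) ≫ iterMu T X n := T.assoc _

/-- Functoriality of the iterates. -/
def iterMap {X Y : 𝒜} (f : X ⟶ Y) : ∀ n : ℕ, iter T n X ⟶ iter T n Y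
  | 0 => f
  | n + 1 => iterStep T (iterMap f n)

/-- The restriction of a monotone map to the positive elements. -/
def tailHom {a b : ℕ} (θ : Fin (a + 1) →o Fin b) : Fin a →o Fin b where
  toFun i := θ i.succ
  monotone' _ _ h := θ.monotone (Fin.succ_le_succ_iff.2 h)

/-- A monotone map with positive values, shifted down by one. -/
def predHom {a b : ℕ} (θ : Fin a →o Fin (b + 1)) (h : ∀ i, θ i ≠ 0) : Fin a →o Fin b where
  toFun i := (θ i).pred (h i)
  monotone' _ _ h' := Fin.pred_le_pred_iff.2 (θ.monotone h')

lemma ne_zero_of_zero {a b : ℕ} {θ : Fin (a + 1) →o Fin (b + 1)} (h : θ 0 ≠ 0) (i : Fin (a + 1)) :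
    θ i ≠ 0 := fun h' => h (le_antisymm (h' ▸ θ.monotone (Fin.zero_le i)) (Fin.zero_le _))

/-- The map `T^a ⟶ T^b` induced by a monotone map `{1, …, a} → {1, …, b}`, composed of the unit (for
elements outside the image) and of the multiplication (for elements with the same image). -/
def iterHom (X : 𝒜) : ∀ (b a : ℕ) (_ : Fin a →o Fin b), iter T a X ⟶ iter T b X
  | 0, 0, _ => 𝟙 _
  | 0, _ + 1, θ => (θ 0).elim0
  | b + 1, 0, θ => iterHom X b 0 (predHom θ fun i => i.elim0) ≫ iterEta T X b
  | b + 1, a + 1, θ =>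
    if h : θ 0 = 0 then iterStep T (iterHom X (b + 1) a (tailHom θ)) ≫ iterMu T X b
    else iterHom X b (a + 1) (predHom θ (ne_zero_of_zero h)) ≫ iterEta T X b
termination_by b a => a + b

variable (X : 𝒜)

lemma iterHom_pos {a b : ℕ} (θ : Fin a →o Fin (b + 1)) (h : ∀ i, θ i ≠ 0) :
    iterHom T X (b + 1) a θ = iterHom T X b a (predHom θ h) ≫ iterEta T X b := by
  cases a with
  | zero => rw [iterHom]
  | succ a => rw [iterHom, dif_neg (h 0)]

lemma iterHom_zero {a b : ℕ} (θ : Fin (a + 1) →o Fin (b + 1)) (h : θ 0 = 0) :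
    iterHom T X (b + 1) (a + 1) θ = iterStep T (iterHom T X (b + 1) a (tailHom θ)) ≫ iterMu T X b := by
  rw [iterHom, dif_pos h]

lemma eta_iterHom : ∀ {c b : ℕ} (ψ : Fin (b + 1) →o Fin c),
    iterEta T X b ≫ iterHom T X c (b + 1) ψ = iterHom T X c b (tailHom ψ)
  | 0, _, ψ => (ψ 0).elim0
  | c + 1, b, ψ => by
    by_cases h : ψ 0 = 0
    · rw [iterHom_zero T X ψ h, ← Category.assoc, iterEta_naturality, Category.assoc,
        iterEta_iterMu, Category.comp_id]
    · rw [iterHom_pos T X ψ (ne_zero_of_zero h), iterHom_pos T X (tailHom ψ)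
        (fun i => ne_zero_of_zero h _), ← Category.assoc, eta_iterHom]
      rfl

lemma iterHom_comp : ∀ (N : ℕ) {a b c : ℕ} (_ : a + b + c ≤ N) (θ : Fin a →o Fin b)
    (ψ : Fin b →o Fin c),
    iterHom T X b a θ ≫ iterHom T X c b ψ = iterHom T X c a (ψ.comp θ) := by
  intro N
  induction N with
  | zero =>
    intro a b c h θ ψ
    obtain rfl : a = 0 := by omega
    obtain rfl : b = 0 := by omega
    obtain rfl : c = 0 := by omega
    simp [iterHom]
  | succ N ih =>
    intro a b c h θ ψ
    by_cases hψ : ∃ c' : ℕ, c = c' + 1 ∧ ∀ i, (ψ i).1 ≠ 0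
    · obtain ⟨c, rfl, h1⟩ := hψ
      have h1' : ∀ i, ψ i ≠ 0 := fun i h' => h1 i (by rw [h']; rfl)
      rw [iterHom_pos T X ψ h1', ← Category.assoc, ih (by omega),
        iterHom_pos T X (ψ.comp θ) fun i => h1' _]
      rfl
    · match b, c, θ, ψ with
      | 0, 0, θ, ψ =>
        cases a with
        | zero => simp [iterHom]
        | succ a => exact (θ 0).elim0
      | 0, c + 1, θ, ψ => exact absurd ⟨c, rfl, fun i => i.elim0⟩ hψ
      | b + 1, 0, θ, ψ => exact (ψ 0).elim0
      | b + 1, c + 1, θ, ψ =>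
        have h0 : ψ 0 = 0 := by
          by_contra h0
          exact hψ ⟨c, rfl, fun i h' => ne_zero_of_zero h0 i (Fin.ext h')⟩
        by_cases hθ : ∀ i, θ i ≠ 0
        · rw [iterHom_pos T X θ hθ, Category.assoc, eta_iterHom, ih (by omega)]
          congr 1
          ext i : 2
          exact congrArg ψ (Fin.succ_pred _ (hθ i))
        · match a, θ with
          | 0, θ => exact absurd (fun i => i.elim0) hθ
          | a + 1, θ =>
            have h2 : θ 0 = 0 := by
              by_contra h2
              exact hθ (ne_zero_of_zero h2)
            have h3 := iterHom_zero T X ψ h0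
            have h4 : iterMu T X b ≫ iterHom T X (c + 1) (b + 1) ψ =
                iterStep T (iterHom T X (c + 1) (b + 1) ψ) ≫ iterMu T X c := by
              rw [h3, iterStep_comp, ← Category.assoc, iterMu_naturality, Category.assoc,
                Category.assoc, iterMu_assoc]
            rw [iterHom_zero T X θ h2, iterHom_zero T X (ψ.comp θ) (by simp [h2, h0]),
              Category.assoc, h4, ← Category.assoc, ← iterStep_comp, ih (by omega)]
            rfl

lemma iterHom_id : ∀ n, iterHom T X n n OrderHom.id = 𝟙 _
  | 0 => by simp [iterHom]
  | n + 1 => by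
    rw [iterHom_zero T X _ rfl, iterHom_pos T X (tailHom OrderHom.id) (fun i => Fin.succ_ne_zero i)]
    have h1 : predHom (tailHom (OrderHom.id : Fin (n + 1) →o Fin (n + 1)))
        (fun i => Fin.succ_ne_zero i) = OrderHom.id := by
      ext i : 2; simp [tailHom, predHom]
    rw [h1, iterHom_id n, Category.id_comp, iterStep_iterEta_iterMu]

lemma iterHom_naturality {X Y : 𝒜} (f : X ⟶ Y) : ∀ (N : ℕ) {a b : ℕ} (_ : a + b ≤ N)
    (θ : Fin a →o Fin b),
    iterMap T f a ≫ iterHom T Y b a θ = iterHom T X b a θ ≫ iterMap T f b := by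
  intro N
  induction N with
  | zero =>
    intro a b h θ
    obtain rfl : a = 0 := by omega
    obtain rfl : b = 0 := by omega
    simp only [iterHom, Category.comp_id, Category.id_comp]
  | succ N ih =>
    intro a b h θ
    match a, b, θ with
    | 0, 0, θ => simp only [iterHom, Category.comp_id, Category.id_comp]
    | a + 1, 0, θ => exact (θ 0).elim0
    | a, b + 1, θ =>
      by_cases hθ : ∀ i, θ i ≠ 0
      · rw [iterHom_pos T _ θ hθ, iterHom_pos T _ θ hθ, ← Category.assoc, ih (by omega),
          Category.assoc, Category.assoc, iterMap, iterEta_naturality]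
      · match a, θ with
        | 0, θ => exact absurd (fun i => i.elim0) hθ
        | a + 1, θ =>
          have h2 : θ 0 = 0 := by
            by_contra h2
            exact hθ (ne_zero_of_zero h2)
          have h4 := ih (a := a) (b := b + 1) (by omega) (tailHom θ)
          rw [iterHom_zero T _ θ h2, iterHom_zero T _ θ h2, Category.assoc, iterMap, iterMap,
            iterMu_naturality, ← Category.assoc, ← iterStep_comp, h4, iterStep_comp,
            Category.assoc, iterMap]

lemma iterMap_id (n : ℕ) : iterMap T (𝟙 X) n = 𝟙 _ := by
  induction n with
  | zero => rfl
  | succ n ih => rw [iterMap, ih, iterStep_id]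

lemma iterMap_comp {X Y Z : 𝒜} (f : X ⟶ Y) (g : Y ⟶ Z) (n : ℕ) :
    iterMap T (f ≫ g) n = iterMap T f n ≫ iterMap T g n := by
  induction n with
  | zero => rfl
  | succ n ih => rw [iterMap, ih, iterStep_comp]; rfl

/-- The cosimplicial resolution `[n] ↦ T^{n + 1} X` of a monad: the cofaces are given by the unit
and the codegeneracies by the multiplication. -/
def cosimp : 𝒜 ⥤ SimplexCategory ⥤ 𝒜 where
  obj X :=
    { obj n := iter T (n.len + 1) X
      map θ := iterHom T X _ _ θ.toOrderHom
      map_id n := iterHom_id T X _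
      map_comp θ ψ := (iterHom_comp T X _ le_rfl _ _).symm }
  map f :=
    { app n := iterMap T f (n.len + 1)
      naturality _ _ θ := (iterHom_naturality T f _ le_rfl θ.toOrderHom).symm }
  map_id X := by ext n; exact iterMap_id T X _
  map_comp f g := by ext n; exact iterMap_comp T f g _

/-- The coaugmentation `X ⟶ T^{n + 1} X` of the cosimplicial resolution. -/
def coaug (X : 𝒜) (n : SimplexCategory) : X ⟶ ((cosimp T).obj X).obj n :=
  iterHom T X (n.len + 1) 0 ⟨fun i => i.elim0, fun i => i.elim0⟩

lemma coaug_map (X : 𝒜) {n n' : SimplexCategory} (θ : n ⟶ n') :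
    coaug T X n ≫ ((cosimp T).obj X).map θ = coaug T X n' := by
  refine (iterHom_comp T X _ le_rfl _ _).trans ?_
  rw [coaug]
  congr 1
  ext i : 2
  exact i.elim0

end monad

section godement
variable {C : Type u} [SmallCategory C] {J : GrothendieckTopology C} {S : Type u}
  (p : S → GrothendieckTopology.Point.{u} J) (A : Type v) [Category.{u} A] [HasLimitsOfSize.{u, u} A]
  [HasColimitsOfSize.{u, u} A]

/-- The functor `p^*`: the family of the stalks at all points of the family. -/
noncomputable def stalks : Sheaf J A ⥤ (∀ _ : S, A) := Functor.pi' fun s => (p s).sheafFiber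

/-- The functor `p_*`: the product of the skyscraper sheaves. -/
noncomputable def skyscrapers : (∀ _ : S, A) ⥤ Sheaf J A where
  obj E := ∏ᶜ fun s => (p s).skyscraperSheafFunctor.obj (E s)
  map f := Limits.Pi.map fun s => (p s).skyscraperSheafFunctor.map (f s)
  map_id E := by ext s; simp
  map_comp f g := by ext s; simp

/-- The adjunction `p^* ⊣ p_*`. -/
noncomputable def stalksAdj : stalks p A ⊣ skyscrapers p A :=
  Adjunction.mkOfHomEquiv
    { homEquiv F E :=
        { toFun f := Pi.lift fun s => (p s).skyscraperSheafAdjunction.homEquiv F (E s) (f s)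
          invFun g s := ((p s).skyscraperSheafAdjunction.homEquiv F (E s)).symm (g ≫ Pi.π _ s)
          left_inv f := by
            funext s
            refine (congrArg ((p s).skyscraperSheafAdjunction.homEquiv F (E s)).symm
              (Pi.lift_π _ s)).trans (Equiv.symm_apply_apply _ _)
          right_inv g := by
            refine Limits.Pi.hom_ext _ _ fun s => (Pi.lift_π _ s).trans ?_
            exact Equiv.apply_symm_apply _ _ }
      homEquiv_naturality_left_symm {F F' E} f g := by
        funext s
        refine Eq.trans ?_ ((p s).skyscraperSheafAdjunction.homEquiv_naturality_left_symm f _)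
        exact congrArg ((p s).skyscraperSheafAdjunction.homEquiv F (E s)).symm (Category.assoc _ _ _)
      homEquiv_naturality_right {F E E'} f g := by
        refine Limits.Pi.hom_ext _ _ fun s => (Pi.lift_π _ s).trans ?_
        refine ((p s).skyscraperSheafAdjunction.homEquiv_naturality_right (f s) (g s)).trans ?_
        refine Eq.trans ?_ (Category.assoc _ _ _).symm
        have h1 : (skyscrapers p A).map g ≫
            Pi.π (fun s => (p s).skyscraperSheafFunctor.obj (E' s)) s =
            Pi.π (fun s => (p s).skyscraperSheafFunctor.obj (E s)) s ≫
              (p s).skyscraperSheafFunctor.map (g s) :=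
          Limits.Pi.map_π (fun s => (p s).skyscraperSheafFunctor.map (g s)) s
        refine Eq.trans ?_ (congrArg (Pi.lift (fun s =>
          (p s).skyscraperSheafAdjunction.homEquiv F (E s) (f s)) ≫ ·) h1.symm)
        refine Eq.trans ?_ (Category.assoc _ _ _)
        exact congrArg (· ≫ (p s).skyscraperSheafFunctor.map (g s)) (Pi.lift_π
          (fun s => (p s).skyscraperSheafAdjunction.homEquiv F (E s) (f s)) s).symm }

/-- The Godement functor `G = p_* p^*` as a monad. -/
noncomputable def godementMonad : Monad (Sheaf J A) := (stalksAdj p A).toMonad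

variable {k : Type u} [Field k]

/-- The cosimplicial Godement resolution, as a presheaf of cosimplicial commutative algebras. -/
noncomputable def godementCosimp (O : Sheaf J (CommAlgCat.{u} k)) :
    Cᵒᵖ ⥤ SimplexCategory ⥤ CommAlgCat.{u} k :=
  ((cosimp (godementMonad p (CommAlgCat.{u} k))).obj O ⋙ sheafToPresheaf J _).flip

/-- The normalized Godement resolution `N G^• O` of a sheaf of commutative algebras `O`, as a
presheaf of algebras over an operad `E` with a given morphism to the Eilenberg–Zilber operad. If
`X` is a terminal object of the site and the family of points is conservative, its value on `X` is
the `E`-algebra `RΓ(C, O)`. -/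
noncomputable def godementRes {E : DGOperad k} (η : DGOperad.Hom E (ezOperad k))
    (O : Sheaf J (CommAlgCat.{u} k)) : Cᵒᵖ ⥤ E.Alg :=
  godementCosimp p O ⋙ NC.functor k ⋙ DGOperad.Alg.restrict η

end godement

section aug
variable {k : Type u} [CommRing k]

/-- The degree zero cochain `s ↦ c` on vertices of an element which is compatible with all
structure maps of a cosimplicial algebra. -/
def NC.const (A : SimplexCategory ⥤ CommAlgCat.{u} k) (c : ∀ m, lev A m)
    (hc : ∀ (m l : ℕ) (θ : Fin (m + 1) →o Fin (l + 1)), levMap A θ (c m) = c l) : NC A 0 :=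
  ⟨fun m s => if fdeg s = 0 then c m else 0, fun m s h => by
      by_contra h0
      exact h (if_neg h0), fun m l θ s => by
    beta_reduce
    by_cases h : fdeg s = 0
    · have h1 : Set.InjOn θ s.1 := by
        have : s.1.card = 1 := by simp only [fdeg] at h; omega
        obtain ⟨v, hv⟩ := Finset.card_eq_one.1 this
        rw [hv]; simp
      have h2 : push k θ s ⟨s.1.image θ, s.2.image θ⟩ = 1 := if_pos ⟨h1, rfl⟩
      rw [if_pos h, hc, mact, Finset.sum_eq_single (⟨s.1.image θ, s.2.image θ⟩ : Face l)]
      · have h3 := push_deg (k := k) (θ := θ) (s := s) (s' := ⟨s.1.image θ, s.2.image θ⟩)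
        by_cases h4 : (1 : k) = 0
        · have : Subsingleton (lev A l) := by
            have := subsingleton_of_zero_eq_one h4.symm
            exact Module.subsingleton k _
          exact Subsingleton.elim _ _
        · rw [h2, one_smul, if_pos ((h3 (by rwa [h2])).trans h)]
      · intro y _ hy
        have : push k θ s y = 0 := if_neg fun h' => hy (Subtype.ext h'.2.symm)
        rw [this, zero_smul]
      · simp
    · rw [if_neg h, map_zero]
      refine (Finset.sum_eq_zero fun y _ => ?_).symm
      beta_reduce
      by_cases hp : push k θ s y = 0
      · rw [hp, zero_smul]
      · rw [if_neg (by rw [push_deg hp]; exact h), smul_zero]⟩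

/-- The underlying complex of an algebra over an operad, as a functor. -/
def DGOperad.Alg.forget (P : DGOperad k) : P.Alg ⥤ CochainComplex (ModuleCat.{u} k) ℤ where
  obj A := A.cpx
  map f := f.hom

end aug

section modules
variable (k : Type u) [Field k]

/-- The underlying module of a commutative algebra. -/
def algToMod : CommAlgCat.{u} k ⥤ ModuleCat.{u} k where
  obj A := ModuleCat.of k A
  map f := ModuleCat.ofHom f.hom.toLinearMap

/-- The polynomial algebra in one variable corepresents the underlying set of an algebra. -/
noncomputable def algToModForget : coyoneda.obj (op (CommAlgCat.of k (Polynomial k))) ≅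
    algToMod k ⋙ CategoryTheory.forget (ModuleCat.{u} k) :=
  NatIso.ofComponents (fun A => Equiv.toIso
    { toFun := fun f => f.hom Polynomial.X
      invFun := fun a => CommAlgCat.ofHom (Polynomial.aeval (R := k) (A := A) a)
      left_inv := fun f => CommAlgCat.hom_ext <| Polynomial.algHom_ext <| by
        exact Polynomial.aeval_X _
      right_inv := fun a => Polynomial.aeval_X (R := k) (A := A) _ })
    (fun f => by ext; rfl)

variable {k}
variable {C : Type u} [SmallCategory C] (J : GrothendieckTopology C)

instance : J.HasSheafCompose (algToMod k) where
  isSheaf P hP := by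
    refine (Presheaf.isSheaf_iff_isSheaf_forget J _ (CategoryTheory.forget (ModuleCat.{u} k))).2 ?_
    have h1 := hP (CommAlgCat.of k (Polynomial k))
    have h2 : Presheaf.IsSheaf J (P ⋙ coyoneda.obj (op (CommAlgCat.of k (Polynomial k)))) :=
      (isSheaf_iff_isSheaf_of_type J _).2 h1
    exact (Presheaf.isSheaf_of_iso_iff (Functor.isoWhiskerLeft P (algToModForget k))).1 h2

end modules

section comparison
variable {k : Type u} [Field k] {C : Type u} [SmallCategory C] {J : GrothendieckTopology C}

/-- The sheaf of `k`-modules underlying a sheaf of commutative `k`-algebras. -/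
noncomputable abbrev modSheaf (O : Sheaf J (CommAlgCat.{u} k)) : Sheaf J (ModuleCat.{u} k) :=
  (sheafCompose J (algToMod k)).obj O

/-- A complex of sheaves of modules as a presheaf of complexes of modules. -/
def sectionsComplex (I : CochainComplex (Sheaf J (ModuleCat.{u} k)) ℤ) :
    Cᵒᵖ ⥤ CochainComplex (ModuleCat.{u} k) ℤ where
  obj U :=
    { X i := (I.X i).obj.obj U
      d i j := (I.d i j).hom.app U
      shape i j h := by rw [I.shape i j h]; rfl
      d_comp_d' i j l _ _ :=
        congrArg (fun f : I.X i ⟶ I.X l => f.hom.app U) (I.d_comp_d i j l) }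
  map f :=
    { f i := (I.X i).obj.map f
      comm' i j _ := ((I.d i j).hom.naturality f) }
  map_id U := by ext i : 1; exact (I.X i).obj.map_id U
  map_comp f g := by ext i : 1; exact (I.X i).obj.map_comp f g

/-- The augmentation `Z ⟶ I^0` of an injective resolution. -/
noncomputable def injAug {Z : Sheaf J (ModuleCat.{u} k)} (R : InjectiveResolution Z) :
    Z ⟶ R.cochainComplex.X 0 :=
  (HomologicalComplex.singleObjXSelf (ComplexShape.up ℕ) 0 Z).inv ≫ R.ι.f 0 ≫
    (R.cochainComplexXIso 0 0 rfl).inv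

variable {S : Type u} (p : S → GrothendieckTopology.Point.{u} J)

/-- The normalized Godement complex of a sheaf of algebras, as a presheaf of complexes. -/
noncomputable def godementComplex (O : Sheaf J (CommAlgCat.{u} k)) :
    Cᵒᵖ ⥤ CochainComplex (ModuleCat.{u} k) ℤ :=
  godementCosimp p O ⋙ NC.functor k ⋙ DGOperad.Alg.forget (ezOperad k)

/-- The augmentation `O(U) → (N G^0 O)(U)` of the normalized Godement complex. -/
noncomputable def godementAug (O : Sheaf J (CommAlgCat.{u} k)) (U : Cᵒᵖ) (o : O.obj.obj U) :
    NC ((godementCosimp p O).obj U) 0 :=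
  NC.const _ (fun m => ((coaug (godementMonad p (CommAlgCat.{u} k)) O
      (SimplexCategory.mk m)).hom.app U).hom o) fun m l θ => by
    have h1 := coaug_map (godementMonad p (CommAlgCat.{u} k)) O (SimplexCategory.mkHom θ)
    exact congrArg (fun f => (f.hom.app U).hom o) h1

/-- An injective resolution `I` of the sheaf of modules underlying `O`, with a map of complexes
`N G^• O ⟶ I` that is compatible with the augmentations of `O` to both. -/
structure GodementComparison (O : Sheaf J (CommAlgCat.{u} k)) where
  /-- The injective resolution. -/
  res : InjectiveResolution (modSheaf O)
  /-- The map of complexes of presheaves `N G^• O ⟶ I`. -/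
  map : godementComplex p O ⟶ sectionsComplex res.cochainComplex
  map_aug (U : Cᵒᵖ) (o : O.obj.obj U) :
    ((map.app U).f 0).hom (godementAug p O U o) = ((injAug res).hom.app U).hom o

variable {C' : Type u} [SmallCategory C'] {J' : GrothendieckTopology C'} {S' : Type u}

/-- A map of complexes `I' ⟶ f_* I` of injective resolutions `O' ⟶ I'` and `O ⟶ I` that lifts a
given map `φ : O' ⟶ f_* O`. (The presheaf `f_* I` is `U ↦ I(F U)`.) -/
structure ResolutionLift {O : Sheaf J (CommAlgCat.{u} k)} {O' : Sheaf J' (CommAlgCat.{u} k)}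
    (F : C' ⥤ C) [F.IsContinuous J' J]
    (φ : O' ⟶ (F.sheafPushforwardContinuous (CommAlgCat.{u} k) J' J).obj O)
    (R' : InjectiveResolution (modSheaf O')) (R : InjectiveResolution (modSheaf O)) where
  /-- The map of complexes of presheaves `I' ⟶ f_* I`. -/
  map : sectionsComplex R'.cochainComplex ⟶ F.op ⋙ sectionsComplex R.cochainComplex
  map_aug (U : C') (o : O'.obj.obj (op U)) :
    ((map.app (op U)).f 0).hom (((injAug R').hom.app (op U)).hom o) =
      ((injAug R).hom.app (op (F.obj U))).hom ((φ.hom.app (op U)).hom o)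

end comparison

end EInf

open EInf

/-! Write `G` and `G'` for the two Godement monads. The algebra `B` is the normalized complex of the
sections over `X'` of the diagonal `[n] ↦ G'^{n+1} f_* G^{n+1} O` of a bicosimplicial sheaf of
algebras (`diagRes`, `doubleGodement`). A diagonal, unlike a total complex, is again a cosimplicial
commutative algebra, so the operad acts on its normalization, and maps of cosimplicial algebras into
it give maps of `E`-algebras with nothing more to check. The map `a` applies the iterates of `G'` to
`O' → f_* O → f_* G^{n+1} O` (`fromTarget`). The map `b` is the restriction from `X` to `u(X')`,
followed by the coaugmentation `f_* G^{n+1} O → G'^{n+1} f_* G^{n+1} O` (`fromSource`).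

The map `b` is a quasi-isomorphism for two reasons. First, `u(X')` need not be terminal, but a
product of skyscrapers sees an object only through its fibers, and the fibers of `u(X')` are those
of the terminal object `X'` at the inverse images of the points; so the restriction is an
isomorphism (`isIso_fiber_map`, `isIso_secN_map`). Secondly, after `p'^*` the coaugmentation of the
diagonal is a cosimplicial homotopy equivalence, with an extra degeneracy that comes from the counit
of `p'^* ⊣ p'_*` (`diagStalkHomotopy`). As the points are conservative, it is a quasi-isomorphism of
complexes of sheaves (`quasiIso_modCoMap_diagAug`). The terms on both sides are injective sheaves of
modules, so it is even a homotopy equivalence, and it remains a quasi-isomorphism on sections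
(`quasiIso_secNMap_diagAug`).

Injectivity has two sources. Over a field all modules are injective, hence so are products of
skyscrapers (`injective_modSheaf_skyscrapers`). Direct images preserve injectives because `f^{-1}`
is exact on sheaves of modules (`injective_pushforward`). Exactness is given for sheaves of sets
only; it is carried over by showing that each point of the source has an inverse image that is again
a point (`isCofiltered_elements`, `comapPoint`) and that the stalk of `f^{-1} M` at a point is the
stalk of `M` at its inverse image.

That `ψ` is the natural map follows from K-injectivity of `f_* I`: the direct image of `e` extends
along `fromSource` to the complex of the diagonal, up to homotopy. The extension, composed with
`fromTarget`, and the composite of `e'` and `t` are two maps from a resolution of `O'` to a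
K-injective complex. They agree on `O'`, hence they are homotopic (`exists_extension`).

Homological algebra is done with alternating coface complexes, which are complexes of sheaves of
modules. The Dold–Kan projection splits off the normalized complex on sections, up to signs, with a
complement that is contractible (`theta`, `rho`, `thetaEquiv`). A constant cosimplicial sheaf in
place of `f_* G^• O` gives the fact that the Godement resolution is an injective resolution
(`godementInj`). Every comparison `e` is then a homotopy equivalence up to this splitting
(`quasiIso_godementComparison`). -/

namespace EInf

/-! ### The diagonal of the bicosimplicial object `T^{m+1} K^n` of a monad `T`. -/

section diagonal
variable {𝒜 : Type*} [Category 𝒜] (T : Monad 𝒜)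

/-- The empty map. -/
def elimHom (b : ℕ) : Fin 0 →o Fin b := ⟨fun i => i.elim0, fun i => i.elim0⟩

lemma elimHom_eq {b : ℕ} (θ : Fin 0 →o Fin b) : θ = elimHom b := by
  ext i : 2
  exact i.elim0

/-- The diagonal of the bicosimplicial object `T^{m + 1} K^n`. -/
def diagRes (K : SimplexCategory ⥤ 𝒜) : SimplexCategory ⥤ 𝒜 where
  obj n := iter T (n.len + 1) (K.obj n)
  map {n n'} θ := iterMap T (K.map θ) (n.len + 1) ≫
    iterHom T (K.obj n') (n'.len + 1) (n.len + 1) θ.toOrderHom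
  map_id n := by
    rw [K.map_id, iterMap_id, Category.id_comp]
    exact iterHom_id T _ _
  map_comp {n n' n''} θ ψ := by
    have h := iterHom_comp T (K.obj n'') _ le_rfl θ.toOrderHom ψ.toOrderHom
    -- The interchange of the two cosimplicial directions: the structure maps of the iterates of `T`
    -- are natural in the object.
    have h' := iterHom_naturality T (K.map ψ) _ le_rfl θ.toOrderHom
    calc _ = (iterMap T (K.map θ) (n.len + 1) ≫ iterMap T (K.map ψ) (n.len + 1)) ≫
          (iterHom T (K.obj n'') _ _ θ.toOrderHom ≫ iterHom T (K.obj n'') _ _ ψ.toOrderHom) := by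
            rw [h, K.map_comp, iterMap_comp]; rfl
      _ = iterMap T (K.map θ) (n.len + 1) ≫ (iterMap T (K.map ψ) (n.len + 1) ≫
          iterHom T (K.obj n'') _ _ θ.toOrderHom) ≫ iterHom T (K.obj n'') _ _ ψ.toOrderHom := by
            simp only [Category.assoc]
      _ = _ := by rw [h']; simp only [Category.assoc]

/-- The coaugmentation `K^n ⟶ T^{n + 1} K^n`. -/
def diagAug (K : SimplexCategory ⥤ 𝒜) : K ⟶ diagRes T K where
  app n := coaug T (K.obj n) n
  naturality n n' θ := by
    have h : K.map θ ≫ coaug T (K.obj n') n = coaug T (K.obj n) n ≫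
      iterMap T (K.map θ) (n.len + 1) := iterHom_naturality T (K.map θ) _ le_rfl (elimHom (n.len + 1))
    have h' := coaug_map T (K.obj n') θ
    calc _ = K.map θ ≫ coaug T (K.obj n') n ≫ ((cosimp T).obj (K.obj n')).map θ := by rw [h']; rfl
      _ = (K.map θ ≫ coaug T (K.obj n') n) ≫ ((cosimp T).obj (K.obj n')).map θ :=
        (Category.assoc _ _ _).symm
      _ = _ := by rw [h]; exact Category.assoc _ _ _

/-- Functoriality of the diagonal along a map `O ⟶ K^n` from a constant object. -/
def diagOfConst {O : 𝒜} {K : SimplexCategory ⥤ 𝒜} (f : ∀ n, O ⟶ K.obj n)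
    (hf : ∀ {n n'} (θ : n ⟶ n'), f n ≫ K.map θ = f n') :
    (cosimp T).obj O ⟶ diagRes T K where
  app n := iterMap T (f n) (n.len + 1)
  naturality n n' θ := by
    have h := iterHom_naturality T (f n') _ le_rfl θ.toOrderHom
    refine h.symm.trans ?_
    rw [← hf θ, iterMap_comp]
    exact Category.assoc _ _ _

/-- Naturality of the coaugmentation in the object. In the application to `f_* G^• O`, this identity
says that the two legs `fromTarget` and `fromSource` of the zigzag agree on `O'`, and it is all that
relates them. -/
lemma coaug_diagOfConst {O : 𝒜} {K : SimplexCategory ⥤ 𝒜} (f : ∀ n, O ⟶ K.obj n)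
    (hf : ∀ {n n'} (θ : n ⟶ n'), f n ≫ K.map θ = f n') (n : SimplexCategory) :
    coaug T O n ≫ (diagOfConst T f hf).app n = f n ≫ (diagAug T K).app n :=
  (iterHom_naturality T (f n) _ le_rfl (elimHom (n.len + 1))).symm

end diagonal

/-! ### The extra degeneracy of the diagonal after the left adjoint `L` of `T = R L`. -/

/-- The extension of a monotone map by `0 ↦ 0`. -/
def consHom {b c : ℕ} (ξ : Fin b →o Fin (c + 1)) : Fin (b + 1) →o Fin (c + 1) where
  toFun := Fin.cases 0 ξ
  monotone' i j h := by
    induction i using Fin.cases with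
    | zero => simp
    | succ i =>
      induction j using Fin.cases with
      | zero => simp at h
      | succ j => simpa using ξ.monotone (Fin.succ_le_succ_iff.1 h)

@[simp] lemma consHom_zero {b c : ℕ} (ξ : Fin b →o Fin (c + 1)) : consHom ξ 0 = 0 := rfl

@[simp] lemma consHom_succ {b c : ℕ} (ξ : Fin b →o Fin (c + 1)) (i : Fin b) :
    consHom ξ i.succ = ξ i := rfl

/-- The successor of a monotone map. -/
def succHom {a b : ℕ} (θ : Fin a →o Fin b) : Fin a →o Fin (b + 1) where
  toFun i := (θ i).succ
  monotone' _ _ h := Fin.succ_le_succ_iff.2 (θ.monotone h)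

section stalk
variable {𝒜 ℬ : Type*} [Category 𝒜] [Category ℬ] {L : 𝒜 ⥤ ℬ} {R : ℬ ⥤ 𝒜} (adj : L ⊣ R)

local notation "TM" => Adjunction.toMonad adj

/-- The counit of the adjunction at the iterates of the monad. -/
def iterCounit (X : 𝒜) (b : ℕ) : L.obj (iter TM (b + 1) X) ⟶ L.obj (iter TM b X) :=
  adj.counit.app (L.obj (iter TM b X))

lemma iterCounit_naturality {X Y : 𝒜} {a b : ℕ} (f : iter TM a X ⟶ iter TM b Y) :
    L.map (iterStep TM f) ≫ iterCounit adj Y b = iterCounit adj X a ≫ L.map f :=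
  adj.counit_naturality (L.map f)

lemma map_iterEta_iterCounit (X : 𝒜) (b : ℕ) :
    L.map (iterEta TM X b) ≫ iterCounit adj X b = 𝟙 _ :=
  adj.left_triangle_components (iter TM b X)

lemma map_iterMu_iterCounit (X : 𝒜) (b : ℕ) : L.map (iterMu TM X b) ≫ iterCounit adj X b =
    iterCounit adj X (b + 1) ≫ iterCounit adj X b :=
  adj.counit_naturality (adj.counit.app (L.obj (iter TM b X)))

/-- The map `L T^a ⟶ L T^b`, `T = R L`, induced by a monotone map `{1, …, a} → {0, 1, …, b}`: the
factors over `0` are absorbed by the counit. -/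
def counitHom (X : 𝒜) {a b : ℕ} (ζ : Fin a →o Fin (b + 1)) :
    L.obj (iter TM a X) ⟶ L.obj (iter TM b X) :=
  L.map (iterHom TM X (b + 1) a ζ) ≫ iterCounit adj X b

/-- Adjoin a basepoint `0` below `{1, …, b}`. The counit makes `L T^•` functorial for monotone maps
that may send elements to the basepoint; `consHom` is the pointed extension that makes them
composable. The reason is the naturality of the counit together with its compatibility with the
multiplication `R ε L`. -/
lemma counitHom_comp (X : 𝒜) {a b c : ℕ} (ζ : Fin a →o Fin (b + 1)) (ξ : Fin b →o Fin (c + 1)) :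
    counitHom adj X ζ ≫ counitHom adj X ξ = counitHom adj X ((consHom ξ).comp ζ) := by
  have h1 : iterHom TM X (c + 1) a ((consHom ξ).comp ζ) =
      iterHom TM X (b + 1) a ζ ≫ iterHom TM X (c + 1) (b + 1) (consHom ξ) :=
    (iterHom_comp TM X _ le_rfl _ _).symm
  have h2 : iterHom TM X (c + 1) (b + 1) (consHom ξ) =
      iterStep TM (iterHom TM X (c + 1) b ξ) ≫ iterMu TM X c := iterHom_zero TM X (consHom ξ) rfl
  rw [counitHom, counitHom, counitHom, h1, h2, L.map_comp, L.map_comp, Category.assoc,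
    Category.assoc, Category.assoc, map_iterMu_iterCounit, ← Category.assoc (iterCounit adj X b),
    ← iterCounit_naturality, Category.assoc]

/-- By the triangle identity, maps that avoid the basepoint act by the structure maps that `L`
inherits from the monad. -/
lemma counitHom_succ (X : 𝒜) {a b : ℕ} (θ : Fin a →o Fin b) :
    counitHom adj X (succHom θ) = L.map (iterHom TM X b a θ) := by
  rw [counitHom, iterHom_pos TM X (succHom θ) (fun i => Fin.succ_ne_zero (θ i)), L.map_comp,
    Category.assoc, map_iterEta_iterCounit, Category.comp_id]
  rfl

lemma counitHom_naturality {X Y : 𝒜} (f : X ⟶ Y) {a b : ℕ} (ζ : Fin a →o Fin (b + 1)) :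
    L.map (iterMap TM f a) ≫ counitHom adj Y ζ = counitHom adj X ζ ≫ L.map (iterMap TM f b) := by
  rw [counitHom, counitHom, ← Category.assoc, ← L.map_comp, iterHom_naturality TM f _ le_rfl,
    L.map_comp, Category.assoc, Category.assoc, ← iterCounit_naturality]
  rfl

lemma counitHom_elim (X : 𝒜) {b : ℕ} (ζ : Fin 0 →o Fin (b + 1)) :
    counitHom adj X ζ = L.map (iterHom TM X b 0 (elimHom b)) := by
  rw [← counitHom_succ, elimHom_eq ζ, elimHom_eq (succHom _)]

variable (K : SimplexCategory ⥤ 𝒜)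

/-- The map `L T^{n + 1} K^n ⟶ L T^{m + 1} K^m` induced by a map `[n] ⟶ [m]` and a monotone map
`[n] → {⊥} ∪ [m]`. -/
def diagStalkHom {n m : SimplexCategory} (κ : n ⟶ m) (ζ : Fin (n.len + 1) →o Fin (m.len + 2)) :
    L.obj (iter TM (n.len + 1) (K.obj n)) ⟶ L.obj (iter TM (m.len + 1) (K.obj m)) :=
  L.map (iterMap TM (K.map κ) (n.len + 1)) ≫ counitHom adj (K.obj m) ζ

/-- The pairs `(κ, ζ)` compose like maps of a category, so every identity between cofaces,
codegeneracies and homotopy operators on `L T^{n+1} K^n` becomes an identity between monotone maps.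
-/
lemma diagStalkHom_comp {n m l : SimplexCategory} (κ : n ⟶ m) (κ' : m ⟶ l)
    (ζ : Fin (n.len + 1) →o Fin (m.len + 2)) (ζ' : Fin (m.len + 1) →o Fin (l.len + 2)) :
    diagStalkHom adj K κ ζ ≫ diagStalkHom adj K κ' ζ' =
      diagStalkHom adj K (κ ≫ κ') ((consHom ζ').comp ζ) := by
  rw [diagStalkHom, diagStalkHom, diagStalkHom, ← counitHom_comp, K.map_comp, iterMap_comp,
    L.map_comp, Category.assoc, Category.assoc,
    ← Category.assoc (counitHom adj (K.obj m) ζ), ← counitHom_naturality, Category.assoc]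

lemma map_diagRes {n m : SimplexCategory} (θ : n ⟶ m) : L.map ((diagRes TM K).map θ) =
    diagStalkHom adj K θ (succHom θ.toOrderHom) := by
  rw [diagStalkHom, counitHom_succ]
  exact L.map_comp _ _

/-- The retraction of `L (diagAug K)`. -/
def diagStalkRetraction : diagRes TM K ⋙ L ⟶ K ⋙ L where
  app n := counitHom adj (K.obj n) (b := 0) (OrderHom.const _ 0)
  naturality n m θ := by
    -- Everything goes to the basepoint in the end, so `θ` leaves no trace in the direction of `T`.
    have h1 : counitHom adj (K.obj m) (succHom θ.toOrderHom) ≫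
        counitHom adj (K.obj m) (b := 0) (OrderHom.const _ 0) =
        counitHom adj (K.obj m) (b := 0) (OrderHom.const _ 0) := by
      rw [counitHom_comp]; congr 1
    have h2 := counitHom_naturality adj (K.map θ) (a := n.len + 1) (b := 0) (OrderHom.const _ 0)
    calc _ = diagStalkHom adj K θ (succHom θ.toOrderHom) ≫
          counitHom adj (K.obj m) (b := 0) (OrderHom.const _ 0) :=
            congrArg (· ≫ counitHom adj (K.obj m) (b := 0) (OrderHom.const _ 0))
              (map_diagRes adj K θ)
      _ = L.map (iterMap TM (K.map θ) (n.len + 1)) ≫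
          counitHom adj (K.obj m) (b := 0) (OrderHom.const _ 0) := by
            rw [diagStalkHom, Category.assoc, h1]
      _ = _ := h2

lemma map_diagAug_retraction :
    Functor.whiskerRight (diagAug TM K) L ≫ diagStalkRetraction adj K = 𝟙 _ := by
  ext n
  -- The composite is indexed by a monotone map out of the empty set, and there is only one of
  -- these.
  have h : L.map (iterHom TM (K.obj n) (n.len + 1) 0 (elimHom _)) ≫
      counitHom adj (K.obj n) (b := 0) (OrderHom.const _ 0) = 𝟙 _ := by
    rw [← counitHom_elim adj (K.obj n) (elimHom _), counitHom_comp, counitHom_elim,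
      ← elimHom_eq OrderHom.id, iterHom_id, L.map_id]
  exact h

lemma retraction_map_diagAug (n : SimplexCategory) :
    (diagStalkRetraction adj K).app n ≫ L.map ((diagAug TM K).app n) =
      diagStalkHom adj K (𝟙 n) (OrderHom.const _ 0) := by
  have h : counitHom adj (K.obj n) (b := 0) (OrderHom.const (Fin (n.len + 1)) 0) ≫
      L.map (iterHom TM (K.obj n) (n.len + 1) 0 (elimHom _)) =
      diagStalkHom adj K (𝟙 n) (OrderHom.const _ 0) := by
    rw [← counitHom_elim adj (K.obj n) (elimHom _), counitHom_comp, diagStalkHom, K.map_id,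
      iterMap_id, L.map_id, Category.id_comp]
    congr 1
  exact h

lemma id_diagStalkHom (n : SimplexCategory) : 𝟙 (L.obj ((diagRes TM K).obj n)) =
    diagStalkHom adj K (𝟙 n) (succHom OrderHom.id) := by
  rw [← L.map_id, ← (diagRes TM K).map_id]
  exact map_diagRes adj K (𝟙 n)

/-- The monotone map `j ↦ ⊥` for `j ≤ i` and `j ↦ j - 1` for `j > i`. -/
def collapse {n : ℕ} (i : Fin (n + 1)) : Fin (n + 2) →o Fin (n + 2) where
  toFun j := if j.1 ≤ i.1 then 0 else j
  monotone' a b h := by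
    have h' : a.1 ≤ b.1 := h
    by_cases h1 : a.1 ≤ i.1
    · simp [h1]
    · have h2 : ¬ b.1 ≤ i.1 := by omega
      simpa [h1, h2] using h

lemma consHom_val {b c : ℕ} (ξ : Fin b →o Fin (c + 1)) (i : Fin (b + 1)) :
    (consHom ξ i).1 = if h : i.1 = 0 then 0 else (ξ ⟨i.1 - 1, by have := i.2; omega⟩).1 := by
  induction i using Fin.cases with
  | zero => simp
  | succ i => simp

lemma collapse_val {n : ℕ} (i : Fin (n + 1)) (j : Fin (n + 2)) :
    (collapse i j).1 = if j.1 ≤ i.1 then 0 else j.1 := by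
  change (if j.1 ≤ i.1 then (0 : Fin (n + 2)) else j).1 = _
  split_ifs <;> rfl

lemma succHom_val {a b : ℕ} (θ : Fin a →o Fin b) (i : Fin a) : (succHom θ i).1 = (θ i).1 + 1 := rfl

lemma delta_val {n : ℕ} (i : Fin (n + 2)) (j : Fin (n + 1)) :
    ((SimplexCategory.δ i).toOrderHom j).1 = if j.1 < i.1 then j.1 else j.1 + 1 := by
  change (Fin.succAbove i j).1 = _
  simp only [Fin.succAbove, Fin.lt_def, Fin.val_castSucc]
  split_ifs <;> rfl

lemma sigma_val {n : ℕ} (i : Fin (n + 1)) (j : Fin (n + 2)) :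
    ((SimplexCategory.σ i).toOrderHom j).1 = if j.1 ≤ i.1 then j.1 else j.1 - 1 := by
  change (Fin.predAbove i j).1 = _
  simp only [Fin.predAbove, Fin.lt_def, Fin.val_castSucc]
  split_ifs <;> simp <;> omega

lemma comp_val {n m l : SimplexCategory} (κ : n ⟶ m) (κ' : m ⟶ l) (j : Fin (n.len + 1)) :
    ((κ ≫ κ').toOrderHom j).1 = (κ'.toOrderHom (κ.toOrderHom j)).1 := rfl

/-- Identities of a homotopy can now be checked on values in `ℕ`, where `omega` decides them after a
case distinction. -/
lemma diagStalkHom_congr {n m : SimplexCategory} {κ κ' : n ⟶ m}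
    {ζ ζ' : Fin (n.len + 1) →o Fin (m.len + 2)}
    (h : ∀ j, (κ.toOrderHom j).1 = (κ'.toOrderHom j).1) (h' : ∀ j, (ζ j).1 = (ζ' j).1) :
    diagStalkHom adj K κ ζ = diagStalkHom adj K κ' ζ' := by
  obtain rfl : ζ = ζ' := by ext j; exact h' j
  obtain rfl : κ = κ' := by ext j; exact h j
  rfl

lemma map_diagRes_comp {n m l : SimplexCategory} (θ : n ⟶ m) (κ : m ⟶ l)
    (ζ : Fin (m.len + 1) →o Fin (l.len + 2)) :
    L.map ((diagRes TM K).map θ) ≫ diagStalkHom adj K κ ζ =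
      diagStalkHom adj K (θ ≫ κ) (ζ.comp θ.toOrderHom) :=
  (congrArg (· ≫ _) (map_diagRes adj K θ)).trans (diagStalkHom_comp adj K _ _ _ _)

lemma comp_map_diagRes {n m l : SimplexCategory} (θ : m ⟶ l) (κ : n ⟶ m)
    (ζ : Fin (n.len + 1) →o Fin (m.len + 2)) :
    diagStalkHom adj K κ ζ ≫ L.map ((diagRes TM K).map θ) =
      diagStalkHom adj K (κ ≫ θ) ((consHom (succHom θ.toOrderHom)).comp ζ) :=
  (congrArg (_ ≫ ·) (map_diagRes adj K θ)).trans (diagStalkHom_comp adj K _ _ _ _)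

open Simplicial in
/-- The homotopy operators `L T^{n + 2} K^{n + 1} ⟶ L T^{n + 1} K^n`. -/
def diagStalkH {n : ℕ} (i : Fin (n + 1)) :
    L.obj ((diagRes TM K).obj ⦋n + 1⦌) ⟶ L.obj ((diagRes TM K).obj ⦋n⦌) :=
  diagStalkHom adj K (n := ⦋n + 1⦌) (m := ⦋n⦌) (SimplexCategory.σ i) (collapse i)

open Simplicial in
lemma delta_diagStalkH {n : ℕ} (i : Fin (n + 2)) (j : Fin (n + 1)) :
    L.map ((diagRes TM K).map (SimplexCategory.δ i)) ≫ diagStalkH adj K j =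
      diagStalkHom adj K (n := ⦋n⦌) (m := ⦋n⦌) (SimplexCategory.δ i ≫ SimplexCategory.σ j)
        ((collapse j).comp (SimplexCategory.δ i).toOrderHom) :=
  map_diagRes_comp adj K _ _ _

open Simplicial in
lemma diagStalkH_delta {n : ℕ} (i : Fin (n + 2)) (j : Fin (n + 1)) :
    diagStalkH adj K j ≫ L.map ((diagRes TM K).map (SimplexCategory.δ i)) =
      diagStalkHom adj K (n := ⦋n + 1⦌) (m := ⦋n + 1⦌) (SimplexCategory.σ j ≫ SimplexCategory.δ i)
        ((consHom (succHom (SimplexCategory.δ i).toOrderHom)).comp (collapse j)) :=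
  comp_map_diagRes adj K _ _ _

open Simplicial in
lemma sigma_diagStalkH {n : ℕ} (i : Fin (n + 2)) (j : Fin (n + 1)) :
    L.map ((diagRes TM K).map (SimplexCategory.σ i)) ≫ diagStalkH adj K j =
      diagStalkHom adj K (n := ⦋n + 2⦌) (m := ⦋n⦌) (SimplexCategory.σ i ≫ SimplexCategory.σ j)
        ((collapse j).comp (SimplexCategory.σ i).toOrderHom) :=
  map_diagRes_comp adj K _ _ _

open Simplicial in
lemma diagStalkH_sigma {n : ℕ} (i : Fin (n + 1)) (j : Fin (n + 2)) :
    diagStalkH adj K j ≫ L.map ((diagRes TM K).map (SimplexCategory.σ i)) =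
      diagStalkHom adj K (n := ⦋n + 2⦌) (m := ⦋n⦌) (SimplexCategory.σ j ≫ SimplexCategory.σ i)
        ((consHom (succHom (SimplexCategory.σ i).toOrderHom)).comp (collapse j)) :=
  comp_map_diagRes adj K _ _ _

open Simplicial in
/-- The simplicial homotopy (in the opposite category) from `L (diagAug K)` composed with its
retraction to the identity. -/
def diagStalkHomotopy : SimplicialObject.Homotopy (C := ℬᵒᵖ)
    (X := (diagRes TM K ⋙ L).op) (Y := (diagRes TM K ⋙ L).op)
    (NatTrans.op (diagStalkRetraction adj K ≫ Functor.whiskerRight (diagAug TM K) L))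
    (𝟙 _) where
  h {n} i := (diagStalkH adj K i).op
  -- At one end `collapse 0 ∘ δ 0` is the successor map, which avoids the basepoint, and `σ 0 ∘ δ 0`
  -- is the identity: this is the identity of the diagonal.
  h_zero_comp_δ_zero n := Quiver.Hom.unop_inj <| by
    refine Eq.trans ?_ (id_diagStalkHom adj K ⦋n⦌).symm
    refine (delta_diagStalkH adj K _ _).trans (diagStalkHom_congr adj K ?_ ?_)
    · intro j
      simp only [comp_val, sigma_val, delta_val]
      simp
    · intro j
      simp only [OrderHom.comp_coe, Function.comp_apply, collapse_val, delta_val, succHom_val]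
      simp
  -- At the other end the last coface misses the only element that `collapse n` does not send to the
  -- basepoint: this is the retraction followed by the coaugmentation.
  h_last_comp_δ_last n := Quiver.Hom.unop_inj <| by
    refine Eq.trans ?_ (retraction_map_diagAug adj K ⦋n⦌).symm
    refine (delta_diagStalkH adj K _ _).trans (diagStalkHom_congr adj K ?_ ?_)
    · intro j
      have := j.2
      simp only [comp_val, sigma_val, delta_val, SimplexCategory.len_mk] at *
      simp [show j.1 < n + 1 from j.2, show j.1 ≤ n by omega]
    · intro j
      have := j.2
      simp only [OrderHom.comp_coe, Function.comp_apply, collapse_val, delta_val,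
        SimplexCategory.len_mk] at *
      simp [show j.1 < n + 1 from j.2, show j.1 ≤ n by omega]
  h_succ_comp_δ_castSucc_of_lt {n} i j hij := Quiver.Hom.unop_inj <| by
    refine (delta_diagStalkH adj K i.castSucc j.succ).trans
      (Eq.trans (diagStalkHom_congr adj K ?_ ?_) (diagStalkH_delta adj K i j).symm)
    · intro a
      have h : i.1 ≤ j.1 := hij
      simp only [comp_val, sigma_val, delta_val, Fin.val_castSucc, Fin.val_succ]
      split_ifs <;> omega
    · intro a
      have h : i.1 ≤ j.1 := hij
      simp only [OrderHom.comp_coe, Function.comp_apply, collapse_val, delta_val, consHom_val,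
        succHom_val, Fin.val_castSucc, Fin.val_succ]
      split_ifs <;> omega
  h_succ_comp_δ_castSucc_succ {n} j := Quiver.Hom.unop_inj <| by
    refine (delta_diagStalkH adj K j.castSucc.succ j.succ).trans
      (Eq.trans (diagStalkHom_congr adj K ?_ ?_) (delta_diagStalkH adj K _ _).symm)
    · intro a
      simp only [comp_val, sigma_val, delta_val, Fin.val_castSucc, Fin.val_succ]
      split_ifs <;> omega
    · intro a
      simp only [OrderHom.comp_coe, Function.comp_apply, collapse_val, delta_val,
        Fin.val_castSucc, Fin.val_succ]
      split_ifs <;> omega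
  h_castSucc_comp_δ_succ_of_lt {n} i j hji := Quiver.Hom.unop_inj <| by
    refine (delta_diagStalkH adj K i.succ j.castSucc).trans
      (Eq.trans (diagStalkHom_congr adj K ?_ ?_) (diagStalkH_delta adj K i j).symm)
    · intro a
      have h : j.1 < i.1 := hji
      simp only [comp_val, sigma_val, delta_val, Fin.val_castSucc, Fin.val_succ]
      split_ifs <;> omega
    · intro a
      have h : j.1 < i.1 := hji
      simp only [OrderHom.comp_coe, Function.comp_apply, collapse_val, delta_val, consHom_val,
        succHom_val, Fin.val_castSucc, Fin.val_succ]
      split_ifs <;> omega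
  h_comp_σ_castSucc_of_le {n} i j hij := Quiver.Hom.unop_inj <| by
    refine (sigma_diagStalkH adj K i.castSucc j).trans
      (Eq.trans (diagStalkHom_congr adj K ?_ ?_) (diagStalkH_sigma adj K i j.succ).symm)
    · intro a
      have h : i.1 ≤ j.1 := hij
      simp only [comp_val, sigma_val, Fin.val_castSucc, Fin.val_succ]
      split_ifs <;> omega
    · intro a
      have h : i.1 ≤ j.1 := hij
      simp only [OrderHom.comp_coe, Function.comp_apply, collapse_val, sigma_val, consHom_val,
        succHom_val, Fin.val_castSucc, Fin.val_succ]
      split_ifs <;> omega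
  h_comp_σ_succ_of_lt {n} i j hji := Quiver.Hom.unop_inj <| by
    refine (sigma_diagStalkH adj K i.succ j).trans
      (Eq.trans (diagStalkHom_congr adj K ?_ ?_) (diagStalkH_sigma adj K i j.castSucc).symm)
    · intro a
      have h : j.1 ≤ i.1 := hji
      simp only [comp_val, sigma_val, Fin.val_castSucc, Fin.val_succ]
      split_ifs <;> omega
    · intro a
      have h : j.1 ≤ i.1 := hji
      simp only [OrderHom.comp_coe, Function.comp_apply, collapse_val, sigma_val, consHom_val,
        succHom_val, Fin.val_castSucc, Fin.val_succ]
      split_ifs <;> omega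

end stalk
-- Alternating coface complexes and the Dold–Kan projection.
section coAlt
open AlgebraicTopology Simplicial
variable {C : Type*} [Category C] [Preadditive C]

/-- The alternating coface complex of a cosimplicial object; it is defined through the opposite
category, where the results on simplicial objects apply. -/
def coAlt (A : SimplexCategory ⥤ C) : CochainComplex C ℕ where
  X n := A.obj ⦋n⦌
  d i j := (((alternatingFaceMapComplex Cᵒᵖ).obj A.op).d j i).unop
  shape i j h := by
    rw [((alternatingFaceMapComplex Cᵒᵖ).obj A.op).shape j i h]; rfl
  d_comp_d' i j l _ _ := by
    rw [← unop_comp, HomologicalComplex.d_comp_d]; rfl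

lemma coAlt_d (A : SimplexCategory ⥤ C) (n : ℕ) :
    (coAlt A).d n (n + 1) =
      ∑ i : Fin (n + 2), (-1 : ℤ) ^ (i : ℕ) • A.map (SimplexCategory.δ i) := by
  change (((alternatingFaceMapComplex Cᵒᵖ).obj A.op).d (n + 1) n).unop = _
  rw [alternatingFaceMapComplex_obj_d, AlternatingFaceMapComplex.objD, unop_sum]
  refine Finset.sum_congr rfl fun i _ => ?_
  rw [unop_zsmul]
  rfl

/-- The map of cochain complexes given by an endomorphism of the face map complex in the opposite
category. -/
def coAltOfOp {A B : SimplexCategory ⥤ C}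
    (f : (alternatingFaceMapComplex Cᵒᵖ).obj B.op ⟶ (alternatingFaceMapComplex Cᵒᵖ).obj A.op) :
    coAlt A ⟶ coAlt B where
  f n := (f.f n).unop
  comm' i j _ := congrArg Quiver.Hom.unop (f.comm j i).symm

/-- The alternating coface complex is functorial. -/
def coAltMap {A B : SimplexCategory ⥤ C} (f : A ⟶ B) : coAlt A ⟶ coAlt B :=
  coAltOfOp ((alternatingFaceMapComplex Cᵒᵖ).map (NatTrans.op f))

@[simp] lemma coAltMap_id (A : SimplexCategory ⥤ C) : coAltMap (𝟙 A) = 𝟙 _ := rfl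

lemma coAltMap_comp {A B D : SimplexCategory ⥤ C} (f : A ⟶ B) (g : B ⟶ D) :
    coAltMap (f ≫ g) = coAltMap f ≫ coAltMap g := rfl

/-- The components of `coAltHomotopyOfOp`. -/
def coAltHomotopyHom {A B : SimplexCategory ⥤ C}
    {f g : (alternatingFaceMapComplex Cᵒᵖ).obj B.op ⟶ (alternatingFaceMapComplex Cᵒᵖ).obj A.op}
    (h : Homotopy f g) (i j : ℕ) : (coAlt A).X i ⟶ (coAlt B).X j := (h.hom j i).unop

/-- A chain homotopy in the opposite category gives a homotopy of cochain complexes. -/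
def coAltHomotopyOfOp {A B : SimplexCategory ⥤ C}
    {f g : (alternatingFaceMapComplex Cᵒᵖ).obj B.op ⟶ (alternatingFaceMapComplex Cᵒᵖ).obj A.op}
    (h : Homotopy f g) : Homotopy (coAltOfOp f) (coAltOfOp g) where
  hom i j := coAltHomotopyHom h i j
  zero i j hij := congrArg Quiver.Hom.unop (h.zero j i hij)
  comm n := by
    have h1 := h.comm n
    cases n with
    | zero =>
      rw [Homotopy.dNext_zero_chainComplex, Homotopy.prevD_chainComplex, zero_add] at h1
      rw [Homotopy.dNext_cochainComplex, Homotopy.prevD_zero_cochainComplex, add_zero]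
      exact congrArg Quiver.Hom.unop h1
    | succ n =>
      -- The passage to the opposite category exchanges the two terms `dNext` and `prevD`, hence the
      -- commutation of the sum.
      rw [Homotopy.dNext_succ_chainComplex, Homotopy.prevD_chainComplex, add_comm (_ ≫ _)] at h1
      rw [Homotopy.dNext_cochainComplex, Homotopy.prevD_succ_cochainComplex]
      exact congrArg Quiver.Hom.unop h1

/-- A cosimplicial map with a retraction that is a homotopy inverse gives a homotopy equivalence. -/
noncomputable def coAltHomotopyEquiv {A B : SimplexCategory ⥤ C} (f : A ⟶ B) (r : B ⟶ A) (hr : f ≫ r = 𝟙 A)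
    (h : SimplicialObject.Homotopy (NatTrans.op (r ≫ f)) (𝟙 B.op)) :
    HomotopyEquiv (coAlt A) (coAlt B) where
  hom := coAltMap f
  inv := coAltMap r
  homotopyHomInvId := Homotopy.ofEq (by rw [← coAltMap_comp, hr, coAltMap_id])
  homotopyInvHomId := (coAltHomotopyOfOp h.toChainHomotopy).trans
    (Homotopy.ofEq (coAltMap_id B))

/-- The idempotent endomorphism whose image is the normalized complex. -/
noncomputable def coProj (A : SimplexCategory ⥤ C) : coAlt A ⟶ coAlt A :=
  coAltOfOp (DoldKan.PInfty (X := A.op))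

/-- The projection to the normalized complex is homotopic to the identity. -/
noncomputable def coProjHomotopy (A : SimplexCategory ⥤ C) : Homotopy (coProj A) (𝟙 _) :=
  coAltHomotopyOfOp (DoldKan.homotopyPInftyToId A.op)

/-- In the opposite category `PInfty` vanishes on degeneracies. So the image of the projection
consists of elements killed by all codegeneracies, that is, of normalized cochains. -/
lemma coProj_comp_map (A : SimplexCategory ⥤ C) (n : ℕ) {Δ' : SimplexCategory}
    (θ : ⦋n⦌ ⟶ Δ') (hθ : ¬ Mono θ) : (coProj A).f n ≫ A.map θ = 0 :=
  congrArg Quiver.Hom.unop (DoldKan.degeneracy_comp_PInfty A.op n θ hθ)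

/-- Conversely, whatever is killed by the codegeneracies is killed by the complementary idempotent
`QInfty`, and `PInfty + QInfty = 1`. -/
lemma comp_coProj (A : SimplexCategory ⥤ C) (n : ℕ) {Z : C} (f : Z ⟶ A.obj ⦋n⦌)
    (hf : ∀ {m : ℕ} (θ : ⦋n⦌ ⟶ ⦋m⦌), ¬ Mono θ → f ≫ A.map θ = 0) : f ≫ (coProj A).f n = f := by
  have h1 : DoldKan.DegeneraciesVanish (X := A.op) f.op := by
    cases n with
    | zero => trivial
    | succ n =>
      intro i
      refine congrArg Quiver.Hom.op (hf (SimplexCategory.σ i) fun h => ?_)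
      have h2 := (SimplexCategory.mono_iff_injective.1 h)
      have h3 : (SimplexCategory.σ i).toOrderHom i.castSucc = (SimplexCategory.σ i).toOrderHom i.succ := by
        apply Fin.ext
        rw [sigma_val, sigma_val]
        simp
      have h4 := congrArg Fin.val (h2 h3)
      simp at h4
  have h2 := (DoldKan.degeneraciesVanish_iff_QInfty_f_comp (X := A.op) f.op).1 h1
  have h3 := congrArg (· ≫ f.op) (DoldKan.PInfty_f_add_QInfty_f (X := A.op) n)
  simp only [Preadditive.add_comp, h2, add_zero] at h3
  exact congrArg Quiver.Hom.unop (h3.trans (Category.id_comp _))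

variable {D : Type*} [Category D] [Preadditive D] (F : C ⥤ D) [F.Additive]

/-- The alternating coface complex commutes with additive functors. -/
def mapCoAltIso (A : SimplexCategory ⥤ C) :
    (F.mapHomologicalComplex _).obj (coAlt A) ≅ coAlt (A ⋙ F) :=
  HomologicalComplex.Hom.isoOfComponents (fun n => Iso.refl _) (by
    rintro i j hij
    obtain rfl : i + 1 = j := hij
    have h : F.map (∑ i : Fin (i + 2), (-1 : ℤ) ^ (i : ℕ) • A.map (SimplexCategory.δ i)) =
        ∑ i : Fin (i + 2), (-1 : ℤ) ^ (i : ℕ) • (A ⋙ F).map (SimplexCategory.δ i) := by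
      rw [Functor.map_sum]
      exact Finset.sum_congr rfl fun a _ => F.map_zsmul
    have : F.map ((coAlt A).d i (i + 1)) = (coAlt (A ⋙ F)).d i (i + 1) :=
      (congrArg (F.map ·) (coAlt_d A i)).trans (h.trans (coAlt_d (A ⋙ F) i).symm)
    exact (Category.id_comp _).trans (this.symm.trans (Category.comp_id _).symm))

lemma mapCoAltIso_naturality {A B : SimplexCategory ⥤ C} (f : A ⟶ B) :
    (F.mapHomologicalComplex _).map (coAltMap f) ≫ (mapCoAltIso F B).hom =
      (mapCoAltIso F A).hom ≫ coAltMap (Functor.whiskerRight f F) := by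
  ext n
  exact (Category.comp_id _).trans (Category.id_comp _).symm

lemma map_coProj (A : SimplexCategory ⥤ C) (n : ℕ) :
    F.map ((coProj A).f n) = (coProj (A ⋙ F)).f n :=
  congrArg Quiver.Hom.unop (DoldKan.map_PInfty_f F.op A.op n).symm

/-- The two cofaces in degree `0` agree on a coaugmentation and occur with opposite signs. -/
lemma coAlt_d_zero_comp (A : SimplexCategory ⥤ C) {Y : C} (f : ∀ n, Y ⟶ A.obj n)
    (hf : ∀ {n n'} (θ : n ⟶ n'), f n ≫ A.map θ = f n') : f ⦋0⦌ ≫ (coAlt A).d 0 1 = 0 := by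
  refine (congrArg (f ⦋0⦌ ≫ ·) (coAlt_d A 0)).trans ?_
  have h : f ⦋0⦌ ≫ ∑ i : Fin (0 + 2), (-1 : ℤ) ^ (i : ℕ) • A.map (SimplexCategory.δ i) = 0 := by
    rw [Fin.sum_univ_two, Preadditive.comp_add, Preadditive.comp_zsmul, Preadditive.comp_zsmul, hf, hf]
    simp
  exact h

/-- The codegeneracies of a constant object are identities, and the projection composed with a
codegeneracy vanishes. -/
lemma coProj_const (Y : C) (n : ℕ) :
    (coProj ((Functor.const SimplexCategory).obj Y)).f (n + 1) = 0 := by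
  have h := coProj_comp_map ((Functor.const SimplexCategory).obj Y) (n + 1)
    (SimplexCategory.σ (0 : Fin (n + 1))) (fun h => by
      have h2 := (SimplexCategory.mono_iff_injective.1 h)
      have h3 : (SimplexCategory.σ (0 : Fin (n + 1))).toOrderHom 0 =
          (SimplexCategory.σ (0 : Fin (n + 1))).toOrderHom 1 := by
        apply Fin.ext
        rw [sigma_val, sigma_val]
        simp
      have h4 := congrArg Fin.val (h2 h3)
      simp at h4)
  exact (Category.comp_id _).symm.trans h

variable [HasZeroObject C]

/-- The map from a single complex given by a coaugmentation. -/
noncomputable def coAltAug (A : SimplexCategory ⥤ C) {Y : C} (f : ∀ n, Y ⟶ A.obj n)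
    (hf : ∀ {n n'} (θ : n ⟶ n'), f n ≫ A.map θ = f n') :
    (CochainComplex.single₀ C).obj Y ⟶ coAlt A :=
  ((CochainComplex.fromSingle₀Equiv (coAlt A) Y).symm ⟨f ⦋0⦌, coAlt_d_zero_comp A f hf⟩)

lemma coAltAug_f_zero (A : SimplexCategory ⥤ C) {Y : C} (f : ∀ n, Y ⟶ A.obj n)
    (hf : ∀ {n n'} (θ : n ⟶ n'), f n ≫ A.map θ = f n') : (coAltAug A f hf).f 0 = f ⦋0⦌ :=
  CochainComplex.fromSingle₀Equiv_symm_apply_f_zero _ _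

/-- The coaugmentation of a constant cosimplicial object. -/
noncomputable def constAug (Y : C) :
    (CochainComplex.single₀ C).obj Y ⟶ coAlt ((Functor.const _).obj Y) :=
  coAltAug ((Functor.const _).obj Y) (fun _ => 𝟙 Y) (fun _ => Category.id_comp _)

lemma constAug_f_zero (Y : C) : (constAug Y).f 0 = 𝟙 Y :=
  coAltAug_f_zero ((Functor.const _).obj Y) (fun _ => 𝟙 Y) (fun _ => Category.id_comp _)

/-- The projection of the alternating coface complex of a constant object to degree zero. -/
noncomputable def constProj (Y : C) :
    coAlt ((Functor.const _).obj Y) ⟶ (CochainComplex.single₀ C).obj Y :=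
  (CochainComplex.toSingle₀Equiv (coAlt ((Functor.const _).obj Y)) Y).symm (𝟙 Y)

lemma constProj_f_zero (Y : C) : (constProj Y).f 0 = 𝟙 Y :=
  CochainComplex.toSingle₀Equiv_symm_apply_f_zero _

/-- The alternating coface complex of a constant object is concentrated in degree zero, up to
homotopy. -/
noncomputable def constCoAltEquiv (Y : C) :
    HomotopyEquiv ((CochainComplex.single₀ C).obj Y) (coAlt ((Functor.const _).obj Y)) where
  hom := constAug Y
  inv := constProj Y
  homotopyHomInvId := Homotopy.ofEq (by
    refine (CochainComplex.toSingle₀Equiv _ _).injective ?_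
    change (constAug Y).f 0 ≫ (constProj Y).f 0 = 𝟙 Y
    refine (congrArg (· ≫ (constProj Y).f 0) (constAug_f_zero Y)).trans ?_
    exact (Category.id_comp _).trans (constProj_f_zero Y))
  -- The composite is the Dold–Kan projection of the constant object: both are the identity in
  -- degree `0` and zero above. The projection is homotopic to the identity.
  homotopyInvHomId := (Homotopy.ofEq (by
    ext n
    cases n with
    | zero =>
      change (constProj Y).f 0 ≫ (constAug Y).f 0 = 𝟙 Y
      refine (congrArg (· ≫ (constAug Y).f 0) (constProj_f_zero Y)).trans ?_
      exact (Category.id_comp _).trans (constAug_f_zero Y)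
    | succ n =>
      refine Eq.trans ?_ (coProj_const Y n).symm
      refine Eq.trans ?_ (zero_comp (f := (constAug Y).f (n + 1)))
      refine congrArg (· ≫ (constAug Y).f (n + 1)) ?_
      exact (HomologicalComplex.isZero_single_obj_X _ _ _ _ (by simp)).eq_of_tgt _ _)).trans
    (coProjHomotopy _)

end coAlt

/-! ### Set-valued functors whose coinduction has an exact left adjoint are flat. -/

section flat
variable {C : Type u} [SmallCategory C] (Ψ : C ⥤ Type u)

/-- The presheaf `Y ↦ ∏_{Ψ Y} E`. -/
noncomputable def coinduced : Type u ⥤ Cᵒᵖ ⥤ Type u := Functor.flip (Ψ.op ⋙ piFunctor.{u}.flip)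

variable {Ψ} {L : (Cᵒᵖ ⥤ Type u) ⥤ Type u} (adj : L ⊣ coinduced Ψ)

/-- The element of `L P` given by a section `x` of `P` and an element `w`. -/
noncomputable def germ {P : Cᵒᵖ ⥤ Type u} {Y : C} (w : Ψ.obj Y) (x : P.obj (op Y)) : L.obj P :=
  Pi.π (fun _ : Ψ.obj Y => L.obj P) w ((adj.unit.app P).app (op Y) x)

lemma coinduced_map_π {E E' : Type u} (f : E ⟶ E') {Y : C} (w : Ψ.obj Y)
    (z : ((coinduced Ψ).obj E).obj (op Y)) :
    Pi.π (fun _ : Ψ.obj Y => E') w (((coinduced Ψ).map f).app (op Y) z) =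
      f (Pi.π (fun _ : Ψ.obj Y => E) w z) :=
  ConcreteCategory.congr_hom (Pi.map_π (fun _ : Ψ.obj Y => f) w) z

lemma coinduced_obj_map_π {E : Type u} {Y Z : C} (g : Z ⟶ Y) (w : Ψ.obj Z)
    (z : ((coinduced Ψ).obj E).obj (op Y)) :
    Pi.π (fun _ : Ψ.obj Z => E) w (((coinduced Ψ).obj E).map g.op z) =
      Pi.π (fun _ : Ψ.obj Y => E) (Ψ.map g w) z := by
  have h : ((coinduced Ψ).obj E).map g.op ≫ Pi.π (fun _ : Ψ.obj Z => E) w =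
      Pi.π (fun _ : Ψ.obj Y => E) (Ψ.map g w) := by
    simp [coinduced]
    exact Pi.lift_π _ _
  exact ConcreteCategory.congr_hom h z

lemma germ_naturality {P Q : Cᵒᵖ ⥤ Type u} (f : P ⟶ Q) {Y : C} (w : Ψ.obj Y) (x : P.obj (op Y)) :
    L.map f (germ adj w x) = germ adj w (f.app _ x) := by
  have h := ConcreteCategory.congr_hom (NatTrans.congr_app (adj.unit.naturality f) (op Y)) x
  refine (coinduced_map_π (L.map f) w _).symm.trans ?_
  exact congrArg _ h.symm

lemma germ_map {P : Cᵒᵖ ⥤ Type u} {Y Z : C} (g : Z ⟶ Y) (w : Ψ.obj Z) (x : P.obj (op Y)) :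
    germ adj w (P.map g.op x) = germ adj (Ψ.map g w) x := by
  refine Eq.trans ?_ (coinduced_obj_map_π g w _)
  exact congrArg _ (ConcreteCategory.congr_hom ((adj.unit.app P).naturality g.op) x)

lemma germ_homEquiv {P : Cᵒᵖ ⥤ Type u} {E : Type u} (f : L.obj P ⟶ E) {Y : C} (w : Ψ.obj Y)
    (x : P.obj (op Y)) :
    Pi.π (fun _ : Ψ.obj Y => E) w ((adj.homEquiv P E f).app (op Y) x) = f (germ adj w x) := by
  rw [adj.homEquiv_unit]
  exact coinduced_map_π f w _

/-- By adjunction a map out of `L.obj P` is a natural family of maps from sections of `P` to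
products, and its components are the values on germs. -/
lemma hom_ext_germ {P : Cᵒᵖ ⥤ Type u} {E : Type u} {f g : L.obj P ⟶ E}
    (h : ∀ (Y : C) (w : Ψ.obj Y) (x : P.obj (op Y)), f (germ adj w x) = g (germ adj w x)) :
    f = g := by
  refine (adj.homEquiv P E).injective ?_
  ext Y x
  have : ((adj.homEquiv P E) f).app Y ≫ 𝟙 _ = ((adj.homEquiv P E) g).app Y ≫ 𝟙 _ := by
    refine Limits.Pi.hom_ext (f := fun _ : Ψ.obj Y.unop => E) _ _ fun w => ?_
    ext x
    exact ((germ_homEquiv adj f w x).trans (h _ w x)).trans (germ_homEquiv adj g w x).symm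
  exact ConcreteCategory.congr_hom this x

/-- No construction of `L` is available, so surjectivity comes from the universal property: the
predicate of being a germ and the true predicate are two maps to `ULift Prop` that agree on all
germs. -/
lemma exists_germ {P : Cᵒᵖ ⥤ Type u} (z : L.obj P) :
    ∃ (Y : C) (w : Ψ.obj Y) (x : P.obj (op Y)), germ adj w x = z := by
  have h : TypeCat.ofHom (fun z : L.obj P => ULift.up.{u} (∃ (Y : C) (w : Ψ.obj Y) (x : P.obj (op Y)),
      germ adj w x = z)) = TypeCat.ofHom (fun _ => ULift.up True) :=
    hom_ext_germ adj fun Y w x => congrArg ULift.up (eq_true ⟨Y, w, x, rfl⟩)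
  exact of_eq_true (congrArg ULift.down (ConcreteCategory.congr_hom h z))

/-- The tuple of all elements `w` is a section over `Y` of the presheaf coinduced from the set
`Ψ.obj Y`. By Yoneda and adjunction it gives a map from `L.obj (yoneda.obj Y)` to `Ψ.obj Y` that
takes the germ of the identity at `w` back to `w`. -/
lemma germ_id_injective {Y : C} {w w' : Ψ.obj Y}
    (h : germ adj w (P := yoneda.obj Y) (𝟙 Y) = germ adj w' (P := yoneda.obj Y) (𝟙 Y)) : w = w' := by
  let e : PUnit.{u + 1} ⟶ ∏ᶜ fun _ : Ψ.obj Y => Ψ.obj Y :=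
    Pi.lift fun w => TypeCat.ofHom fun _ => w
  have he (w : Ψ.obj Y) : Pi.π (fun _ : Ψ.obj Y => Ψ.obj Y) w (e PUnit.unit) = w :=
    ConcreteCategory.congr_hom (Pi.lift_π (fun w : Ψ.obj Y => TypeCat.ofHom fun _ => w) w) PUnit.unit
  let t : yoneda.obj Y ⟶ (coinduced Ψ).obj (Ψ.obj Y) :=
    (yonedaEquiv (F := (coinduced Ψ).obj (Ψ.obj Y))).symm (e PUnit.unit)
  have ht : t.app (op Y) (𝟙 Y) = e PUnit.unit :=
    (yonedaEquiv (F := (coinduced Ψ).obj (Ψ.obj Y))).apply_symm_apply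
      (e PUnit.unit : ((coinduced Ψ).obj (Ψ.obj Y)).obj (op Y))
  have key (w : Ψ.obj Y) :
      (adj.homEquiv _ _).symm t (germ adj w (P := yoneda.obj Y) (𝟙 Y)) = w := by
    rw [← germ_homEquiv, Equiv.apply_symm_apply, ht]
    exact he w
  rw [← key w, h, key w']

lemma germ_id {Y Z : C} (g : Z ⟶ Y) (w : Ψ.obj Z) :
    germ adj w (P := yoneda.obj Y) g = germ adj (Ψ.map g w) (P := yoneda.obj Y) (𝟙 Y) := by
  rw [← germ_map]
  congr 1
  exact (Category.comp_id g).symm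

/-- The set `Ψ.obj Y` embeds in the value of `L` at the presheaf represented by `Y`, and all
elements of `L.obj P` are germs. Each axiom comes from the preservation of one finite limit of
presheaves: the terminal presheaf, the product of two representables, and the equalizer of two maps
of representables. -/
theorem isCofiltered_elements (adj : L ⊣ coinduced Ψ) [PreservesFiniteLimits L] : IsCofiltered Ψ.Elements where
  nonempty := by
    have h : IsTerminal (L.obj (⊤_ _)) := IsTerminal.isTerminalObj L _ terminalIsTerminal
    obtain ⟨Y, w, -⟩ := exists_germ adj (h.from PUnit PUnit.unit)
    exact ⟨⟨Y, w⟩⟩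
  cone_objs := by
    rintro ⟨Y₁, w₁⟩ ⟨Y₂, w₂⟩
    let b : IsLimit (BinaryFan.mk (L.map (prod.fst (X := yoneda.obj Y₁) (Y := yoneda.obj Y₂)))
        (L.map prod.snd)) := mapIsLimitOfPreservesOfIsLimit L _ _ (prodIsProd _ _)
    obtain ⟨e, h₁, h₂⟩ := BinaryFan.IsLimit.lift' b
      (TypeCat.ofHom fun _ : PUnit.{u + 1} => germ adj w₁ (P := yoneda.obj Y₁) (𝟙 Y₁))
      (TypeCat.ofHom fun _ => germ adj w₂ (P := yoneda.obj Y₂) (𝟙 Y₂))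
    have e₁ := ConcreteCategory.congr_hom h₁ PUnit.unit
    have e₂ := ConcreteCategory.congr_hom h₂ PUnit.unit
    -- The pair of germs of identities is the germ of a section `x` over some `Z`; such a section is
    -- a pair of maps from `Z` to `Y₁` and `Y₂`.
    obtain ⟨Z, w, x, hx⟩ := exists_germ adj (e PUnit.unit)
    refine ⟨⟨Z, w⟩, ⟨(prod.fst : yoneda.obj Y₁ ⨯ yoneda.obj Y₂ ⟶ _).app _ x, ?_⟩,
      ⟨(prod.snd : yoneda.obj Y₁ ⨯ yoneda.obj Y₂ ⟶ _).app _ x, ?_⟩, trivial⟩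
    · apply germ_id_injective adj
      refine (germ_id adj _ _).symm.trans ((germ_naturality adj prod.fst w x).symm.trans ?_)
      rw [hx]
      exact e₁
    · apply germ_id_injective adj
      refine (germ_id adj _ _).symm.trans ((germ_naturality adj prod.snd w x).symm.trans ?_)
      rw [hx]
      exact e₂
  cone_maps := by
    rintro ⟨Y₁, w₁⟩ ⟨Y₂, w₂⟩ ⟨f, hf⟩ ⟨g, hg⟩
    dsimp at f g hf hg
    let b := isLimitForkMapOfIsLimit L _ (equalizerIsEqualizer (yoneda.map f) (yoneda.map g))
    let a₁ : PUnit.{u + 1} ⟶ L.obj (yoneda.obj Y₁) :=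
      TypeCat.ofHom fun _ => germ adj w₁ (P := yoneda.obj Y₁) (𝟙 Y₁)
    have aux (h : Y₁ ⟶ Y₂) : L.map (yoneda.map h) (germ adj w₁ (P := yoneda.obj Y₁) (𝟙 Y₁)) =
        germ adj (Ψ.map h w₁) (P := yoneda.obj Y₂) (𝟙 Y₂) := by
      refine (germ_naturality adj (yoneda.map h) w₁ (𝟙 Y₁)).trans ?_
      refine Eq.trans ?_ (germ_id adj h w₁)
      exact congrArg (germ adj w₁ (P := yoneda.obj Y₂)) (Category.id_comp h)
    have ha : a₁ ≫ L.map (yoneda.map f) = a₁ ≫ L.map (yoneda.map g) := by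
      ext
      exact ((aux f).trans (by rw [hf, hg])).trans (aux g).symm
    have e₁ := ConcreteCategory.congr_hom (Fork.IsLimit.lift_ι' b a₁ ha) PUnit.unit
    -- A section of the equalizer over `Z` is a map `Z ⟶ Y₁` that equalizes `f` and `g`.
    obtain ⟨Z, w, x, hx⟩ := exists_germ adj (Fork.IsLimit.lift b a₁ ha PUnit.unit)
    refine ⟨⟨Z, w⟩, ⟨(equalizer.ι (yoneda.map f) (yoneda.map g)).app _ x, ?_⟩, ?_⟩
    · apply germ_id_injective adj
      refine (germ_id adj _ _).symm.trans
        ((germ_naturality adj (equalizer.ι (yoneda.map f) (yoneda.map g)) w x).symm.trans ?_)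
      rw [hx]
      exact e₁
    · apply Subtype.ext
      exact ConcreteCategory.congr_hom (NatTrans.congr_app
        (equalizer.condition (yoneda.map f) (yoneda.map g)) (op Z)) x

/-- A functor to sets is a fiber functor if the left adjoint of its coinduction is exact and
coinduced presheaves are sheaves. -/
noncomputable def pointOfAdj [PreservesFiniteLimits L] (J : GrothendieckTopology C)
    (hJ : ∀ E, Presheaf.IsSheaf J ((coinduced Ψ).obj E)) : GrothendieckTopology.Point.{u} J where
  fiber := Ψ
  isCofiltered := isCofiltered_elements adj
  initiallySmall := initiallySmall_of_essentiallySmall _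
  jointly_surjective {Y} R hR w := by
    -- Maps from a covering sieve to a sheaf extend uniquely to the representable. Coinduced
    -- presheaves are sheaves, so by adjunction `L` sends the inclusion of the sieve to an
    -- epimorphism, hence to a surjection of sets.
    have hepi : Epi (L.map R.functorInclusion) := ⟨fun {E} a b hab => by
      refine (adj.homEquiv _ _).injective ?_
      have h := (isSheaf_iff_isSheaf_of_type J _).1 (hJ E) R hR
      refine h.hom_ext _ _ ?_
      rw [← adj.homEquiv_naturality_left, ← adj.homEquiv_naturality_left, hab]⟩
    obtain ⟨z, hz⟩ := (epi_iff_surjective _).1 hepi (germ adj w (P := yoneda.obj Y) (𝟙 Y))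
    obtain ⟨Z, v, x, rfl⟩ := exists_germ adj z
    refine ⟨Z, x.1, x.2, v, germ_id_injective adj ?_⟩
    rw [← hz, germ_naturality]
    exact (germ_id adj x.1 v).symm

end flat

/-! ### Inverse images of points. -/

section comap
variable {C C' : Type u} [SmallCategory C] [SmallCategory C'] {J : GrothendieckTopology C}
  {J' : GrothendieckTopology C'} (F : C' ⥤ C) [F.IsContinuous J' J]
  [PreservesFiniteLimits (F.sheafPullback (Type u) J' J)] (q : GrothendieckTopology.Point.{u} J)

/-- The inverse image of a point under a continuous functor whose inverse image functor is exact. -/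
noncomputable def comapPoint : GrothendieckTopology.Point.{u} J' :=
  -- The left adjoint is sheafification, then `f^{-1}`, then the stalk at `q`, a composite of exact
  -- functors; the exactness of `f^{-1}` on sheaves of sets is used here. Its right adjoint sends
  -- `E` to the direct image of a skyscraper, which is `Y ↦ ∏_{q(F Y)} E`.
  pointOfAdj (Ψ := F ⋙ q.fiber)
    (L := presheafToSheaf J' (Type u) ⋙ F.sheafPullback (Type u) J' J ⋙ q.sheafFiber)
    ((sheafificationAdjunction J' (Type u)).comp
      ((F.sheafAdjunctionContinuous (Type u) J' J).comp q.skyscraperSheafAdjunction)) J'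
    (fun E => ((F.sheafPushforwardContinuous (Type u) J' J).obj (q.skyscraperSheaf E)).property)

variable (A : Type v) [Category.{u} A] [HasLimitsOfSize.{u, u} A]
  [HasColimitsOfSize.{u, u} A] [(F.sheafPushforwardContinuous A J' J).IsRightAdjoint]

/-- The stalk of an inverse image. -/
noncomputable def comapFiberIso :
    (comapPoint F q).sheafFiber ≅ F.sheafPullback A J' J ⋙ q.sheafFiber :=
  -- Uniqueness of left adjoints: the direct image of the skyscraper at `q` is, by definition, the
  -- skyscraper at the inverse image of `q`.
  (conjugateIsoEquiv ((F.sheafAdjunctionContinuous A J' J).comp q.skyscraperSheafAdjunction)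
    (comapPoint F q).skyscraperSheafAdjunction).symm (Iso.refl _)

end comap
-- Detection on stalks, and injective sheaves of modules.
section injective
variable {k : Type u} [Field k] {C C' : Type u} [SmallCategory C] [SmallCategory C']
  {J : GrothendieckTopology C} {J' : GrothendieckTopology C'}
  {S : Type u} (p : S → GrothendieckTopology.Point.{u} J)

lemma isIso_of_fibers (hp : (ObjectProperty.ofObj p).IsConservativeFamilyOfPoints)
    {M N : Sheaf J (ModuleCat.{u} k)} (f : M ⟶ N)
    (hf : ∀ s, IsIso ((p s).sheafFiber.map f)) : IsIso f := by
  rw [(hp.jointlyReflectIsomorphisms (ModuleCat.{u} k)).isIso_iff]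
  rintro ⟨_, ⟨s⟩⟩
  exact hf s

lemma mono_of_fibers (hp : (ObjectProperty.ofObj p).IsConservativeFamilyOfPoints)
    {M N : Sheaf J (ModuleCat.{u} k)} (f : M ⟶ N)
    (hf : ∀ s, Mono ((p s).sheafFiber.map f)) : Mono f := by
  rw [(hp.jointlyReflectMonomorphisms (ModuleCat.{u} k)).mono_iff]
  rintro ⟨_, ⟨s⟩⟩
  exact hf s

/-- Stalk functors are exact, so the stalk of the map on homology is the map on the homology of
stalks, and conservativity applies to it. -/
lemma quasiIso_of_fibers (hp : (ObjectProperty.ofObj p).IsConservativeFamilyOfPoints)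
    {K L : CochainComplex (Sheaf J (ModuleCat.{u} k)) ℕ} (f : K ⟶ L)
    (hf : ∀ s, QuasiIso (((p s).sheafFiber.mapHomologicalComplex _).map f)) : QuasiIso f := by
  refine ⟨fun i => ?_⟩
  rw [quasiIsoAt_iff]
  have γ : ShortComplex.LeftHomologyMapData ((HomologicalComplex.shortComplexFunctor _ _ i).map f)
    (K.sc i).leftHomologyData (L.sc i).leftHomologyData := default
  refine γ.quasiIso_iff.2 (isIso_of_fibers p hp _ fun s => ?_)
  have h := (quasiIsoAt_iff _ i).1 ((hf s).quasiIsoAt i)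
  exact (γ.map (p s).sheafFiber).quasiIso_iff.1 h

/-- A right adjoint preserves injectives if its left adjoint preserves monomorphisms. For `f^{-1}`
on sheaves of modules this is checked on stalks, which are stalks of the original sheaves at inverse
images of points. -/
lemma injective_pushforward (hp : (ObjectProperty.ofObj p).IsConservativeFamilyOfPoints)
    (F : C' ⥤ C) [F.IsContinuous J' J] [PreservesFiniteLimits (F.sheafPullback (Type u) J' J)]
    (I : Sheaf J (ModuleCat.{u} k)) [Injective I] :
    Injective ((F.sheafPushforwardContinuous (ModuleCat.{u} k) J' J).obj I) := by
  have : (F.sheafPullback (ModuleCat.{u} k) J' J).PreservesMonomorphisms := ⟨fun {M N} f hf => by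
    refine mono_of_fibers p hp _ fun s => ?_
    exact ((MorphismProperty.monomorphisms _).arrow_mk_iso_iff
      (((Functor.mapArrowFunctor _ _).mapIso
        (comapFiberIso F (p s) (ModuleCat.{u} k))).app (Arrow.mk f))).1
        (inferInstanceAs (Mono ((comapPoint F (p s)).sheafFiber.map f)))⟩
  exact Injective.injective_of_adjoint
    (F.sheafAdjunctionContinuous (ModuleCat.{u} k) J' J) I

/-- The coefficients are a field, and over a semisimple ring every module is injective. -/
lemma injective_moduleCat (M : ModuleCat.{u} k) : Injective M := by
  have := Module.injective_of_isSemisimpleRing k M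
  exact Module.injective_object_of_injective_module (R := k) (M := M)

lemma injective_skyscraper (q : GrothendieckTopology.Point.{u} J) (M : ModuleCat.{u} k) :
    Injective (q.skyscraperSheafFunctor.obj M) := by
  have : q.sheafFiber (A := ModuleCat.{u} k).PreservesMonomorphisms := inferInstance
  have := injective_moduleCat M
  exact Injective.injective_of_adjoint q.skyscraperSheafAdjunction M

instance : PreservesLimitsOfSize.{u, u} (algToMod k) := by
  have : PreservesLimitsOfSize.{u, u} (algToMod k ⋙ CategoryTheory.forget (ModuleCat.{u} k)) :=
    preservesLimits_of_natIso (algToModForget k)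
  exact preservesLimits_of_reflects_of_preserves (algToMod k) (CategoryTheory.forget (ModuleCat.{u} k))

instance : PreservesFilteredColimitsOfSize.{u, u} (algToMod k) where
  preserves_filtered_colimits D _ _ := by
    -- Algebras are commutative rings under `k`, and the forgetful functor from an under category
    -- preserves connected colimits only.
    have := IsFiltered.isConnected D
    have h1 : PreservesColimitsOfShape D ((commAlgCatEquivUnder (.of k)).functor ⋙
      Under.forget (CommRingCat.of k) ⋙ CategoryTheory.forget CommRingCat.{u}) := inferInstance
    have h2 : PreservesColimitsOfShape D
        (algToMod k ⋙ CategoryTheory.forget (ModuleCat.{u} k)) := h1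
    have h3 : ReflectsColimitsOfShape D (CategoryTheory.forget (ModuleCat.{u} k)) :=
      reflectsColimitsOfShape_of_reflectsIsomorphisms
    exact preservesColimitsOfShape_of_reflects_of_preserves _
      (CategoryTheory.forget (ModuleCat.{u} k))

lemma skyscraper_map_π (q : GrothendieckTopology.Point.{u} J) {A : Type v} [Category.{u} A]
    [HasProducts.{u} A] (M : A) {Y Z : C} (g : Z ⟶ Y) (w : q.fiber.obj Z) :
    (q.skyscraperSheafFunctor.obj M).obj.map g.op ≫ Pi.π (fun _ : q.fiber.obj Z => M) w =
      Pi.π (fun _ : q.fiber.obj Y => M) (q.fiber.map g w) :=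
  (Pi.map'_comp_π (f := fun _ : q.fiber.obj Y => M) (g := fun _ : q.fiber.obj Z => M)
    (q.fiber.map g) (fun _ => 𝟙 M) w).trans (Category.comp_id _)

/-- Skyscraper sheaves commute with the passage to underlying modules. -/
noncomputable def modSkyscraperIso (q : GrothendieckTopology.Point.{u} J) (M : CommAlgCat.{u} k) :
    modSheaf (q.skyscraperSheafFunctor.obj M) ≅
      q.skyscraperSheafFunctor.obj ((algToMod k).obj M) :=
  (fullyFaithfulSheafToPresheaf J _).preimageIso (NatIso.ofComponents
    (fun Y => PreservesProduct.iso (algToMod k) (fun _ : q.fiber.obj Y.unop => M)) (by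
      intro Y Z g
      refine Limits.Pi.hom_ext (f := fun _ : q.fiber.obj Z.unop => (algToMod k).obj M) _ _
        fun w => ?_
      have h1 (Y : C) (w : q.fiber.obj Y) :
          (PreservesProduct.iso (algToMod k) (fun _ : q.fiber.obj Y => M)).hom ≫ Pi.π _ w =
            (algToMod k).map (Pi.π (fun _ : q.fiber.obj Y => M) w) := by
        rw [PreservesProduct.iso_hom, piComparison_comp_π]
      refine (Category.assoc _ _ _).trans ((congrArg (_ ≫ ·) (h1 _ w)).trans ?_)
      refine Eq.trans ?_ (Category.assoc _ _ _).symm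
      refine Eq.trans ?_ (congrArg (_ ≫ ·) (skyscraper_map_π q ((algToMod k).obj M) g.unop w)).symm
      refine Eq.trans ?_ (h1 _ _).symm
      refine ((algToMod k).map_comp _ _).symm.trans ?_
      exact congrArg (algToMod k).map (skyscraper_map_π q M g.unop w)))

instance : PreservesLimitsOfSize.{u, u} (sheafCompose J (algToMod k)) := by
  have : PreservesLimitsOfSize.{u, u} (sheafCompose J (algToMod k) ⋙ sheafToPresheaf J _) :=
    inferInstanceAs (PreservesLimitsOfSize.{u, u} (sheafToPresheaf J (CommAlgCat.{u} k) ⋙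
      (Functor.whiskeringRight _ _ _).obj (algToMod k)))
  exact preservesLimits_of_reflects_of_preserves _ (sheafToPresheaf J (ModuleCat.{u} k))

/-- The passage to underlying modules commutes with products and skyscrapers, so this is a product
of skyscrapers of vector spaces. All values of the Godement monad have this form. -/
lemma injective_modSheaf_skyscrapers (E : S → CommAlgCat.{u} k) :
    Injective (modSheaf ((skyscrapers p _).obj E)) := by
  have (s : S) : Injective (modSheaf ((p s).skyscraperSheafFunctor.obj (E s))) :=
    have := injective_skyscraper (p s) ((algToMod k).obj (E s))
    Injective.of_iso (modSkyscraperIso (p s) (E s)).symm inferInstance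
  exact Injective.of_iso (PreservesProduct.iso (sheafCompose J (algToMod k))
    (fun s => (p s).skyscraperSheafFunctor.obj (E s))).symm inferInstance

end injective
-- The coaugmentation of the diagonal is a quasi-isomorphism of complexes of sheaves.
section stalkwise
open AlgebraicTopology Simplicial

lemma quasiIso_coAltMap_of_iso {𝒜 𝒟 : Type*} [Category 𝒜] [Category 𝒟] [Abelian 𝒟]
    {P Q : 𝒜 ⥤ 𝒟} (e : P ≅ Q) {A B : SimplexCategory ⥤ 𝒜} (f : A ⟶ B)
    (h : QuasiIso (coAltMap (Functor.whiskerRight f Q))) :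
    QuasiIso (coAltMap (Functor.whiskerRight f P)) := by
  have h1 : Functor.whiskerRight f P =
      Functor.whiskerLeft A e.hom ≫ Functor.whiskerRight f Q ≫ Functor.whiskerLeft B e.inv := by
    ext n
    simp
  have i1 : IsIso (coAltMap (Functor.whiskerLeft A e.hom)) :=
    ⟨coAltMap (Functor.whiskerLeft A e.inv), by
      rw [← coAltMap_comp, ← Functor.whiskerLeft_comp, e.hom_inv_id]; exact coAltMap_id _, by
      rw [← coAltMap_comp, ← Functor.whiskerLeft_comp, e.inv_hom_id]; exact coAltMap_id _⟩
  have i2 : IsIso (coAltMap (Functor.whiskerLeft B e.inv)) :=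
    ⟨coAltMap (Functor.whiskerLeft B e.hom), by
      rw [← coAltMap_comp, ← Functor.whiskerLeft_comp, e.inv_hom_id]; exact coAltMap_id _, by
      rw [← coAltMap_comp, ← Functor.whiskerLeft_comp, e.hom_inv_id]; exact coAltMap_id _⟩
  rw [h1, coAltMap_comp, coAltMap_comp]
  infer_instance

variable {k : Type u} [Field k] {C : Type u} [SmallCategory C] {J : GrothendieckTopology C}

/-- The complex of sheaves of modules given by a cosimplicial sheaf of algebras. -/
noncomputable abbrev modCo (K : SimplexCategory ⥤ Sheaf J (CommAlgCat.{u} k)) :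
    CochainComplex (Sheaf J (ModuleCat.{u} k)) ℕ := coAlt (K ⋙ sheafCompose J (algToMod k))

/-- The map of complexes of sheaves of modules given by a map of cosimplicial sheaves of algebras. -/
noncomputable abbrev modCoMap {K K' : SimplexCategory ⥤ Sheaf J (CommAlgCat.{u} k)} (f : K ⟶ K') :
    modCo K ⟶ modCo K' := coAltMap (Functor.whiskerRight f _)

instance additive_sheafFiber (q : GrothendieckTopology.Point.{u} J) :
    (q.sheafFiber (A := ModuleCat.{u} k)).Additive :=
  Functor.additive_of_preserves_binary_products _

variable {S : Type u} (p : S → GrothendieckTopology.Point.{u} J)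

/-- On stalks the counit provides an extra degeneracy, so the coaugmentation is a homotopy
equivalence there. Nothing is assumed of the cosimplicial sheaf `K`. -/
lemma quasiIso_modCoMap_diagAug (hp : (ObjectProperty.ofObj p).IsConservativeFamilyOfPoints)
    (K : SimplexCategory ⥤ Sheaf J (CommAlgCat.{u} k)) :
    QuasiIso (modCoMap (diagAug (godementMonad p _) K)) := by
  refine quasiIso_of_fibers p hp _ fun s => ?_
  have h1 := mapCoAltIso_naturality (p s).sheafFiber
    (Functor.whiskerRight (diagAug (godementMonad p _) K) (sheafCompose J (algToMod k)))
  have h2 : QuasiIso (coAltMap (Functor.whiskerRight (diagAug (godementMonad p _) K)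
      (sheafCompose J (algToMod k) ⋙ (p s).sheafFiber))) := by
    -- The stalk of the underlying modules is the underlying module of the stalk of algebras.
    refine quasiIso_coAltMap_of_iso ((p s).sheafFiberCompIso (algToMod k)) _ ?_
    -- The cosimplicial homotopy lives in families of commutative algebras, which have no
    -- alternating sums; it is carried by this functor to vector spaces and gives a homotopy of
    -- complexes there.
    let L := Pi.eval (fun _ : S => CommAlgCat.{u} k) s ⋙ algToMod k
    let e := coAltHomotopyEquiv
      (Functor.whiskerRight (Functor.whiskerRight (diagAug (godementMonad p _) K)
        (stalks p (CommAlgCat.{u} k))) L)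
      (Functor.whiskerRight (diagStalkRetraction (stalksAdj p (CommAlgCat.{u} k)) K) L)
      ((Functor.whiskerRight_comp _ _ _).symm.trans
        ((congrArg (Functor.whiskerRight · L)
          (map_diagAug_retraction (stalksAdj p (CommAlgCat.{u} k)) K)).trans
          (Functor.whiskerRight_id' _)))
      ((diagStalkHomotopy (stalksAdj p (CommAlgCat.{u} k)) K).whiskerRight L.op)
    exact e.quasiIso_hom
  refine (quasiIso_iff_comp_right _ (mapCoAltIso (p s).sheafFiber
    (diagRes (godementMonad p _) K ⋙ sheafCompose J (algToMod k))).hom).1 ?_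
  rw [h1]
  exact (quasiIso_iff_comp_left _ _).2 h2

end stalkwise
-- The Godement resolution as an injective resolution.
section godementInj
open AlgebraicTopology Simplicial

lemma isIso_coAltMap {𝒟 : Type*} [Category 𝒟] [Preadditive 𝒟] {A B : SimplexCategory ⥤ 𝒟}
    (f : A ⟶ B) (hf : ∀ n, IsIso (f.app n)) : IsIso (coAltMap f) := by
  have : IsIso f := NatIso.isIso_of_isIso_app f
  exact ⟨coAltMap (inv f), by rw [← coAltMap_comp, IsIso.hom_inv_id]; exact coAltMap_id _, by
    rw [← coAltMap_comp, IsIso.inv_hom_id]; exact coAltMap_id _⟩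

variable {k : Type u} [Field k] {C : Type u} [SmallCategory C] {J : GrothendieckTopology C}
  {S : Type u} (p : S → GrothendieckTopology.Point.{u} J)

/-- The coaugmentation of the Godement resolution as a map of cosimplicial sheaves of modules. -/
noncomputable def godementCoaug (O : Sheaf J (CommAlgCat.{u} k)) :
    (Functor.const SimplexCategory).obj (modSheaf O) ⟶
      (cosimp (godementMonad p _)).obj O ⋙ sheafCompose J (algToMod k) where
  app n := (sheafCompose J (algToMod k)).map (coaug (godementMonad p _) O n)
  naturality _ _ θ := (Category.id_comp _).trans
    ((congrArg (sheafCompose J (algToMod k)).map (coaug_map (godementMonad p _) O θ)).symm.trans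
      ((sheafCompose J (algToMod k)).map_comp _ _))

/-- This is the theorem on the diagonal for a constant cosimplicial sheaf, whose diagonal is the
Godement resolution itself. -/
lemma quasiIso_godementCoaug (hp : (ObjectProperty.ofObj p).IsConservativeFamilyOfPoints)
    (O : Sheaf J (CommAlgCat.{u} k)) : QuasiIso (coAltMap (godementCoaug p O)) := by
  let T := godementMonad p (CommAlgCat.{u} k)
  let K := (Functor.const SimplexCategory).obj O
  let g : (cosimp T).obj O ⟶ diagRes T K :=
    diagOfConst T (K := K) (fun _ => 𝟙 O) (fun _ => Category.id_comp _)
  -- The comparison with the diagonal of the constant object consists of the iterates of the monad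
  -- on an identity.
  have hg : IsIso (modCoMap g) := isIso_coAltMap _ fun n => by
    have : IsIso (g.app n) := by
      have h : IsIso (iterMap T (𝟙 O) (n.len + 1)) := by
        rw [iterMap_id]
        infer_instance
      exact h
    exact inferInstanceAs (IsIso ((sheafCompose J (algToMod k)).map (g.app n)))
  let c : (Functor.const SimplexCategory).obj (modSheaf O) ⟶ K ⋙ sheafCompose J (algToMod k) :=
    { app n := 𝟙 _
      naturality n n' θ := by
        refine (Category.id_comp _).trans ((Category.id_comp _).trans ?_).symm
        exact (sheafCompose J (algToMod k)).map_id O }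
  have hc : IsIso (coAltMap c) := isIso_coAltMap _ fun n => inferInstanceAs (IsIso (𝟙 _))
  have h : coAltMap (godementCoaug p O) ≫ modCoMap g =
      coAltMap c ≫ modCoMap (diagAug T K) := by
    rw [← coAltMap_comp, ← coAltMap_comp]
    congr 1
    ext n : 2
    refine Eq.trans ?_ (Category.id_comp _).symm
    refine ((sheafCompose J (algToMod k)).map_comp _ _).symm.trans ?_
    refine congrArg (sheafCompose J (algToMod k)).map ?_
    exact (coaug_diagOfConst T (K := K) (fun _ => 𝟙 O) (fun _ => Category.id_comp _) n).trans
      (Category.id_comp _)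
  have := quasiIso_modCoMap_diagAug p hp K
  refine (quasiIso_iff_comp_right _ (modCoMap g)).1 ?_
  rw [h]
  infer_instance

/-- The outermost functor in each degree is `p_*`, so the terms are products of skyscrapers for any
`K`. -/
lemma injective_modCo_diagRes (K : SimplexCategory ⥤ Sheaf J (CommAlgCat.{u} k)) (n : ℕ) :
    Injective ((modCo (diagRes (godementMonad p _) K)).X n) :=
  injective_modSheaf_skyscrapers p _

lemma injective_modCo_cosimp (O : Sheaf J (CommAlgCat.{u} k)) (n : ℕ) :
    Injective ((modCo ((cosimp (godementMonad p _)).obj O)).X n) :=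
  injective_modSheaf_skyscrapers p _

/-- The alternating coface complex of the Godement resolution is an injective resolution. -/
noncomputable def godementInj (hp : (ObjectProperty.ofObj p).IsConservativeFamilyOfPoints)
    (O : Sheaf J (CommAlgCat.{u} k)) : InjectiveResolution (modSheaf O) where
  cocomplex := modCo ((cosimp (godementMonad p _)).obj O)
  injective := injective_modCo_cosimp p O
  ι := constAug (modSheaf O) ≫ coAltMap (godementCoaug p O)
  quasiIso := by
    have := quasiIso_godementCoaug p hp O
    have : QuasiIso (constAug (modSheaf O)) := (constCoAltEquiv (modSheaf O)).quasiIso_hom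
    infer_instance

end godementInj
-- Restriction from the terminal object `X` to `u(X')`.
section terminal
variable {C C' : Type u} [SmallCategory C] [SmallCategory C'] {J : GrothendieckTopology C}
  {J' : GrothendieckTopology C'} {A : Type v} [Category.{u} A] [HasLimitsOfSize.{u, u} A]
  [HasColimitsOfSize.{u, u} A]

lemma isIso_skyscraper_map (q : GrothendieckTopology.Point.{u} J) (M : A) {Y Z : C} (g : Z ⟶ Y)
    [IsIso (q.fiber.map g)] : IsIso ((q.skyscraperSheafFunctor.obj M).obj.map g.op) :=
  inferInstanceAs (IsIso ((piFunctor.{u}.obj M).map (q.fiber.map g).op))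

/-- Sections over an object commute with products, and the sections of a skyscraper depend on the
object only through its fiber. -/
lemma isIso_skyscrapers_map {S : Type u} (p : S → GrothendieckTopology.Point.{u} J) (E : S → A)
    {Y Z : C} (g : Z ⟶ Y) (hg : ∀ s, IsIso ((p s).fiber.map g)) :
    IsIso (((skyscrapers p A).obj E).obj.map g.op) := by
  let G (s : S) := (p s).skyscraperSheafFunctor.obj (E s)
  let ev (Y : C) : Sheaf J A ⥤ A := sheafToPresheaf J A ⋙ (evaluation Cᵒᵖ A).obj (op Y)
  have (s : S) : IsIso ((G s).obj.map g.op) :=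
    have := hg s
    isIso_skyscraper_map (p s) (E s) g
  have h1 (Y : C) (s : S) : (PreservesProduct.iso (ev Y) G).hom ≫ Pi.π _ s = (ev Y).map (Pi.π G s) := by
    rw [PreservesProduct.iso_hom, piComparison_comp_π]
  have h2 : (∏ᶜ G).obj.map g.op ≫ (PreservesProduct.iso (ev Z) G).hom =
      (PreservesProduct.iso (ev Y) G).hom ≫ Limits.Pi.map (fun s => (G s).obj.map g.op) := by
    refine Limits.Pi.hom_ext (f := fun s => (ev Z).obj (G s)) _ _ fun s => ?_
    refine (Category.assoc _ _ _).trans ((congrArg (_ ≫ ·) (h1 Z s)).trans ?_)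
    refine Eq.trans ?_ (Category.assoc _ _ _).symm
    refine Eq.trans ?_ (congrArg (_ ≫ ·) (Limits.Pi.map_π (fun s => (G s).obj.map g.op) s)).symm
    refine Eq.trans ?_ (Category.assoc _ _ _)
    refine Eq.trans ?_ (congrArg (· ≫ (G s).obj.map g.op) (h1 Y s)).symm
    exact (Pi.π G s).hom.naturality g.op
  have h3 : (∏ᶜ G).obj.map g.op = (PreservesProduct.iso (ev Y) G).hom ≫
      Limits.Pi.map (fun s => (G s).obj.map g.op) ≫ (PreservesProduct.iso (ev Z) G).inv := by
    rw [← Category.assoc, Iso.eq_comp_inv]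
    exact h2
  have h4 : IsIso ((∏ᶜ G).obj.map g.op) := by
    rw [h3]
    infer_instance
  exact h4

variable (J') in
-- The fiber of a terminal object at a point is a singleton. The fiber of `F.obj X'` at `q` is the
-- fiber of `X'` at the inverse image of `q`, hence a singleton too, even where `F.obj X'` is not
-- terminal.
lemma isIso_fiber_map (F : C' ⥤ C) [F.IsContinuous J' J]
    [PreservesFiniteLimits (F.sheafPullback (Type u) J' J)] (q : GrothendieckTopology.Point.{u} J)
    {X : C} (hX : IsTerminal X) {X' : C'} (hX' : IsTerminal X') (g : F.obj X' ⟶ X) :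
    IsIso (q.fiber.map g) :=
  isIso_of_isTerminal ((comapPoint (J' := J') F q).isTerminalFiberObj X' hX') (q.isTerminalFiberObj X hX) _

end terminal
-- Normalized cochains as the image of the Dold–Kan projection.
section normalized
variable {k : Type u} [Field k]

/-- The signs that identify the differential of the normalized complex with the alternating sum of
the cofaces. -/
def eps (k : Type u) [CommRing k] : ℕ → k
  | 0 => 1
  | n + 1 => sgn k (n + 1) * eps k n

lemma eps_mul_self (n : ℕ) : eps k n * eps k n = 1 := by
  induction n with
  | zero => simp [eps]
  | succ n ih =>
    rw [eps, mul_mul_mul_comm, ih, sgn_mul_self, mul_one]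

variable (A : SimplexCategory ⥤ CommAlgCat.{u} k)

/-- The value on the top face. -/
def topEval (n : ℕ) : NC A n →ₗ[k] lev A n where
  toFun a := a.1 n (topFace n)
  map_add' _ _ := rfl
  map_smul' _ _ := rfl

variable {A}

lemma levMap_topEval {n l : ℕ} (a : NC A n) (θ : Fin (n + 1) →o Fin (l + 1))
    (hθ : Function.Injective θ) (s : Face l) (hs : Finset.univ.image θ = s.1) :
    levMap A θ (topEval A n a) = a.1 l s := by
  refine (a.2.2 n l θ (topFace n)).trans ?_
  rw [mact, Finset.sum_eq_single s]
  · rw [push_top, if_pos ⟨hθ, hs⟩, one_smul]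
  · intro y _ hy
    rw [push_top, if_neg fun h => hy (Subtype.ext (h.2.symm.trans hs)), zero_smul]
  · simp

/-- The facets of the top face are the images of the cofaces, and the value of a cochain on a facet
is the coface applied to its top value. -/
lemma topEval_diff {n : ℕ} (a : NC A n) :
    topEval A (n + 1) (NC.diff (e := n) (e' := (n + 1 : ℕ)) rfl a) =
      sgn k (n + 1) • ∑ i : Fin (n + 2), sgn k (i : ℕ) •
        levMap A (SimplexCategory.δ i).toOrderHom (topEval A n a) := by
  classical
  change sgn k (n + 1) • mact (bdry k) (a.1 (n + 1)) (topFace (n + 1)) = _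
  congr 1
  have he (v : Fin (n + 2)) : ((Finset.univ : Finset (Fin (n + 2))).erase v).Nonempty := by
    refine Finset.card_pos.1 ?_
    rw [Finset.card_erase_of_mem (Finset.mem_univ v)]
    simp
  simp only [mact, bdry, Finset.sum_smul]
  rw [Finset.sum_comm]
  refine Finset.sum_congr rfl fun v _ => ?_
  rw [Finset.sum_eq_single ⟨_, he v⟩]
  · rw [topFace, if_pos rfl]
    congr 1
    · congr 1
      -- The sign in the boundary counts the vertices below `v`, of which there are `v`.
      have : (Finset.univ.filter (· < v)) = Finset.Iio v := by ext; simp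
      rw [this, Fin.card_Iio]
    · refine (levMap_topEval a _ ?_ _ ?_).symm
      · exact SimplexCategory.mono_iff_injective.1 inferInstance
      · exact (Fin.image_succAbove_univ v).trans (by ext; simp)
  · intro b _ hb
    rw [if_neg fun h => hb (Subtype.ext h.symm), zero_smul]
  · simp

/-- Faces are nonempty, so none has negative dimension. -/
lemma subsingleton_NC {e : ℤ} (he : e < 0) : Subsingleton (NC A e) := by
  have h (a : NC A e) : a = 0 := Subtype.ext <| funext fun m => funext fun s => by
    by_contra h
    have h1 := a.2.1 m s h
    have := Finset.card_pos.2 s.2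
    simp only [fdeg] at h1
    omega
  exact ⟨fun a b => (h a).trans (h b).symm⟩

lemma topEval_injective (n : ℕ) : Function.Injective (topEval A n) := fun a b h => NC.ext_top A n a b h

/-- The image of the projection is killed by all codegeneracies, and `NC.exists_top_iff` says that
such elements are top values of cochains. -/
lemma exists_topEval_eq_coProj (n : ℕ) (x : lev A n) :
    ∃ a : NC A n, topEval A n a = ((coProj (A ⋙ algToMod k)).f n).hom x := by
  refine (NC.exists_top_iff A n _).2 fun l θ hθ => ?_
  have h := coProj_comp_map (A ⋙ algToMod k) n (SimplexCategory.mkHom θ)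
    (fun h => hθ (SimplexCategory.mono_iff_injective.1 h))
  exact congrArg (fun f => f.hom x) h

/-- The projection to the normalized complex. -/
noncomputable def normLift (n : ℕ) : lev A n →ₗ[k] NC A n where
  toFun x := (exists_topEval_eq_coProj n x).choose
  map_add' x y := topEval_injective n (by
    rw [map_add, (exists_topEval_eq_coProj n x).choose_spec,
      (exists_topEval_eq_coProj n y).choose_spec, (exists_topEval_eq_coProj n (x + y)).choose_spec]
    exact map_add ((coProj (A ⋙ algToMod k)).f n).hom x y)
  map_smul' c x := topEval_injective n (by
    rw [RingHom.id_apply, map_smul, (exists_topEval_eq_coProj n x).choose_spec,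
      (exists_topEval_eq_coProj n (c • x)).choose_spec]
    exact map_smul ((coProj (A ⋙ algToMod k)).f n).hom c x)

lemma topEval_normLift (n : ℕ) (x : lev A n) :
    topEval A n (normLift n x) = ((coProj (A ⋙ algToMod k)).f n).hom x :=
  (exists_topEval_eq_coProj n x).choose_spec

/-- Top values of cochains are killed by the codegeneracies, so the projection fixes them. -/
lemma normLift_topEval (n : ℕ) (a : NC A n) : normLift n (topEval A n a) = a := by
  refine topEval_injective n ((topEval_normLift n _).trans ?_)
  have h := comp_coProj (A ⋙ algToMod k) n (ModuleCat.ofHom (topEval A n)) (fun {m} θ hθ => by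
    refine ModuleCat.hom_ext (LinearMap.ext fun a => ?_)
    refine (NC.exists_top_iff A n (topEval A n a)).1 ⟨a, rfl⟩ m θ.toOrderHom ?_
    exact fun h => hθ (SimplexCategory.mono_iff_injective.2 h))
  exact congrArg (fun f => f.hom a) h

end normalized
-- Complexes of sections, and extension by zero to negative degrees.
section sections
variable {k : Type u} [Field k] {C : Type u} [SmallCategory C] {J : GrothendieckTopology C}

/-- The maps on sections given by a map of complexes of sheaves. -/
def sectionsMap {I I' : CochainComplex (Sheaf J (ModuleCat.{u} k)) ℤ} (f : I ⟶ I') :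
    sectionsComplex I ⟶ sectionsComplex I' where
  app U :=
    { f i := (f.f i).hom.app U
      comm' i j _ := congrArg (fun g : I.X i ⟶ I'.X j => g.hom.app U) (f.comm i j) }
  naturality U V g := by
    ext i : 1
    exact (f.f i).hom.naturality g

/-- The map of complexes of sheaves given by maps on sections. -/
def ofSections {I I' : CochainComplex (Sheaf J (ModuleCat.{u} k)) ℤ}
    (f : sectionsComplex I ⟶ sectionsComplex I') : I ⟶ I' where
  f i := ⟨{ app U := (f.app U).f i
            naturality U V g := congrArg (fun t => t.f i) (f.naturality g) }⟩
  comm' i j _ := by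
    ext U : 3
    exact (f.app U).comm i j

/-- Sections of sheaves of modules over an object. -/
def sectionsAt (k : Type u) [Field k] (J : GrothendieckTopology C) (U : Cᵒᵖ) :
    Sheaf J (ModuleCat.{u} k) ⥤ ModuleCat.{u} k :=
  sheafToPresheaf J _ ⋙ (evaluation Cᵒᵖ _).obj U

instance (U : Cᵒᵖ) : (sectionsAt k J U).Additive where
  map_add := rfl

/-- Homotopic maps of complexes of sheaves give homotopic maps on sections. -/
def sectionsHomotopy {I I' : CochainComplex (Sheaf J (ModuleCat.{u} k)) ℤ} {f g : I ⟶ I'}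
    (h : Homotopy f g) (U : Cᵒᵖ) : Homotopy ((sectionsMap f).app U) ((sectionsMap g).app U) :=
  (sectionsAt k J U).mapHomotopy h

/-- Sections are additive but not exact, so a homotopy equivalence is required here and not merely a
quasi-isomorphism of complexes of sheaves. -/
lemma quasiIso_sections {I I' : CochainComplex (Sheaf J (ModuleCat.{u} k)) ℤ} (f : I ⟶ I')
    (hf : HomologicalComplex.homotopyEquivalences _ _ f) (U : Cᵒᵖ) :
    QuasiIso ((sectionsMap f).app U) := by
  obtain ⟨e, rfl⟩ := hf
  exact ((sectionsAt k J U).mapHomotopyEquiv e).quasiIso_hom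

section extension
variable (L : CochainComplex (Sheaf J (ModuleCat.{u} k)) ℕ)

/-- The extension of a complex in nonnegative degrees by zero. -/
noncomputable abbrev ext0 : CochainComplex (Sheaf J (ModuleCat.{u} k)) ℤ :=
  L.extend ComplexShape.embeddingUpNat

/-- The components of `ext0` in nonnegative degrees. -/
noncomputable def ext0XIso (n : ℕ) : (ext0 L).X (n : ℤ) ≅ L.X n :=
  L.extendXIso ComplexShape.embeddingUpNat rfl

lemma ext0XIso_inv_d (n : ℕ) : (ext0XIso L n).inv ≫ (ext0 L).d n (n + 1 : ℕ) =
    L.d n (n + 1) ≫ (ext0XIso L (n + 1)).inv := by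
  rw [Iso.inv_comp_eq]
  exact L.extend_d_eq ComplexShape.embeddingUpNat rfl rfl

lemma ext0_d_hom (n : ℕ) : (ext0 L).d n (n + 1 : ℕ) ≫ (ext0XIso L (n + 1)).hom =
    (ext0XIso L n).hom ≫ L.d n (n + 1) := by
  rw [← Iso.eq_comp_inv, Category.assoc]
  exact L.extend_d_eq ComplexShape.embeddingUpNat rfl rfl

lemma isZero_ext0 (n : ℕ) : IsZero ((ext0 L).X (Int.negSucc n)) :=
  L.isZero_extend_X ComplexShape.embeddingUpNat _ (fun i h => by
    have : (i : ℤ) = Int.negSucc n := h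
    omega)

variable {L} {N : Cᵒᵖ ⥤ CochainComplex (ModuleCat.{u} k) ℤ}

/-- Maps to the sections of an extension by zero. -/
noncomputable def toExt0 (hN : ∀ U n, IsZero ((N.obj U).X (Int.negSucc n)))
    (t : ∀ U (n : ℕ), (N.obj U).X n ⟶ (L.X n).obj.obj U)
    (ht : ∀ U (n : ℕ), (N.obj U).d n (n + 1 : ℕ) ≫ t U (n + 1) = t U n ≫ (L.d n (n + 1)).hom.app U)
    (hn : ∀ {U V} (g : U ⟶ V) (n : ℕ), (N.map g).f n ≫ t V n = t U n ≫ (L.X n).obj.map g) :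
    N ⟶ sectionsComplex (ext0 L) where
  app U :=
    { f
      | Int.ofNat n => t U n ≫ (ext0XIso L n).inv.hom.app U
      | Int.negSucc n => 0
      comm' i j hij := by
        obtain rfl : i + 1 = j := hij
        cases i with
        | ofNat n =>
          have h := congrArg (fun g => g.hom.app U) (ext0XIso_inv_d L n)
          refine (Category.assoc _ _ _).trans ((congrArg (t U n ≫ ·) h).trans ?_)
          refine (Category.assoc _ _ _).symm.trans ?_
          refine (congrArg (· ≫ (ext0XIso L (n + 1)).inv.hom.app U) (ht U n).symm).trans ?_
          exact Category.assoc _ _ _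
        | negSucc n => exact (hN U n).eq_of_src _ _ }
  naturality U V g := by
    ext i : 1
    cases i with
    | ofNat n =>
      refine (Category.assoc _ _ _).symm.trans ?_
      refine (congrArg (· ≫ (ext0XIso L n).inv.hom.app V) (hn g n)).trans ?_
      refine (Category.assoc _ _ _).trans ?_
      refine Eq.trans ?_ (Category.assoc _ _ _).symm
      exact congrArg (t U n ≫ ·) ((ext0XIso L n).inv.hom.naturality g)
    | negSucc n => exact (hN U n).eq_of_src _ _

/-- Maps from the sections of an extension by zero. -/
noncomputable def ofExt0 (t : ∀ U (n : ℕ), (L.X n).obj.obj U ⟶ (N.obj U).X n)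
    (ht : ∀ U (n : ℕ), (L.d n (n + 1)).hom.app U ≫ t U (n + 1) = t U n ≫ (N.obj U).d n (n + 1 : ℕ))
    (hn : ∀ {U V} (g : U ⟶ V) (n : ℕ), (L.X n).obj.map g ≫ t V n = t U n ≫ (N.map g).f n) :
    sectionsComplex (ext0 L) ⟶ N where
  app U :=
    { f
      | Int.ofNat n => (ext0XIso L n).hom.hom.app U ≫ t U n
      | Int.negSucc n => 0
      comm' i j hij := by
        obtain rfl : i + 1 = j := hij
        cases i with
        | ofNat n =>
          have h := congrArg (fun g => g.hom.app U) (ext0_d_hom L n)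
          refine (Category.assoc _ _ _).trans
            ((congrArg ((ext0XIso L n).hom.hom.app U ≫ ·) (ht U n).symm).trans ?_)
          refine (Category.assoc _ _ _).symm.trans ?_
          refine (congrArg (· ≫ t U (n + 1)) h.symm).trans ?_
          exact Category.assoc _ _ _
        | negSucc n => exact ((sectionsAt k J U).map_isZero (isZero_ext0 L n)).eq_of_src _ _ }
  naturality U V g := by
    ext i : 1
    cases i with
    | ofNat n =>
      refine (Category.assoc _ _ _).symm.trans ?_
      refine (congrArg (· ≫ t V n) ((ext0XIso L n).hom.hom.naturality g)).trans ?_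
      refine (Category.assoc _ _ _).trans ?_
      refine Eq.trans ?_ (Category.assoc _ _ _).symm
      exact congrArg ((ext0XIso L n).hom.hom.app U ≫ ·) (hn g n)
    | negSucc n => exact ((sectionsAt k J U).map_isZero (isZero_ext0 L n)).eq_of_src _ _

end extension

end sections
-- The normalized complex of sections against the alternating coface complex.
section comparisonMaps
open Simplicial
variable {k : Type u} [Field k] {C : Type u} [SmallCategory C] {J : GrothendieckTopology C}

/-- The cosimplicial algebras of sections of a cosimplicial sheaf of algebras. -/
noncomputable abbrev secAlg (K : SimplexCategory ⥤ Sheaf J (CommAlgCat.{u} k)) :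
    Cᵒᵖ ⥤ SimplexCategory ⥤ CommAlgCat.{u} k := (K ⋙ sheafToPresheaf J _).flip

/-- The normalized complexes of sections of a cosimplicial sheaf of algebras. -/
noncomputable abbrev secN (K : SimplexCategory ⥤ Sheaf J (CommAlgCat.{u} k)) :
    Cᵒᵖ ⥤ CochainComplex (ModuleCat.{u} k) ℤ :=
  secAlg K ⋙ NC.functor k ⋙ DGOperad.Alg.forget (ezOperad k)

/-- The map of normalized complexes of sections given by a map of cosimplicial sheaves. -/
noncomputable abbrev secNMap {K K' : SimplexCategory ⥤ Sheaf J (CommAlgCat.{u} k)} (f : K ⟶ K') :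
    secN K ⟶ secN K' :=
  Functor.whiskerRight ((flipFunctor _ _ _).map (Functor.whiskerRight f (sheafToPresheaf J _)))
    (NC.functor k ⋙ DGOperad.Alg.forget (ezOperad k))

lemma sgn_smul {M : Type*} [AddCommGroup M] [Module k M] (i : ℕ) (x : M) :
    sgn k (i : ℤ) • x = (-1 : ℤ) ^ i • x := by
  rw [sgn, Int.cast_smul_eq_zsmul, Int.negOnePow_def]
  simp

lemma map_alternatingSum {𝒟 ℰ : Type*} [Category 𝒟] [Category ℰ] [Preadditive 𝒟] [Preadditive ℰ]
    (F : 𝒟 ⥤ ℰ) [F.Additive] {X Y : 𝒟} {n : ℕ} (f : Fin n → (X ⟶ Y)) :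
    F.map (∑ i : Fin n, (-1 : ℤ) ^ (i : ℕ) • f i) = ∑ i : Fin n, (-1 : ℤ) ^ (i : ℕ) • F.map (f i) := by
  rw [Functor.map_sum]
  exact Finset.sum_congr rfl fun i _ => Functor.map_zsmul _

lemma alternatingSum_apply {M N : ModuleCat.{u} k} {n : ℕ} (f : Fin n → (M ⟶ N)) (x : M) :
    (∑ i : Fin n, (-1 : ℤ) ^ (i : ℕ) • f i).hom x = ∑ i : Fin n, sgn k (i : ℕ) • (f i).hom x := by
  rw [ModuleCat.hom_sum, LinearMap.sum_apply]
  refine Finset.sum_congr rfl fun i _ => ?_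
  rw [sgn_smul]
  rfl

variable (K : SimplexCategory ⥤ Sheaf J (CommAlgCat.{u} k))

lemma modCo_d_apply (U : Cᵒᵖ) (n : ℕ) (x : lev ((secAlg K).obj U) n) :
    (((modCo K).d n (n + 1)).hom.app U).hom x =
      ∑ i : Fin (n + 2), sgn k (i : ℕ) •
        levMap ((secAlg K).obj U) (SimplexCategory.δ i).toOrderHom x := by
  have h : (sectionsAt k J U).map ((modCo K).d n (n + 1)) = ∑ i : Fin (n + 2),
      (-1 : ℤ) ^ (i : ℕ) • (sectionsAt k J U).map
        ((K ⋙ sheafCompose J (algToMod k)).map (SimplexCategory.δ i)) :=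
    (congrArg (sectionsAt k J U).map (coAlt_d _ n)).trans (map_alternatingSum _ _)
  exact (congrArg (fun f => f.hom x) h).trans (alternatingSum_apply
    (fun i => (sectionsAt k J U).map ((K ⋙ sheafCompose J (algToMod k)).map (SimplexCategory.δ i))) x)

/-- The signed value on the top face. -/
noncomputable def thetaTop (U : Cᵒᵖ) (n : ℕ) :
    ((secN K).obj U).X n ⟶ ((modCo K).X n).obj.obj U :=
  ModuleCat.ofHom (eps k n • topEval ((secAlg K).obj U) n)

/-- The signed projection to the normalized complex. -/
noncomputable def rhoTop (U : Cᵒᵖ) (n : ℕ) :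
    ((modCo K).X n).obj.obj U ⟶ ((secN K).obj U).X n :=
  ModuleCat.ofHom (eps k n • normLift (A := (secAlg K).obj U) n)

lemma thetaTop_apply (U : Cᵒᵖ) (n : ℕ) (a : NC ((secAlg K).obj U) n) :
    (thetaTop K U n).hom a = eps k n • topEval ((secAlg K).obj U) n a := rfl

/-- The differential of the normalized complex carries the additional sign `(-1)^(n+1)`; the
recursion for `eps` absorbs it. -/
lemma d_thetaTop (U : Cᵒᵖ) (n : ℕ) : ((secN K).obj U).d n (n + 1 : ℕ) ≫ thetaTop K U (n + 1) =
    thetaTop K U n ≫ ((modCo K).d n (n + 1)).hom.app U := by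
  refine ModuleCat.hom_ext (LinearMap.ext fun a => ?_)
  have h1 : ((secN K).obj U).d n (n + 1 : ℕ) a = NC.diff (e := n) (e' := (n + 1 : ℕ)) rfl a :=
    NC.complex_d (A := (secAlg K).obj U) (n : ℤ) a
  have h2 (a : NC ((secAlg K).obj U) n) : eps k (n + 1) • topEval ((secAlg K).obj U) (n + 1)
      (NC.diff (e := n) (e' := (n + 1 : ℕ)) rfl a) = eps k n • ∑ i : Fin (n + 2), sgn k (i : ℕ) •
        levMap ((secAlg K).obj U) (SimplexCategory.δ i).toOrderHom (topEval _ n a) := by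
    rw [topEval_diff, smul_smul, eps, mul_right_comm, sgn_mul_self, one_mul]
  refine (congrArg (thetaTop K U (n + 1)).hom h1).trans ((h2 a).trans ?_)
  refine Eq.trans ?_ (map_smul ((((modCo K).d n (n + 1)).hom.app U).hom) (eps k n)
    (topEval _ n a)).symm
  exact congrArg (eps k n • ·) (modCo_d_apply K U n (topEval _ n a)).symm

lemma thetaTop_naturality {U V : Cᵒᵖ} (g : U ⟶ V) (n : ℕ) :
    ((secN K).map g).f n ≫ thetaTop K V n = thetaTop K U n ≫ ((modCo K).X n).obj.map g := by
  refine ModuleCat.hom_ext (LinearMap.ext fun a => ?_)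
  exact (map_smul (((modCo K).X n).obj.map g).hom (eps k n) (topEval _ n a)).symm

lemma thetaTop_rhoTop (U : Cᵒᵖ) (n : ℕ) : thetaTop K U n ≫ rhoTop K U n = 𝟙 _ := by
  have h (a : NC ((secAlg K).obj U) n) :
      eps k n • normLift (A := (secAlg K).obj U) n (eps k n • topEval _ n a) = a := by
    rw [map_smul, smul_smul, eps_mul_self, one_smul, normLift_topEval]
  exact ModuleCat.hom_ext (LinearMap.ext h)

/-- With `thetaTop_rhoTop`, this splits the idempotent `coProj` on sections with the normalized
complex as its image. The signs cancel because `eps` squares to `1`. -/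
lemma rhoTop_thetaTop (U : Cᵒᵖ) (n : ℕ) : rhoTop K U n ≫ thetaTop K U n =
    ((coProj (K ⋙ sheafCompose J (algToMod k))).f n).hom.app U := by
  refine ModuleCat.hom_ext (LinearMap.ext fun x => ?_)
  have h1 (x : lev ((secAlg K).obj U) n) :
      eps k n • topEval ((secAlg K).obj U) n (eps k n • normLift n x) =
      ((coProj ((secAlg K).obj U ⋙ algToMod k)).f n).hom x := by
    rw [map_smul, smul_smul, eps_mul_self, one_smul, topEval_normLift]
  refine Eq.trans (h1 x) ?_
  have h2 := map_coProj (sectionsAt k J U) (K ⋙ sheafCompose J (algToMod k)) n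
  exact congrArg (fun f => f.hom x) h2.symm

lemma mono_thetaTop (U : Cᵒᵖ) (n : ℕ) : Mono (thetaTop K U n) :=
  have : Mono (thetaTop K U n ≫ rhoTop K U n) := by
    rw [thetaTop_rhoTop]
    infer_instance
  mono_of_mono _ (rhoTop K U n)

/-- After composition with the monomorphism `thetaTop`, this says that the Dold–Kan projection is a
map of complexes. -/
lemma d_rhoTop (U : Cᵒᵖ) (n : ℕ) : ((modCo K).d n (n + 1)).hom.app U ≫ rhoTop K U (n + 1) =
    rhoTop K U n ≫ ((secN K).obj U).d n (n + 1 : ℕ) := by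
  have := mono_thetaTop K U (n + 1)
  rw [← cancel_mono (thetaTop K U (n + 1)), Category.assoc, Category.assoc, rhoTop_thetaTop,
    d_thetaTop, ← Category.assoc (rhoTop K U n), rhoTop_thetaTop]
  exact congrArg (fun g => g.hom.app U)
    ((coProj (K ⋙ sheafCompose J (algToMod k))).comm n (n + 1)).symm

lemma rhoTop_naturality {U V : Cᵒᵖ} (g : U ⟶ V) (n : ℕ) :
    ((modCo K).X n).obj.map g ≫ rhoTop K V n = rhoTop K U n ≫ ((secN K).map g).f n := by
  have := mono_thetaTop K V n
  rw [← cancel_mono (thetaTop K V n), Category.assoc, Category.assoc, rhoTop_thetaTop,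
    thetaTop_naturality, ← Category.assoc (rhoTop K U n), rhoTop_thetaTop]
  exact ((coProj (K ⋙ sheafCompose J (algToMod k))).f n).hom.naturality g

lemma isZero_secN (U : Cᵒᵖ) (n : ℕ) : IsZero (((secN K).obj U).X (Int.negSucc n)) :=
  have := subsingleton_NC (A := (secAlg K).obj U) (e := Int.negSucc n) (Int.negSucc_lt_zero n)
  ModuleCat.isZero_of_subsingleton (ModuleCat.of k (NC ((secAlg K).obj U) (Int.negSucc n)))

/-- The map from the normalized complexes of sections to the alternating coface complex. -/
noncomputable def theta : secN K ⟶ sectionsComplex (ext0 (modCo K)) :=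
  toExt0 (isZero_secN K) (thetaTop K) (d_thetaTop K) (thetaTop_naturality K)

/-- The map from the alternating coface complex to the normalized complexes of sections. -/
noncomputable def rho : sectionsComplex (ext0 (modCo K)) ⟶ secN K :=
  ofExt0 (rhoTop K) (d_rhoTop K) (rhoTop_naturality K)

lemma theta_rho : theta K ≫ rho K = 𝟙 _ := by
  ext U i : 3
  cases i with
  | ofNat n =>
    have h : (ext0XIso (modCo K) n).inv.hom.app U ≫ (ext0XIso (modCo K) n).hom.hom.app U = 𝟙 _ :=
      congrArg (fun g => g.hom.app U) (ext0XIso (modCo K) n).inv_hom_id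
    refine Eq.trans ?_ (thetaTop_rhoTop K U n)
    refine (Category.assoc _ _ _).trans (congrArg (thetaTop K U n ≫ ·) ?_)
    refine (Category.assoc _ _ _).symm.trans ?_
    exact (congrArg (· ≫ rhoTop K U n) h).trans (Category.id_comp _)
  | negSucc n => exact (isZero_secN K U n).eq_of_src _ _

lemma rho_theta : rho K ≫ theta K = sectionsMap (HomologicalComplex.extendMap
    (coProj (K ⋙ sheafCompose J (algToMod k))) ComplexShape.embeddingUpNat) := by
  ext U i : 3
  cases i with
  | ofNat n =>
    have h := congrArg (fun g => g.hom.app U) (HomologicalComplex.extendMap_f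
      (coProj (K ⋙ sheafCompose J (algToMod k))) ComplexShape.embeddingUpNat
      (i := n) (i' := (n : ℤ)) rfl)
    refine Eq.trans ?_ h.symm
    refine (Category.assoc _ _ _).trans (congrArg ((ext0XIso (modCo K) n).hom.hom.app U ≫ ·) ?_)
    refine (Category.assoc _ _ _).symm.trans ?_
    exact congrArg (· ≫ (ext0XIso (modCo K) n).inv.hom.app U) (rhoTop_thetaTop K U n)
  | negSucc n => exact ((sectionsAt k J U).map_isZero (isZero_ext0 _ n)).eq_of_src _ _

/-- On sections, the normalized complex and the alternating coface complex are homotopy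
equivalent. -/
noncomputable def thetaEquiv (U : Cᵒᵖ) :
    HomotopyEquiv ((secN K).obj U) ((sectionsComplex (ext0 (modCo K))).obj U) where
  hom := (theta K).app U
  inv := (rho K).app U
  homotopyHomInvId := Homotopy.ofEq (NatTrans.congr_app (theta_rho K) U)
  -- This composite is the Dold–Kan projection, which is homotopic to the identity already as a map
  -- of complexes of sheaves.
  homotopyInvHomId := (Homotopy.ofEq (NatTrans.congr_app (rho_theta K) U)).trans
    ((sectionsHomotopy ((coProjHomotopy _).extend ComplexShape.embeddingUpNat) U).trans
      (Homotopy.ofEq (by rw [HomologicalComplex.extendMap_id]; rfl)))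

instance quasiIso_theta (U : Cᵒᵖ) : QuasiIso ((theta K).app U) := (thetaEquiv K U).quasiIso_hom

instance quasiIso_rho (U : Cᵒᵖ) : QuasiIso ((rho K).app U) := (thetaEquiv K U).quasiIso_inv

variable {K} in
lemma theta_naturality {K' : SimplexCategory ⥤ Sheaf J (CommAlgCat.{u} k)} (f : K ⟶ K') :
    theta K ≫ sectionsMap (HomologicalComplex.extendMap (modCoMap f) ComplexShape.embeddingUpNat) =
      secNMap f ≫ theta K' := by
  ext U i : 3
  cases i with
  | ofNat n =>
    have h := HomologicalComplex.extendMap_f (modCoMap f) ComplexShape.embeddingUpNat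
      (i := n) (i' := (n : ℤ)) rfl
    have h' : (ext0XIso (modCo K) n).inv ≫ (HomologicalComplex.extendMap (modCoMap f)
        ComplexShape.embeddingUpNat).f n = (modCoMap f).f n ≫ (ext0XIso (modCo K') n).inv := by
      rw [Iso.inv_comp_eq]
      exact h
    refine (Category.assoc _ _ _).trans
      ((congrArg (thetaTop K U n ≫ ·) (congrArg (fun g => g.hom.app U) h')).trans ?_)
    refine (Category.assoc _ _ _).symm.trans ?_
    refine Eq.trans ?_ (Category.assoc _ _ _)
    refine congrArg (· ≫ (ext0XIso (modCo K') n).inv.hom.app U) ?_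
    refine ModuleCat.hom_ext (LinearMap.ext fun a => ?_)
    exact map_smul (((modCoMap f).f n).hom.app U).hom (eps k n) (topEval _ n a)
  | negSucc n => exact (isZero_secN K U n).eq_of_src _ _

end comparisonMaps
-- Maps into K-injective complexes.
section kinjective
variable {𝒟 : Type*} [Category 𝒟] [Abelian 𝒟]

lemma isIso_Qh_map [HasDerivedCategory 𝒟] {A B : CochainComplex 𝒟 ℤ} (s : A ⟶ B) [QuasiIso s] :
    IsIso (DerivedCategory.Qh.map ((HomotopyCategory.quotient _ _).map s)) :=
  (NatIso.isIso_map_iff (DerivedCategory.quotientCompQhIso 𝒟) s).2 inferInstance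

/-- Homotopy classes of maps to a K-injective complex are morphisms of the derived category, where
the quasi-isomorphism `s` can be cancelled. -/
lemma homotopic_of_quasiIso {A B L : CochainComplex 𝒟 ℤ} (s : A ⟶ B) [QuasiIso s]
    [L.IsKInjective] (g h : B ⟶ L) (H : Nonempty (Homotopy (s ≫ g) (s ≫ h))) :
    Nonempty (Homotopy g h) := by
  let := HasDerivedCategory.standard 𝒟
  have := isIso_Qh_map s
  obtain ⟨H⟩ := H
  refine ⟨HomotopyCategory.homotopyOfEq _ _
    ((CochainComplex.IsKInjective.Qh_map_bijective _ L).injective ?_)⟩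
  rw [← cancel_epi (DerivedCategory.Qh.map ((HomotopyCategory.quotient _ _).map s)),
    ← Functor.map_comp, ← Functor.map_comp, ← Functor.map_comp, ← Functor.map_comp,
    HomotopyCategory.eq_of_homotopy _ _ H]

/-- The morphism `s⁻¹ a` of the derived category is represented by a map of complexes because the
target is K-injective. -/
lemma exists_extension_of_quasiIso {A B L : CochainComplex 𝒟 ℤ} (s : A ⟶ B) [QuasiIso s]
    [L.IsKInjective] (a : A ⟶ L) : ∃ g : B ⟶ L, Nonempty (Homotopy (s ≫ g) a) := by
  let := HasDerivedCategory.standard 𝒟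
  have := isIso_Qh_map s
  obtain ⟨γ, hγ⟩ := (CochainComplex.IsKInjective.Qh_map_bijective
    ((HomotopyCategory.quotient _ _).obj B) L).surjective
    (inv (DerivedCategory.Qh.map ((HomotopyCategory.quotient _ _).map s)) ≫
      DerivedCategory.Qh.map ((HomotopyCategory.quotient _ _).map a))
  obtain ⟨g, rfl⟩ := (HomotopyCategory.quotient _ _).map_surjective γ
  refine ⟨g, ⟨HomotopyCategory.homotopyOfEq _ _
    ((CochainComplex.IsKInjective.Qh_map_bijective _ L).injective ?_)⟩⟩
  rw [Functor.map_comp, Functor.map_comp, hγ, IsIso.hom_inv_id_assoc]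

/-- Both terms of the homotopy vanish in degree `0`: the source has zero differential and the target
is zero in degree `-1`. Thus extensions that exist up to homotopy are strictly compatible with
augmentations. -/
lemma f_zero_eq_of_homotopy_single {Z : 𝒟} {L : CochainComplex 𝒟 ℤ} [L.IsStrictlyGE 0]
    {f g : (CochainComplex.singleFunctor 𝒟 0).obj Z ⟶ L} (h : Homotopy f g) : f.f 0 = g.f 0 := by
  have h1 := h.comm 0
  have h2 : ((CochainComplex.singleFunctor 𝒟 0).obj Z).d 0 1 = 0 :=
    HomologicalComplex.single_obj_d _ _ _ _ _
  rw [dNext_eq _ (show (ComplexShape.up ℤ).Rel 0 1 by simp),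
    prevD_eq _ (show (ComplexShape.up ℤ).Rel (-1) 0 by simp), h2, zero_comp,
    (L.isZero_of_isStrictlyGE 0 (-1)).eq_of_tgt (h.hom 0 (-1)) 0, zero_comp, zero_add, zero_add] at h1
  exact h1

end kinjective

/-! ### Augmentations of injective resolutions. -/

section resolution
variable {k : Type u} [Field k] {C : Type u} [SmallCategory C] {J : GrothendieckTopology C}
  {Z : Sheaf J (ModuleCat.{u} k)} (R : InjectiveResolution Z)

/-- The component in degree `0` of a complex concentrated in degree `0`. -/
noncomputable def singleZeroIso (Z : Sheaf J (ModuleCat.{u} k)) :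
    ((CochainComplex.singleFunctor _ 0).obj Z).X 0 ≅ Z :=
  HomologicalComplex.singleObjXSelf (.up ℤ) 0 Z

lemma ι'_f_zero_eq_injAug :
    R.ι'.f 0 = (singleZeroIso Z).hom ≫ injAug R := by
  rw [R.ι'_f_zero, injAug]
  congr 1

lemma injAug_d : injAug R ≫ R.cochainComplex.d 0 1 = 0 := by
  have h := R.ι'.comm 0 1
  have h2 : ((CochainComplex.singleFunctor (Sheaf J (ModuleCat.{u} k)) 0).obj Z).d 0 1 = 0 :=
    HomologicalComplex.single_obj_d _ _ _ _ _
  rw [h2, zero_comp, ι'_f_zero_eq_injAug, Category.assoc] at h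
  exact (cancel_epi (singleZeroIso Z).hom).1 (h.trans comp_zero.symm)

variable {R} {L : CochainComplex (Sheaf J (ModuleCat.{u} k)) ℤ}

lemma ι'_comp_eq {B : CochainComplex (Sheaf J (ModuleCat.{u} k)) ℤ}
    {f g : (CochainComplex.singleFunctor _ 0).obj Z ⟶ B} (h : f.f 0 = g.f 0) : f = g :=
  HomologicalComplex.from_single_hom_ext h

/-- The map given by `z` extends along the quasi-isomorphism `ι'` up to homotopy, and on a complex
concentrated in degree `0` the homotopy is an equality. -/
lemma exists_lift_of_injAug [L.IsKInjective] [L.IsStrictlyGE 0] (z : Z ⟶ L.X 0)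
    (hz : z ≫ L.d 0 1 = 0) : ∃ g : R.cochainComplex ⟶ L, injAug R ≫ g.f 0 = z := by
  let a : (CochainComplex.singleFunctor _ 0).obj Z ⟶ L :=
    HomologicalComplex.mkHomFromSingle z (by
      intro i hi
      obtain rfl : 0 + 1 = i := hi
      exact hz)
  obtain ⟨g, ⟨hg⟩⟩ := exists_extension_of_quasiIso R.ι' a
  refine ⟨g, ?_⟩
  have h := f_zero_eq_of_homotopy_single hg
  rw [HomologicalComplex.comp_f, ι'_f_zero_eq_injAug, Category.assoc] at h
  exact (cancel_epi (singleZeroIso Z).hom).1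
    (h.trans (HomologicalComplex.mkHomFromSingle_f z _))

/-- A map under `Z` between two resolutions is a quasi-isomorphism, and between K-injective
complexes quasi-isomorphisms are homotopy equivalences. -/
lemma quasiIso_of_injAug {R' : InjectiveResolution Z} (g : R.cochainComplex ⟶ R'.cochainComplex)
    (h : injAug R ≫ g.f 0 = injAug R') :
    HomologicalComplex.homotopyEquivalences _ _ g := by
  have h1 : R.ι' ≫ g = R'.ι' := ι'_comp_eq (by
    rw [HomologicalComplex.comp_f, ι'_f_zero_eq_injAug, ι'_f_zero_eq_injAug, Category.assoc, h])
  have i1 : R.cochainComplex.IsKInjective := CochainComplex.isKInjective_of_injective _ 0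
  have i2 : R'.cochainComplex.IsKInjective := CochainComplex.isKInjective_of_injective _ 0
  refine (CochainComplex.IsKInjective.quasiIso_iff g).1 ?_
  refine (quasiIso_iff_comp_left R.ι' g).1 ?_
  rw [h1]
  infer_instance

end resolution
-- Compatibility of the Dold–Kan comparison with coaugmentations.
section augmentation
variable {k : Type u} [Field k] {C : Type u} [SmallCategory C] {J : GrothendieckTopology C}
  {K : SimplexCategory ⥤ Sheaf J (CommAlgCat.{u} k)} {O : Sheaf J (CommAlgCat.{u} k)}

/-- The map to the alternating coface complex given by a coaugmentation. -/
noncomputable def modCoAug (f : ∀ n, O ⟶ K.obj n) : modSheaf O ⟶ (ext0 (modCo K)).X 0 :=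
  (sheafCompose J (algToMod k)).map (f (SimplexCategory.mk 0)) ≫ (ext0XIso (modCo K) 0).inv

lemma modCoAug_extendMap {K' : SimplexCategory ⥤ Sheaf J (CommAlgCat.{u} k)} (g : K ⟶ K')
    (f : ∀ n, O ⟶ K.obj n) : modCoAug f ≫ (HomologicalComplex.extendMap (modCoMap g)
      ComplexShape.embeddingUpNat).f 0 = modCoAug fun n => f n ≫ g.app n := by
  have h := HomologicalComplex.extendMap_f (modCoMap g) ComplexShape.embeddingUpNat
    (i := 0) (i' := ((0 : ℕ) : ℤ)) rfl
  have h' : (ext0XIso (modCo K) 0).inv ≫ (HomologicalComplex.extendMap (modCoMap g)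
      ComplexShape.embeddingUpNat).f ((0 : ℕ) : ℤ) =
        (modCoMap g).f 0 ≫ (ext0XIso (modCo K') 0).inv := by
    rw [Iso.inv_comp_eq]
    exact h
  refine (Category.assoc _ _ _).trans ((congrArg (_ ≫ ·) h').trans ?_)
  refine (Category.assoc _ _ _).symm.trans (congrArg (· ≫ (ext0XIso (modCo K') 0).inv) ?_)
  exact ((sheafCompose J (algToMod k)).map_comp _ _).symm

/-- The augmentation of the normalized complex given by a coaugmentation. -/
noncomputable def secAug (f : ∀ n, O ⟶ K.obj n)
    (hf : ∀ {n n'} (θ : n ⟶ n'), f n ≫ K.map θ = f n') (U : Cᵒᵖ) (o : O.obj.obj U) :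
    NC ((secAlg K).obj U) 0 :=
  NC.const _ (fun m => ((f (SimplexCategory.mk m)).hom.app U).hom o) fun _ _ θ =>
    congrArg (fun f => (f.hom.app U).hom o) (hf (SimplexCategory.mkHom θ))

lemma topEval_const (A : SimplexCategory ⥤ CommAlgCat.{u} k) (c : ∀ m, lev A m)
    (hc : ∀ (m l : ℕ) (θ : Fin (m + 1) →o Fin (l + 1)), levMap A θ (c m) = c l) :
    topEval A 0 (NC.const A c hc) = c 0 := by
  have h : fdeg (topFace 0) = 0 := by simp [fdeg, topFace]
  change (if fdeg (topFace 0) = 0 then c 0 else 0) = c 0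
  exact if_pos h

variable (f : ∀ n, O ⟶ K.obj n) (hf : ∀ {n n'} (θ : n ⟶ n'), f n ≫ K.map θ = f n')

/-- The sign `eps` is `1` in degree `0`, so the augmentations correspond exactly and not only up to
sign. -/
lemma theta_secAug (U : Cᵒᵖ) (o : O.obj.obj U) :
    (((theta K).app U).f 0).hom (secAug f hf U o) = ((modCoAug f).hom.app U).hom o := by
  have h : (thetaTop K U 0).hom (secAug f hf U o) =
      ((f (SimplexCategory.mk 0)).hom.app U).hom o := by
    refine (thetaTop_apply K U 0 _).trans ?_
    rw [eps, one_smul]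
    exact topEval_const _ _ _
  exact congrArg ((ext0XIso (modCo K) 0).inv.hom.app U).hom h

lemma rho_modCoAug (U : Cᵒᵖ) (o : O.obj.obj U) :
    (((rho K).app U).f 0).hom (((modCoAug f).hom.app U).hom o) = secAug f hf U o := by
  refine (congrArg (((rho K).app U).f 0).hom (theta_secAug f hf U o)).symm.trans ?_
  exact congrArg (fun g => ((g.app U).f 0).hom (secAug f hf U o)) (theta_rho K)

end augmentation

/-! ### Comparison maps from the Godement complex to injective resolutions. -/

section comparison
variable {k : Type u} [Field k] {C : Type u} [SmallCategory C] {J : GrothendieckTopology C}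
  {S : Type u} {p : S → GrothendieckTopology.Point.{u} J}
  (hp : (ObjectProperty.ofObj p).IsConservativeFamilyOfPoints) (O : Sheaf J (CommAlgCat.{u} k))

lemma injAug_godementInj : injAug (godementInj p hp O) =
    modCoAug (K := (cosimp (godementMonad p _)).obj O) (coaug (godementMonad p _) O) := by
  have h : (HomologicalComplex.singleObjXSelf (ComplexShape.up ℕ) 0 (modSheaf O)).inv ≫
      (constAug (modSheaf O)).f 0 = 𝟙 _ :=
    (congrArg (_ ≫ ·) (constAug_f_zero (modSheaf O))).trans (Category.comp_id _)
  have h2 : (HomologicalComplex.singleObjXSelf (ComplexShape.up ℕ) 0 (modSheaf O)).inv ≫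
      (godementInj p hp O).ι.f 0 = (godementCoaug p O).app (SimplexCategory.mk 0) := by
    refine (Category.assoc _ _ _).symm.trans ?_
    exact (congrArg (· ≫ (godementCoaug p O).app (SimplexCategory.mk 0)) h).trans
      (Category.id_comp _)
  refine (Category.assoc _ _ _).symm.trans ?_
  exact congrArg (· ≫ (ext0XIso (modCo ((cosimp (godementMonad p _)).obj O)) 0).inv) h2

/-- The comparison with the resolution by the alternating coface complex. -/
noncomputable def godementComparison : GodementComparison p O where
  res := godementInj p hp O
  map := theta ((cosimp (godementMonad p _)).obj O)
  map_aug U o := by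
    refine (theta_secAug (coaug (godementMonad p _) O) (coaug_map _ O) U o).trans ?_
    exact congrArg (fun g => (g.hom.app U).hom o) (injAug_godementInj hp O).symm

variable {O}

include hp in
-- The complex of presheaves `N G^• O` does not itself fall under the theory of injective
-- resolutions. Precomposition with `rho` turns the comparison into a map between two injective
-- resolutions that respects augmentations, hence a homotopy equivalence; and `rho` is a
-- quasi-isomorphism on sections.
lemma quasiIso_godementComparison (R : GodementComparison p O) (U : Cᵒᵖ) :
    QuasiIso (R.map.app U) := by
  let K := (cosimp (godementMonad p _)).obj O
  let γ : (godementInj p hp O).cochainComplex ⟶ R.res.cochainComplex :=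
    ofSections (rho K ≫ R.map)
  have h : injAug (godementInj p hp O) ≫ γ.f 0 = injAug R.res := by
    rw [injAug_godementInj]
    ext U : 3
    refine ModuleCat.hom_ext (LinearMap.ext fun o => ?_)
    refine Eq.trans ?_ (R.map_aug U o)
    exact congrArg ((R.map.app U).f 0).hom
      (rho_modCoAug (coaug (godementMonad p _) O) (coaug_map _ O) U o)
  have h1 : QuasiIso ((rho K).app U ≫ R.map.app U) :=
    quasiIso_sections γ (quasiIso_of_injAug γ h) U
  exact (quasiIso_iff_comp_left ((rho K).app U) (R.map.app U)).1 h1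

end comparison
-- Direct images of resolutions.
section pushforward
variable {k : Type u} [Field k] {C C' : Type u} [SmallCategory C] [SmallCategory C']
  {J : GrothendieckTopology C} {J' : GrothendieckTopology C'} (F : C' ⥤ C) [F.IsContinuous J' J]

instance : (F.sheafPushforwardContinuous (ModuleCat.{u} k) J' J).Additive where
  map_add := rfl

/-- The direct image of a complex of sheaves. -/
noncomputable abbrev pushComplex (I : CochainComplex (Sheaf J (ModuleCat.{u} k)) ℤ) :
    CochainComplex (Sheaf J' (ModuleCat.{u} k)) ℤ :=
  ((F.sheafPushforwardContinuous (ModuleCat.{u} k) J' J).mapHomologicalComplex _).obj I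

/-- The direct image of a cosimplicial sheaf of algebras. -/
noncomputable abbrev pushCosimp (K : SimplexCategory ⥤ Sheaf J (CommAlgCat.{u} k)) :
    SimplexCategory ⥤ Sheaf J' (CommAlgCat.{u} k) :=
  K ⋙ F.sheafPushforwardContinuous (CommAlgCat.{u} k) J' J

variable {S S' : Type u} {p : S → GrothendieckTopology.Point.{u} J}
  (hp : (ObjectProperty.ofObj p).IsConservativeFamilyOfPoints)
  {p' : S' → GrothendieckTopology.Point.{u} J'}
  (hp' : (ObjectProperty.ofObj p').IsConservativeFamilyOfPoints)
  [PreservesFiniteLimits (F.sheafPullback (Type u) J' J)]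
  {O : Sheaf J (CommAlgCat.{u} k)} {O' : Sheaf J' (CommAlgCat.{u} k)}

lemma isKInjective_extend {𝒟 : Type*} [Category 𝒟] [Abelian 𝒟] (M : CochainComplex 𝒟 ℕ)
    (h : ∀ n, Injective (M.X n)) :
    CochainComplex.IsKInjective (M.extend ComplexShape.embeddingUpNat) := by
  have (n : ℤ) : Injective ((M.extend ComplexShape.embeddingUpNat).X n) := by
    cases n with
    | ofNat n => exact Injective.of_iso (M.extendXIso ComplexShape.embeddingUpNat rfl).symm (h n)
    | negSucc n =>
      refine Injective.of_iso (IsZero.isoZero ?_).symm inferInstance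
      exact M.isZero_extend_X ComplexShape.embeddingUpNat _ (fun i h => by
        have : (i : ℤ) = Int.negSucc n := h
        omega)
  have : CochainComplex.IsStrictlyGE (M.extend ComplexShape.embeddingUpNat) 0 := inferInstance
  exact CochainComplex.isKInjective_of_injective _ 0

include hp in
lemma isKInjective_pushComplex {Z : Sheaf J (ModuleCat.{u} k)} (R : InjectiveResolution Z) :
    (pushComplex (J' := J') F R.cochainComplex).IsKInjective := by
  have (n : ℤ) : Injective ((pushComplex (J' := J') F R.cochainComplex).X n) :=
    injective_pushforward p hp F (R.cochainComplex.X n)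
  exact CochainComplex.isKInjective_of_injective _ 0

include hp in
-- Although `f_* I` need not resolve `f_* O`, it is K-injective, and this suffices to extend `O' →
-- f_* O → f_* I^0` over the resolution of `O'`.
lemma exists_resolutionLift (φ : O' ⟶ (F.sheafPushforwardContinuous (CommAlgCat.{u} k) J' J).obj O)
    (R' : InjectiveResolution (modSheaf O')) (R : InjectiveResolution (modSheaf O)) :
    Nonempty (ResolutionLift F φ R' R) := by
  have := isKInjective_pushComplex (J' := J') F hp R
  let L := pushComplex (J' := J') F R.cochainComplex
  let z : modSheaf O' ⟶ L.X 0 := (sheafCompose J' (algToMod k)).map φ ≫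
    (F.sheafPushforwardContinuous (ModuleCat.{u} k) J' J).map (injAug R)
  have hz : z ≫ L.d 0 1 = 0 := by
    have h : (F.sheafPushforwardContinuous (ModuleCat.{u} k) J' J).map (injAug R) ≫ L.d 0 1 = 0 :=
      congrArg (F.sheafPushforwardContinuous (ModuleCat.{u} k) J' J).map (injAug_d R)
    exact (Category.assoc _ _ _).trans ((congrArg (_ ≫ ·) h).trans comp_zero)
  obtain ⟨g, hg⟩ := exists_lift_of_injAug z hz
  exact ⟨{ map := sectionsMap g
           map_aug U o := congrArg (fun g => (g.hom.app (op U)).hom o) hg }⟩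

variable (p') in
include hp' in
-- Injective terms make both alternating coface complexes K-injective, so the quasi-isomorphism of
-- complexes of sheaves is a homotopy equivalence and survives on sections. The natural
-- quasi-isomorphism `theta` carries this over to the normalized complexes.
lemma quasiIso_secNMap_diagAug (K : SimplexCategory ⥤ Sheaf J' (CommAlgCat.{u} k))
    (hK : ∀ n, Injective ((modCo K).X n)) (U : C'ᵒᵖ) :
    QuasiIso ((secNMap (diagAug (godementMonad p' _) K)).app U) := by
  let g := HomologicalComplex.extendMap (modCoMap (diagAug (godementMonad p' _) K))
    ComplexShape.embeddingUpNat
  have h1 := isKInjective_extend (modCo K) hK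
  have h2 := isKInjective_extend (modCo (diagRes (godementMonad p' _) K))
    (injective_modCo_diagRes p' K)
  have h3 := quasiIso_modCoMap_diagAug p' hp' K
  have h4 : QuasiIso g := inferInstance
  have h5 := quasiIso_sections g ((CochainComplex.IsKInjective.quasiIso_iff g).1 h4) U
  have h6 : QuasiIso ((theta K).app U ≫ (sectionsMap g).app U) := inferInstance
  have h7 := NatTrans.congr_app (theta_naturality (diagAug (godementMonad p' _) K)) U
  have h8 : QuasiIso ((secNMap (diagAug (godementMonad p' _) K)).app U ≫
      (theta (diagRes (godementMonad p' _) K)).app U) := by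
    have h9 := h7.symm
    rw [NatTrans.comp_app, NatTrans.comp_app] at h9
    rw [h9]
    exact h6
  exact (quasiIso_iff_comp_right _ ((theta (diagRes (godementMonad p' _) K)).app U)).1 h8

include hp in
lemma injective_modCo_pushCosimp (K : SimplexCategory ⥤ Sheaf J (CommAlgCat.{u} k))
    (hK : ∀ n, Injective ((modCo K).X n)) (n : ℕ) :
    Injective ((modCo (pushCosimp (J' := J') F K)).X n) :=
  have := hK n
  injective_pushforward p hp F ((modCo K).X n)

end pushforward
-- The zigzag through the Godement resolution of `f_* G^• O`.
section derived
variable {k : Type u} [Field k] {C C' : Type u} [SmallCategory C] [SmallCategory C']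
  {J : GrothendieckTopology C} {J' : GrothendieckTopology C'}
  {S S' : Type u} (p : S → GrothendieckTopology.Point.{u} J)
  (p' : S' → GrothendieckTopology.Point.{u} J')
  (hp : (ObjectProperty.ofObj p).IsConservativeFamilyOfPoints)
  (hp' : (ObjectProperty.ofObj p').IsConservativeFamilyOfPoints)
  {O : Sheaf J (CommAlgCat.{u} k)} {O' : Sheaf J' (CommAlgCat.{u} k)}

/-- Each term of the Godement resolution is a product of skyscrapers, so the restriction is already
an isomorphism of cosimplicial algebras. -/
lemma isIso_secN_map {Y Z : C} (g : Z ⟶ Y) (hg : ∀ s, IsIso ((p s).fiber.map g)) :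
    IsIso ((secN ((cosimp (godementMonad p _)).obj O)).map g.op) := by
  have (n : SimplexCategory) :
      IsIso (((secAlg ((cosimp (godementMonad p _)).obj O)).map g.op).app n) :=
    isIso_skyscrapers_map p ((stalks p _).obj (iter (godementMonad p _) n.len O)) g hg
  have : IsIso ((secAlg ((cosimp (godementMonad p _)).obj O)).map g.op) :=
    NatIso.isIso_of_isIso_app _
  exact inferInstanceAs (IsIso ((NC.functor k ⋙ DGOperad.Alg.forget (ezOperad k)).map
    ((secAlg ((cosimp (godementMonad p _)).obj O)).map g.op)))

variable (F : C' ⥤ C) [F.IsContinuous J' J]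
  (φ : O' ⟶ (F.sheafPushforwardContinuous (CommAlgCat.{u} k) J' J).obj O)

/-- The direct image of the Godement resolution. -/
noncomputable abbrev pushGodement (J' : GrothendieckTopology C') (F : C' ⥤ C) [F.IsContinuous J' J]
    (O : Sheaf J (CommAlgCat.{u} k)) : SimplexCategory ⥤ Sheaf J' (CommAlgCat.{u} k) :=
  pushCosimp F ((cosimp (godementMonad p _)).obj O)

/-- The coaugmentation of the direct image of the Godement resolution. -/
noncomputable def pushCoaug (n : SimplexCategory) : O' ⟶ (pushGodement p J' F O).obj n :=
  φ ≫ (F.sheafPushforwardContinuous (CommAlgCat.{u} k) J' J).map (coaug (godementMonad p _) O n)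

lemma pushCoaug_map {n n' : SimplexCategory} (θ : n ⟶ n') :
    pushCoaug p F φ n ≫ (pushGodement p J' F O).map θ = pushCoaug p F φ n' := by
  refine (Category.assoc _ _ _).trans (congrArg (φ ≫ ·) ?_)
  exact ((F.sheafPushforwardContinuous (CommAlgCat.{u} k) J' J).map_comp _ _).symm.trans
    (congrArg _ (coaug_map (godementMonad p _) O θ))

/-- The Godement resolution of the direct image of the Godement resolution. -/
noncomputable abbrev doubleGodement (O : Sheaf J (CommAlgCat.{u} k)) :
    SimplexCategory ⥤ Sheaf J' (CommAlgCat.{u} k) :=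
  diagRes (godementMonad p' _) (pushGodement p J' F O)

/-- The map from the Godement resolution on the target. -/
noncomputable def fromTarget : (cosimp (godementMonad p' _)).obj O' ⟶ doubleGodement p p' F O :=
  diagOfConst (godementMonad p' _) (K := pushGodement p J' F O) (pushCoaug p F φ) (pushCoaug_map p F φ)

/-- The map from the direct image of the Godement resolution on the source. -/
noncomputable def fromSource : pushGodement p J' F O ⟶ doubleGodement p p' F O :=
  diagAug (godementMonad p' _) (pushGodement p J' F O)

lemma modCoAug_d {K : SimplexCategory ⥤ Sheaf J (CommAlgCat.{u} k)} (f : ∀ n, O ⟶ K.obj n)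
    (hf : ∀ {n n'} (θ : n ⟶ n'), f n ≫ K.map θ = f n') :
    modCoAug f ≫ (ext0 (modCo K)).d 0 1 = 0 := by
  have h1 : (sheafCompose J (algToMod k)).map (f (SimplexCategory.mk 0)) ≫ (modCo K).d 0 1 = 0 :=
    coAlt_d_zero_comp (K ⋙ sheafCompose J (algToMod k))
      (fun n => (sheafCompose J (algToMod k)).map (f n)) fun θ =>
        ((sheafCompose J (algToMod k)).map_comp _ _).symm.trans
          (congrArg (sheafCompose J (algToMod k)).map (hf θ))
  refine (Category.assoc _ _ _).trans ((congrArg (_ ≫ ·) (ext0XIso_inv_d (modCo K) 0)).trans ?_)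
  refine (Category.assoc _ _ _).symm.trans ?_
  exact (congrArg (· ≫ (ext0XIso (modCo K) 1).inv) h1).trans zero_comp

/-- The map of complexes given by a coaugmentation. -/
noncomputable def fromSingle {K : SimplexCategory ⥤ Sheaf J (CommAlgCat.{u} k)} (f : ∀ n, O ⟶ K.obj n)
    (hf : ∀ {n n'} (θ : n ⟶ n'), f n ≫ K.map θ = f n') :
    (CochainComplex.singleFunctor _ 0).obj (modSheaf O) ⟶ ext0 (modCo K) :=
  HomologicalComplex.mkHomFromSingle (modCoAug f) (by
    intro i hi
    obtain rfl : 0 + 1 = i := hi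
    exact modCoAug_d f hf)

lemma fromSingle_f_zero {K : SimplexCategory ⥤ Sheaf J (CommAlgCat.{u} k)} (f : ∀ n, O ⟶ K.obj n)
    (hf : ∀ {n n'} (θ : n ⟶ n'), f n ≫ K.map θ = f n') :
    (fromSingle f hf).f 0 = (singleZeroIso (modSheaf O)).hom ≫ modCoAug f :=
  HomologicalComplex.mkHomFromSingle_f _ _

variable [PreservesFiniteLimits (F.sheafPullback (Type u) J' J)]
variable {p p' F φ}

include hp hp' in
-- The map `β` extends the direct image of `R.map` along the quasi-isomorphism `fromSource`, which
-- is possible since `f_* I` is K-injective. The second homotopy comes for free: maps from a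
-- resolution of `O'` to `f_* I` are determined up to homotopy by their restrictions to `O'`, where
-- `fromTarget` and `fromSource` agree and `t` lifts `φ`.
lemma exists_extension (R' : GodementComparison p' O') (R : GodementComparison p O)
    (t : ResolutionLift F φ R'.res R.res) :
    ∃ β : ext0 (modCo (doubleGodement p p' F O)) ⟶ pushComplex (J' := J') F R.res.cochainComplex,
      Nonempty (Homotopy (HomologicalComplex.extendMap (modCoMap (fromSource p p' F (O := O)))
        ComplexShape.embeddingUpNat ≫ β)
          (ofSections (rho (pushGodement p J' F O) ≫ Functor.whiskerLeft F.op R.map))) ∧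
      Nonempty (Homotopy (HomologicalComplex.extendMap (modCoMap (fromTarget p p' F φ))
        ComplexShape.embeddingUpNat ≫ β)
          (ofSections (rho ((cosimp (godementMonad p' _)).obj O') ≫ R'.map ≫ t.map))) := by
  have hL := isKInjective_pushComplex (J' := J') F hp R.res
  let b := HomologicalComplex.extendMap (modCoMap (fromSource p p' F (O := O)))
    ComplexShape.embeddingUpNat
  let a : (godementInj p' hp' O').cochainComplex ⟶ ext0 (modCo (doubleGodement p p' F O)) :=
    HomologicalComplex.extendMap (modCoMap (fromTarget p p' F φ)) ComplexShape.embeddingUpNat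
  let β₂ : ext0 (modCo (pushGodement p J' F O)) ⟶ pushComplex F R.res.cochainComplex :=
    ofSections (rho (pushGodement p J' F O) ≫ Functor.whiskerLeft F.op R.map)
  let α : (godementInj p' hp' O').cochainComplex ⟶ pushComplex F R.res.cochainComplex :=
    ofSections (rho ((cosimp (godementMonad p' _)).obj O') ≫ R'.map ≫ t.map)
  have h1 : QuasiIso (modCoMap (fromSource p p' F (O := O))) := quasiIso_modCoMap_diagAug p' hp' _
  have h2 : QuasiIso b := inferInstance
  obtain ⟨β, ⟨hβ⟩⟩ := exists_extension_of_quasiIso b β₂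
  refine ⟨β, ⟨hβ⟩, ?_⟩
  let κ := fromSingle (pushCoaug p F φ) (pushCoaug_map p F φ)
  -- Both sides are the coaugmentation of the diagonal on `O'`, by `coaug_diagOfConst`.
  have hκ : (godementInj p' hp' O').ι' ≫ a = κ ≫ b := ι'_comp_eq (by
    rw [HomologicalComplex.comp_f, HomologicalComplex.comp_f, ι'_f_zero_eq_injAug,
      fromSingle_f_zero, Category.assoc, Category.assoc, injAug_godementInj]
    refine congrArg ((singleZeroIso (modSheaf O')).hom ≫ ·) ?_
    refine (modCoAug_extendMap (fromTarget p p' F φ) _).trans ?_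
    refine Eq.trans ?_ (modCoAug_extendMap (fromSource p p' F (O := O)) _).symm
    exact congrArg modCoAug (funext fun n => coaug_diagOfConst (godementMonad p' _)
      (K := pushGodement p J' F O) (pushCoaug p F φ) (pushCoaug_map p F φ) n))
  -- On a section `o` of `O'` both sides are the augmentation of `φ o` in `f_* I`; this combines the
  -- augmentation conditions on `R`, `t` and `R'`.
  have hκ' : κ ≫ β₂ = (godementInj p' hp' O').ι' ≫ α := ι'_comp_eq (by
    rw [HomologicalComplex.comp_f, HomologicalComplex.comp_f, ι'_f_zero_eq_injAug,
      fromSingle_f_zero, Category.assoc, Category.assoc, injAug_godementInj]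
    refine congrArg ((singleZeroIso (modSheaf O')).hom ≫ ·) ?_
    ext U : 3
    refine ModuleCat.hom_ext (LinearMap.ext fun o => ?_)
    refine (congrArg ((R.map.app (op (F.obj U.unop))).f 0).hom
      (rho_modCoAug (pushCoaug p F φ) (pushCoaug_map p F φ) U o)).trans ?_
    refine (R.map_aug (op (F.obj U.unop)) ((φ.hom.app U).hom o)).trans ?_
    refine (t.map_aug U.unop o).symm.trans ?_
    refine congrArg ((t.map.app U).f 0).hom ?_
    refine (R'.map_aug U o).symm.trans ?_
    exact congrArg ((R'.map.app U).f 0).hom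
      (rho_modCoAug (coaug (godementMonad p' _) O') (coaug_map _ O') U o).symm)
  -- It suffices to compare on `O'`, where `a` may be replaced by `b`, and `β` after `b` by `β₂`.
  refine homotopic_of_quasiIso (godementInj p' hp' O').ι' (a ≫ β) α ⟨?_⟩
  refine (Homotopy.ofEq ?_).trans ((hβ.compLeft κ).trans (Homotopy.ofEq hκ'))
  exact (Category.assoc _ _ _).symm.trans ((congrArg (· ≫ β) hκ).trans (Category.assoc _ _ _))

end derived
-- The comparison on sections of normalized complexes.
section derived
variable {k : Type u} [Field k] {C C' : Type u} [SmallCategory C] [SmallCategory C']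
  {J : GrothendieckTopology C} {J' : GrothendieckTopology C'}
  {S S' : Type u} {p : S → GrothendieckTopology.Point.{u} J}
  {p' : S' → GrothendieckTopology.Point.{u} J'}
  (hp : (ObjectProperty.ofObj p).IsConservativeFamilyOfPoints)
  (hp' : (ObjectProperty.ofObj p').IsConservativeFamilyOfPoints)
  {O : Sheaf J (CommAlgCat.{u} k)} {O' : Sheaf J' (CommAlgCat.{u} k)}
  {F : C' ⥤ C} [F.IsContinuous J' J] [PreservesFiniteLimits (F.sheafPullback (Type u) J' J)]
  {φ : O' ⟶ (F.sheafPushforwardContinuous (CommAlgCat.{u} k) J' J).obj O}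

/-- Transports homotopies between maps of complexes of sheaves back to normalized complexes: the
factor `rho` disappears because `theta ≫ rho` is the identity. -/
lemma homotopy_theta_comp {K K' : SimplexCategory ⥤ Sheaf J (CommAlgCat.{u} k)} (f : K ⟶ K')
    {L : CochainComplex (Sheaf J (ModuleCat.{u} k)) ℤ} (β : ext0 (modCo K') ⟶ L)
    (r : secN K ⟶ sectionsComplex L)
    (h : Nonempty (Homotopy (HomologicalComplex.extendMap (modCoMap f)
      ComplexShape.embeddingUpNat ≫ β) (ofSections (rho K ≫ r)))) (U : Cᵒᵖ) :
    Nonempty (Homotopy ((secNMap f).app U ≫ (theta K' ≫ sectionsMap β).app U) (r.app U)) := by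
  obtain ⟨h⟩ := h
  have h1 : secNMap f ≫ theta K' ≫ sectionsMap β =
      theta K ≫ sectionsMap (HomologicalComplex.extendMap (modCoMap f)
        ComplexShape.embeddingUpNat ≫ β) := by
    rw [← Category.assoc, ← theta_naturality, Category.assoc]
    rfl
  have h2 : theta K ≫ rho K ≫ r = r := by
    rw [← Category.assoc, theta_rho, Category.id_comp]
  exact ⟨(Homotopy.ofEq (NatTrans.congr_app h1 U)).trans
    (((sectionsHomotopy h U).compLeft ((theta K).app U)).trans
      (Homotopy.ofEq (NatTrans.congr_app h2 U)))⟩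

include hp hp' in
lemma exists_comparison (R' : GodementComparison p' O') (R : GodementComparison p O)
    (t : ResolutionLift F φ R'.res R.res) (U : C') :
    ∃ m : (secN (doubleGodement p p' F O)).obj (op U) ⟶
        (sectionsComplex R.res.cochainComplex).obj (op (F.obj U)),
      Nonempty (Homotopy ((secNMap (fromSource p p' F)).app (op U) ≫ m)
        (R.map.app (op (F.obj U)))) ∧
      Nonempty (Homotopy ((secNMap (fromTarget p p' F φ)).app (op U) ≫ m)
        (R'.map.app (op U) ≫ t.map.app (op U))) := by
  obtain ⟨β, h1, h2⟩ := exists_extension hp hp' R' R t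
  exact ⟨(theta _ ≫ sectionsMap β).app (op U),
    homotopy_theta_comp (fromSource p p' F) β (Functor.whiskerLeft F.op R.map) h1 (op U),
    homotopy_theta_comp (fromTarget p p' F φ) β (R'.map ≫ t.map) h2 (op U)⟩

include hp hp' in
-- The terms `f_* G^{n+1} O` are injective, as direct images of products of skyscrapers, so the
-- result on the diagonal applies to sections.
lemma quasiIso_fromSource (U : C') : QuasiIso ((secNMap (fromSource p p' F (O := O))).app (op U)) :=
  quasiIso_secNMap_diagAug p' hp' _ (injective_modCo_pushCosimp F hp _ (injective_modCo_cosimp p O))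
    (op U)

end derived
end EInf

theorem mainTheorem5 {k : Type u} [Field k] [HasDerivedCategory.{w} (ModuleCat.{u} k)]
    (E : DGOperad k) (hE : E.IsEInfinity) (η : DGOperad.Hom E (ezOperad k))
    {C C' : Type u} [SmallCategory C] [SmallCategory C']
    (J : GrothendieckTopology C) (J' : GrothendieckTopology C')
    {S S' : Type u} (p : S → GrothendieckTopology.Point.{u} J)
    (p' : S' → GrothendieckTopology.Point.{u} J')
    (hp : (ObjectProperty.ofObj p).IsConservativeFamilyOfPoints)
    (hp' : (ObjectProperty.ofObj p').IsConservativeFamilyOfPoints)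
    (X : C) (hX : IsTerminal X) (X' : C') (hX' : IsTerminal X')
    (O : Sheaf J (CommAlgCat.{u} k)) (O' : Sheaf J' (CommAlgCat.{u} k))
    (F : C' ⥤ C) [F.IsContinuous J' J]
    [PreservesFiniteLimits (F.sheafPullback (Type u) J' J)]
    (φ : O' ⟶ (F.sheafPushforwardContinuous (CommAlgCat.{u} k) J' J).obj O) :
    (∃ (B : E.Alg) (a : (godementRes p' η O').obj (op X') ⟶ B)
        (b : (godementRes p η O).obj (op X) ⟶ B),
      QuasiIso b.hom ∧
      ∃ ψ : DerivedCategory.Q.obj ((godementRes p' η O').obj (op X')).cpx ⟶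
          DerivedCategory.Q.obj ((godementRes p η O).obj (op X)).cpx,
        ψ ≫ DerivedCategory.Q.map b.hom = DerivedCategory.Q.map a.hom ∧
        ∀ (R' : GodementComparison p' O') (R : GodementComparison p O)
          (t : ResolutionLift F φ R'.res R.res),
          DerivedCategory.Q.map (R'.map.app (op X')) ≫ DerivedCategory.Q.map (t.map.app (op X')) =
            ψ ≫ DerivedCategory.Q.map (R.map.app (op X)) ≫ DerivedCategory.Q.map
              ((sectionsComplex R.res.cochainComplex).map (hX.from (F.obj X')).op)) ∧
    (∀ R : GodementComparison p O, QuasiIso (R.map.app (op X))) ∧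
    (∀ R' : GodementComparison p' O', QuasiIso (R'.map.app (op X'))) ∧
    Nonempty (GodementComparison p O) ∧ Nonempty (GodementComparison p' O') ∧
    ∀ (R' : InjectiveResolution (modSheaf O')) (R : InjectiveResolution (modSheaf O)),
      Nonempty (ResolutionLift F φ R' R) := by
  refine ⟨?_, fun R => quasiIso_godementComparison hp R _,
    fun R' => quasiIso_godementComparison hp' R' _, ⟨godementComparison hp O⟩,
    ⟨godementComparison hp' O'⟩, exists_resolutionLift F hp φ⟩
  -- Sections of `f_* G^• O` over `X'` are sections of `G^• O` over `F.obj X'`, so `b` has to begin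
  -- with the restriction along `g`.
  let g : F.obj X' ⟶ X := hX.from (F.obj X')
  let secMap {K K' : SimplexCategory ⥤ Sheaf J' (CommAlgCat.{u} k)} (f : K ⟶ K') :
      (secAlg K).obj (op X') ⟶ (secAlg K').obj (op X') :=
    ((flipFunctor _ _ _).map (Functor.whiskerRight f (sheafToPresheaf J' _))).app (op X')
  let a : (godementRes p' η O').obj (op X') ⟶ (DGOperad.Alg.restrict η).obj
      ((NC.functor k).obj ((secAlg (doubleGodement p p' F O)).obj (op X'))) :=
    (DGOperad.Alg.restrict η).map ((NC.functor k).map (secMap (fromTarget p p' F φ)))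
  let b : (godementRes p η O).obj (op X) ⟶ (DGOperad.Alg.restrict η).obj
      ((NC.functor k).obj ((secAlg (doubleGodement p p' F O)).obj (op X'))) :=
    (godementRes p η O).map g.op ≫
      (DGOperad.Alg.restrict η).map ((NC.functor k).map (secMap (fromSource p p' F)))
  let r := (secN ((cosimp (godementMonad p _)).obj O)).map g.op
  let s : (secN ((cosimp (godementMonad p _)).obj O)).obj (op (F.obj X')) ⟶
      (secN (doubleGodement p p' F O)).obj (op X') := (secNMap (fromSource p p' F (O := O))).app (op X')
  -- On complexes `b` is `r` followed by `s`: an isomorphism by the singleton fibers, then a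
  -- quasi-isomorphism by the theorem on the diagonal.
  have hr : IsIso r := isIso_secN_map p g fun s => isIso_fiber_map J' F (p s) hX hX' g
  have hs : QuasiIso s := quasiIso_fromSource hp hp' X'
  have hb : QuasiIso b.hom := inferInstanceAs (QuasiIso (r ≫ s))
  have hQ : IsIso (DerivedCategory.Q.map b.hom) := inferInstance
  refine ⟨_, a, b, hb, DerivedCategory.Q.map a.hom ≫ inv (DerivedCategory.Q.map b.hom), by simp,
    fun R' R t => ?_⟩
  -- The map `m` from `B` to `I(u(X'))` closes the diagram: up to homotopy `a` followed by `m` is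
  -- `e'` followed by `t`, and `s` followed by `m` is `e` over `u(X')`. The zigzag itself does not
  -- depend on `R'`, `R` and `t`; only `m` does.
  obtain ⟨m, ⟨h1⟩, ⟨h2⟩⟩ := exists_comparison hp hp' R' R t X'
  have e1 := DerivedCategory.Q_map_eq_of_homotopy _ h2
  have e2 := DerivedCategory.Q_map_eq_of_homotopy _ (h1.compLeft r)
  -- The naturality of `e` in the object moves the restriction from `I` to the Godement complex,
  -- where it is part of `b`.
  have e3 : R.map.app (op X) ≫ (sectionsComplex R.res.cochainComplex).map g.op =
      r ≫ R.map.app (op (F.obj X')) := (R.map.naturality g.op).symm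
  have e4 : DerivedCategory.Q.map (R.map.app (op X)) ≫ DerivedCategory.Q.map
      ((sectionsComplex R.res.cochainComplex).map g.op) =
        DerivedCategory.Q.map b.hom ≫ DerivedCategory.Q.map m := by
    refine (DerivedCategory.Q.map_comp _ _).symm.trans ((congrArg _ e3).trans (e2.symm.trans ?_))
    exact (congrArg _ (Category.assoc r s m).symm).trans (DerivedCategory.Q.map_comp _ _)
  have e5 {x y z w : DerivedCategory (ModuleCat.{u} k)} (f : x ⟶ z) (g : y ⟶ z) [IsIso g]
      (h : z ⟶ w) : (f ≫ inv g) ≫ g ≫ h = f ≫ h := by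
    rw [Category.assoc, IsIso.inv_hom_id_assoc]
  refine (DerivedCategory.Q.map_comp _ _).symm.trans (e1.symm.trans ?_)
  refine (DerivedCategory.Q.map_comp _ _).trans ?_
  refine Eq.trans ?_ (congrArg (_ ≫ ·) e4).symm
  exact (e5 (DerivedCategory.Q.map a.hom) (DerivedCategory.Q.map b.hom) _).symm
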